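/- **Geometry.** Let $\gamma>3$, $\beta>2$, $g>0$, $d_0,r_0>0$ and $$0<\alpha<\min\Big\{\frac{3(\gamma-3)}{4\gamma+3},\ \frac{3(\beta-2)}{9\beta+2}\Big\}.$$ Let $\Omega\subset\mathbb R^3$ be a bounded $C^{1,\alpha}$ domain whose boundary is flat near the origin: for some $\ell>0$, a point with $|x_1|,|x_2|\le 2r_0$, $|x_3|<\ell$ lies in $\Omega$ iff $x_3>0$. Let $B\subset\mathbb R^3$ be a compact body, the closure of its interior, which is a bounded $C^{1,\alpha}$ domain; $B$ is rotationally symmetric about the $x_3$-axis, and with $r=\sqrt{x_1^2+x_2^2}$ its lower boundary for $r\le 2r_0$ is the graph $x_3=r^{1+\alpha}$. The solid at height $h$ is $B+h\mathbf e_3$. Write $\mathcal S(t)=B+h(t)\mathbf e_3$, $\mathcal F(t)=\Omega\setminus\mathcal S(t)$, where $h(0)>0$ and $\mathcal S(0)\subset\Omega$. The solid moves by a vertical translation and possibly a rotation about the $x_3$-axis, has constant density $\rho_s>0$, mass $m=\rho_s|B|$, inertial tensor $\mathbb J$, and initial translational and angular velocities $\mathbf V_0,\omega_0$. **Fluid.**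 The fluid has stress $\mathbb S=2\mu(\vartheta)\big(\mathbb D(\mathbf u)-\tfrac13\operatorname{div}\mathbf u\,\mathbb I\big)+\eta(\vartheta)\operatorname{div}\mathbf u\,\mathbb I$, where on $(0,\infty)$ $\mu$ is Lipschitz, $\eta$ is continuous, $1+s\lesssim\mu(s)$ and $0\le\eta(s)\lesssim1+s$; heat flux $\mathbf q=-\kappa(\vartheta)\nabla\vartheta$ with $\kappa(s)\sim1+s^\beta$; pressure $p=\rho^\gamma+\rho\vartheta+\vartheta^4$; internal energy $e=\frac{\rho^{\gamma-1}}{\gamma-1}+3\frac{\vartheta^4}{\rho}+c_v\vartheta$ and specific entropy $s=4\frac{\vartheta^3}{\rho}+\log\frac{\vartheta^{c_v}}{\rho}$, $c_v>0$. In the solid, $\rho=\rho_s$, $\mathbf u$ is the rigid velocity, $\vartheta$ is the solid's temperature, the heat conductivity is the same $\kappa$, and internal energy and entropy are functions of $\vartheta$ related by Gibbs' relation. The force is gravity, $-g\mathbf e_3$. **Weak solutions.** A weak solution on $(0,T)$ with initial data $(\rho_0,\mathbf m_0,\vartheta_0,\mathbf V_0,\omega_0,h(0))$ of finite energy satisfies,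 with $\mathbf u(t)\in W^{1,2}_0(\Omega)$, $\rho\ge0$, $\vartheta>0$: the weak continuity equation; the weak momentum equation for $C^1$ test fields compactly supported in $[0,T)\times\Omega$ that are rigid velocity fields near $\mathcal S(t)$; the weak entropy inequality on $\Omega$ (with $\mathbf q\cdot\mathbf n=0$ on $\partial\Omega$ and continuous heat flux across $\partial\mathcal S(t)$); and the total energy inequality. Put $$E_0=\int_{\mathcal F(0)}\frac{|\mathbf m_0|^2}{2\rho_0}+\rho_0e(\rho_0,\vartheta_0)\,dx+\frac m2|\mathbf V_0|^2+\frac12\mathbb J(0)\omega_0\cdot\omega_0 .$$ A weak solution enjoys the uniform bounds with constant $C_b$ if each of $$\|\rho\|^\gamma_{L^\infty(0,T;L^\gamma(\mathcal F(\cdot)))},\quad \|\mathbf u\|^2_{L^2(0,T;W^{1,2}_0(\Omega))},\quad \|\rho|\mathbf u|^2\|_{L^\infty(0,T;L^1(\Omega))},\quad \|\vartheta^{\beta/2}\|^2_{L^2(0,T;W^{1,2}(\Omega))}$$ is at most $C_b(E_0+1)$. **Theorem.** For every $C_b$ there is a constant $C_0>0$, depending only on $\Omega,B,\alpha,r_0,d_0,\gamma,\beta,g,\mu,\eta$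 and $C_b$ (not on $\kappa$, $c_v$, $\rho_s$, the thermal laws of the solid, the initial data, the initial height, or $T$), such that the following holds. Suppose that the solid's mass is so large and its initial translational and rotational velocities are so small that $$A:=C_0\max\{m^{-1/2},m^{-3/2}\}\big(1+E_0^{1+\frac1\gamma}\big)<1 .$$ Let $T>\frac{A}{1-A}$ and consider any weak solution on $(0,T)$ that enjoys the uniform bounds with constant $C_b$, with $\operatorname{dist}\big(\mathcal S(t),\partial\Omega\setminus[-2r_0,2r_0]^2\times\{0\}\big)\ge d_0$ for all $t\in[0,T)$. Then the solid touches the bottom of the container at the origin in finite time: there is $t$ with $0<t\le\frac{A}{1-A}$ and $0\in\mathcal S(t)\cap\partial\Omega$. -/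

import Mathlib

open MeasureTheory Set Filter Topology
open scoped ContDiff

noncomputable section

/-- Physical space. The vertical direction is the third coordinate, index `2`. -/
abbrev E3 : Type := EuclideanSpace ℝ (Fin 3)

/-- The standard basis vectors. -/
def stdVec (j : Fin 3) : E3 := EuclideanSpace.single j 1

/-- The upward vertical unit vector. -/
def e3 : E3 := stdVec 2

/-- Distance to the vertical axis. -/
def rad (x : E3) : ℝ := Real.sqrt (x 0 ^ 2 + x 1 ^ 2)

/-- The vector product. -/
def cross (a b : E3) : E3 := WithLp.toLp 2 (crossProduct a.ofLp b.ofLp)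

/-- Frobenius inner product of matrices. -/
def frob (A B : Matrix (Fin 3) (Fin 3) ℝ) : ℝ := ∑ i, ∑ j, A i j * B i j

/-- Symmetric part of a matrix. -/
def symPart (A : Matrix (Fin 3) (Fin 3) ℝ) : Matrix (Fin 3) (Fin 3) ℝ :=
  (1 / 2 : ℝ) • (A + A.transpose)

/-! ### Geometry -/

/-- Bounded domain of class `C^{1,α}`: open, connected, nonempty, bounded, and near each boundary
point, in suitable orthonormal coordinates, the strict epigraph of a `C^{1,α}` function. -/
structure IsC1AlphaDomain (α : ℝ) (D : Set E3) : Prop where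
  isOpen : IsOpen D
  isConnected : IsConnected D
  isBounded : Bornology.IsBounded D
  graph : ∀ x ∈ frontier D, ∃ (R : E3 ≃ₗᵢ[ℝ] E3) (f : EuclideanSpace ℝ (Fin 2) → ℝ) (C : ℝ)
    (U : Set E3), ContDiff ℝ 1 f ∧
      (∀ a b, ‖fderiv ℝ f a - fderiv ℝ f b‖ ≤ C * ‖a - b‖ ^ α) ∧
      IsOpen U ∧ x ∈ U ∧
      ∀ y ∈ U, (y ∈ D ↔ f (!₂[(R y) 0, (R y) 1]) < (R y) 2)

/-- The horizontal square `[-2r₀, 2r₀]² × {0}`. -/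
def floorSquare (r₀ : ℝ) : Set E3 := {x | |x 0| ≤ 2 * r₀ ∧ |x 1| ≤ 2 * r₀ ∧ x 2 = 0}

/-- The body `B`, given in the reference position in which its lowest tip near the axis is the
origin, lifted vertically to the height `h`. -/
def solidAt (B : Set E3) (h : ℝ) : Set E3 := {x | x - h • e3 ∈ B}

/-- The container `Ω` and the reference body `B`. The floor of `Ω` is flat near the axis, `B` is
rotationally symmetric about the axis, and its lower boundary near the axis is the graph
`x₃ = r ^ (1 + α)`, `r ≤ 2 r₀`. -/
structure CollisionGeometry (Ω B : Set E3) (α r₀ : ℝ) : Prop where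
  r₀_pos : 0 < r₀
  container : IsC1AlphaDomain α Ω
  body_regular : closure (interior B) = B
  body : IsC1AlphaDomain α (interior B)
  flat_floor : ∃ l > 0, ∀ x : E3, |x 0| ≤ 2 * r₀ → |x 1| ≤ 2 * r₀ → |x 2| < l →
    (x ∈ Ω ↔ 0 < x 2)
  symmetric : ∀ x y : E3, rad x = rad y → x 2 = y 2 → (x ∈ B ↔ y ∈ B)
  profile : ∃ l > 0, ∀ x : E3, rad x ≤ 2 * r₀ → x 2 < rad x ^ (1 + α) + l →
    (x ∈ B ↔ rad x ^ (1 + α) ≤ x 2)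

/-- Centre of mass of the homogeneous body at height `h`. -/
def centerOfMass (B : Set E3) (h : ℝ) : E3 :=
  (volume.real B)⁻¹ • ∫ x in solidAt B h, x

/-- The quadratic form `𝕁 ω · ω` of the inertial tensor of the body at height `h`. -/
def inertiaForm (B : Set E3) (ρs h : ℝ) (w : E3) : ℝ :=
  ∫ x in solidAt B h, ρs * (‖x - centerOfMass B h‖ ^ 2 * ‖w‖ ^ 2
    - inner ℝ (x - centerOfMass B h) w ^ 2)

/-! ### Sobolev functions -/

/-- `Df` is the weak gradient on `D` of the integrable function `f`, and is integrable. -/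
def HasWeakGradOn (D : Set E3) (f : E3 → ℝ) (Df : E3 → E3) : Prop :=
  IntegrableOn f D ∧ (∀ i, IntegrableOn (fun x => Df x i) D) ∧
  ∀ φ : E3 → ℝ, ContDiff ℝ ∞ φ → HasCompactSupport φ → tsupport φ ⊆ D → ∀ i,
    ∫ x in D, f x * fderiv ℝ φ x (stdVec i) = - ∫ x in D, Df x i * φ x

/-- `u ∈ W₀^{1,2}(D; ℝ³)` with gradient matrix `(Du)ᵢⱼ = ∂ⱼ uᵢ`: limit in `W^{1,2}(D)` of smooth
fields with compact support in `D`. -/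
def IsW0Grad (D : Set E3) (u : E3 → E3) (Du : E3 → Matrix (Fin 3) (Fin 3) ℝ) : Prop :=
  MemLp u 2 (volume.restrict D) ∧
  (∀ i j, MemLp (fun x => Du x i j) 2 (volume.restrict D)) ∧
  ∃ φ : ℕ → E3 → E3,
    (∀ n, ContDiff ℝ ∞ (φ n) ∧ HasCompactSupport (φ n) ∧ tsupport (φ n) ⊆ D) ∧
    Tendsto (fun n => eLpNorm (fun x => φ n x - u x) 2 (volume.restrict D)) atTop (𝓝 0) ∧
    ∀ i j, Tendsto (fun n => eLpNorm (fun x => (fderiv ℝ (φ n) x (stdVec j)) i - Du x i j) 2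
      (volume.restrict D)) atTop (𝓝 0)

/-! ### Constitutive laws -/

/-- Parameters of the model: adiabatic exponent `γ`, gravity `g`, viscosities `μ`, `η`, heat
conductivity `κ`, specific heat `cv` of the fluid, and the density `ρs`, specific internal energy
`es` and specific entropy `ss` (as functions of the temperature) of the solid. -/
structure Material where
  γ : ℝ
  g : ℝ
  μ : ℝ → ℝ
  η : ℝ → ℝ
  κ : ℝ → ℝ
  cv : ℝ
  ρs : ℝ
  es : ℝ → ℝ
  ss : ℝ → ℝ

/-- `μ`, `η` continuous on `(0,∞)`, `μ` Lipschitz, `1 + s ≲ μ(s)` and `0 ≤ η(s) ≲ 1 + s`. -/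
structure ViscosityLaw (μ η : ℝ → ℝ) : Prop where
  mu_lip : ∃ L, LipschitzOnWith L μ (Ioi 0)
  mu_lower : ∃ c > 0, ∀ s > 0, c * (1 + s) ≤ μ s
  eta_cont : ContinuousOn η (Ioi 0)
  eta_nonneg : ∀ s > 0, 0 ≤ η s
  eta_upper : ∃ C, ∀ s > 0, η s ≤ C * (1 + s)

/-- `κ(s) ∼ 1 + s ^ β` on `(0,∞)`. -/
def ConductivityLaw (β : ℝ) (κ : ℝ → ℝ) : Prop :=
  ∃ c C : ℝ, 0 < c ∧ ∀ s > 0, c * (1 + s ^ β) ≤ κ s ∧ κ s ≤ C * (1 + s ^ β)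

/-- Gibbs' relation `ϑ ds = de` for the (incompressible) solid. -/
def SolidGibbs (es ss : ℝ → ℝ) : Prop :=
  ∀ s > 0, ∃ c, HasDerivAt ss c s ∧ HasDerivAt es (s * c) s

namespace Material

variable (M : Material)

/-- Pressure `ρ^γ + ρ ϑ + ϑ⁴`. -/
def pressure (r s : ℝ) : ℝ := r ^ M.γ + r * s + s ^ 4

/-- Volumetric internal energy `ρ e(ρ,ϑ)`, where
`e(ρ,ϑ) = ρ^(γ-1)/(γ-1) + 3 ϑ⁴/ρ + cv ϑ`; meaningful also in vacuum. -/
def fluidEnergy (r s : ℝ) : ℝ := r ^ M.γ / (M.γ - 1) + 3 * s ^ 4 + M.cv * r * s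

/-- Volumetric entropy `ρ s(ρ,ϑ)`, where `s(ρ,ϑ) = 4 ϑ³/ρ + log (ϑ^cv / ρ)`; meaningful also in
vacuum, with `0 log 0 = 0`. -/
def fluidEntropy (r s : ℝ) : ℝ := 4 * s ^ 3 + r * (M.cv * Real.log s - Real.log r)

/-- The stress tensor `2 μ(ϑ) (𝔻 - (1/3) div u 𝕀) + η(ϑ) div u 𝕀` for the velocity gradient `A`. -/
def stress (s : ℝ) (A : Matrix (Fin 3) (Fin 3) ℝ) : Matrix (Fin 3) (Fin 3) ℝ :=
  (2 * M.μ s) • (symPart A - (A.trace / 3) • (1 : Matrix (Fin 3) (Fin 3) ℝ))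
    + (M.η s * A.trace) • (1 : Matrix (Fin 3) (Fin 3) ℝ)

/-- Entropy production `(1/ϑ) (𝕊 : ∇u - q · ∇ϑ / ϑ)` with Fourier's law `q = - κ(ϑ) ∇ϑ`. -/
def entropyProduction (s : ℝ) (A : Matrix (Fin 3) (Fin 3) ℝ) (b : E3) : ℝ :=
  (frob (M.stress s A) A + M.κ s * ‖b‖ ^ 2 / s) / s

open Classical in
/-- Volumetric internal energy of the fluid–solid mixture when the solid occupies `S`. -/
def energyDensity (S : Set E3) (x : E3) (r s : ℝ) : ℝ :=
  if x ∈ S then M.ρs * M.es s else M.fluidEnergy r s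

open Classical in
/-- Volumetric entropy of the fluid–solid mixture when the solid occupies `S`. -/
def entropyDensity (S : Set E3) (x : E3) (r s : ℝ) : ℝ :=
  if x ∈ S then M.ρs * M.ss s else M.fluidEntropy r s

end Material

/-! ### Initial data -/

/-- Initial density, momentum and temperature on the container (fluid and solid together), initial
height, translational and angular velocity of the solid. -/
structure InitialData where
  ρ₀ : E3 → ℝ
  m₀ : E3 → E3
  ϑ₀ : E3 → ℝ
  h₀ : ℝ
  V₀ : E3
  ω₀ : E3

/-- Admissible initial data: the solid lies in `Ω` above the floor, the density and the momentum are
those of the rigid body in the solid, the fluid has nonnegative density, no momentum in vacuum,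
positive temperature and finite energy. -/
structure IsInitialData (Ω B : Set E3) (M : Material) (d : InitialData) : Prop where
  height_pos : 0 < d.h₀
  solid_inside : solidAt B d.h₀ ⊆ Ω
  meas_rho : AEStronglyMeasurable d.ρ₀ (volume.restrict Ω)
  meas_mom : AEStronglyMeasurable d.m₀ (volume.restrict Ω)
  meas_temp : AEStronglyMeasurable d.ϑ₀ (volume.restrict Ω)
  rho_solid : ∀ x ∈ solidAt B d.h₀, d.ρ₀ x = M.ρs
  mom_solid : ∀ x ∈ solidAt B d.h₀,
    d.m₀ x = M.ρs • (d.V₀ + cross d.ω₀ (x - centerOfMass B d.h₀))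
  rho_nonneg : ∀ᵐ x ∂volume.restrict Ω, 0 ≤ d.ρ₀ x
  mom_vacuum : ∀ᵐ x ∂volume.restrict Ω, d.ρ₀ x = 0 → d.m₀ x = 0
  temp_pos : ∀ᵐ x ∂volume.restrict Ω, 0 < d.ϑ₀ x
  kinetic_finite : IntegrableOn (fun x => ‖d.m₀ x‖ ^ 2 / (2 * d.ρ₀ x)) (Ω \ solidAt B d.h₀)
  internal_finite : IntegrableOn (fun x => M.fluidEnergy (d.ρ₀ x) (d.ϑ₀ x)) (Ω \ solidAt B d.h₀)

/-- Mass of the solid. -/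
def solidMass (B : Set E3) (M : Material) : ℝ := M.ρs * volume.real B

/-- Initial energy
`E₀ = ∫_{F(0)} |m₀|²/(2ρ₀) + ρ₀ e(ρ₀,ϑ₀) dx + (m/2) |V₀|² + (1/2) 𝕁(0) ω₀ · ω₀`. -/
def initialEnergy (Ω B : Set E3) (M : Material) (d : InitialData) : ℝ :=
  (∫ x in Ω \ solidAt B d.h₀,
      (‖d.m₀ x‖ ^ 2 / (2 * d.ρ₀ x) + M.fluidEnergy (d.ρ₀ x) (d.ϑ₀ x)))
    + solidMass B M / 2 * ‖d.V₀‖ ^ 2 + inertiaForm B M.ρs d.h₀ d.ω₀ / 2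

/-! ### Weak solutions -/

/-- The unknowns: density, velocity and temperature on the container (fluid and solid together),
the gradients of velocity, `(Du)ᵢⱼ = ∂ⱼ uᵢ`, and temperature, the height `h` of the solid, its
vertical speed `v` and its angular speed `spin` about the vertical axis. -/
structure Motion where
  ρ : ℝ → E3 → ℝ
  u : ℝ → E3 → E3
  ϑ : ℝ → E3 → ℝ
  Du : ℝ → E3 → Matrix (Fin 3) (Fin 3) ℝ
  Dϑ : ℝ → E3 → E3
  h : ℝ → ℝ
  v : ℝ → ℝ
  spin : ℝ → ℝ

/-- The space-time cylinder `(0,T) × Ω`. -/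
def cyl (Ω : Set E3) (T : ℝ) : Set (ℝ × E3) := Ioo 0 T ×ˢ Ω

/-- The space-time region `{(t,x) : 0 < t < T, x ∈ Ω \ S(t)}` occupied by the fluid. -/
def fluidCyl (Ω B : Set E3) (h : ℝ → ℝ) (T : ℝ) : Set (ℝ × E3) :=
  {p | p.1 ∈ Ioo 0 T ∧ p.2 ∈ Ω \ solidAt B (h p.1)}

/-- Time derivative of a function on space-time. -/
def dt {F : Type*} [NormedAddCommGroup F] [NormedSpace ℝ F] (φ : ℝ × E3 → F) (p : ℝ × E3) : F :=
  fderiv ℝ φ p (1, 0)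

/-- Spatial derivative `∂ⱼ` of a function on space-time. -/
def dx {F : Type*} [NormedAddCommGroup F] [NormedSpace ℝ F] (j : Fin 3) (φ : ℝ × E3 → F)
    (p : ℝ × E3) : F :=
  fderiv ℝ φ p (0, stdVec j)

/-- Spatial gradient matrix `∂ⱼ φᵢ` of a vector field on space-time. -/
def gradMat (φ : ℝ × E3 → E3) (p : ℝ × E3) : Matrix (Fin 3) (Fin 3) ℝ :=
  Matrix.of fun i j => (dx j φ p) i

/-- `C¹` functions with compact support in `[0,T) × D` (restrictions to `t ≥ 0`). -/
def IsTest {F : Type*} [NormedAddCommGroup F] [NormedSpace ℝ F] (D : Set E3) (T : ℝ)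
    (φ : ℝ × E3 → F) : Prop :=
  ContDiff ℝ 1 φ ∧ HasCompactSupport φ ∧ tsupport φ ⊆ Iio T ×ˢ D

/-- `φ(t,·)` is a rigid velocity field (`𝔻(φ) = 0`) in a space-time neighbourhood of the solid. -/
def IsRigidNearSolid (B : Set E3) (h : ℝ → ℝ) (T : ℝ) (φ : ℝ × E3 → E3) : Prop :=
  ∃ U : Set (ℝ × E3), IsOpen U ∧ (∀ t ∈ Ico 0 T, ∀ x ∈ solidAt B (h t), (t, x) ∈ U) ∧
    ∀ p ∈ U, 0 ≤ p.1 → symPart (gradMat φ p) = 0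

/-- Weak solutions on `(0,T)` of the system for a heat-conducting compressible fluid under gravity
`-g e₃` and a rigid body that moves by vertical translation and rotation about the vertical axis:
continuity equation, momentum equation with test fields that are rigid near the solid (this contains
the balance of linear and angular momentum of the solid), entropy inequality and energy inequality.
The test functions of the entropy inequality do not vanish on `∂Ω` or near the solid, which expresses
`q · n = 0` on `∂Ω` and the continuity of the heat flux at the surface of the solid. -/
structure IsWeakSolution (Ω B : Set E3) (M : Material) (T : ℝ) (d : InitialData) (s : Motion) :
    Prop where
  -- motion of the solid
  height_init : s.h 0 = d.h₀
  speed_int : IntegrableOn s.v (Ioo 0 T)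
  height_eq : ∀ t ∈ Ico 0 T, s.h t = d.h₀ + ∫ τ in (0 : ℝ)..t, s.v τ
  solid_inside : ∀ t ∈ Ico 0 T, solidAt B (s.h t) ⊆ closure Ω
  -- measurability
  meas_rho : AEStronglyMeasurable (fun p : ℝ × E3 => s.ρ p.1 p.2) (volume.restrict (cyl Ω T))
  meas_u : AEStronglyMeasurable (fun p : ℝ × E3 => s.u p.1 p.2) (volume.restrict (cyl Ω T))
  meas_temp : AEStronglyMeasurable (fun p : ℝ × E3 => s.ϑ p.1 p.2) (volume.restrict (cyl Ω T))
  meas_Du : ∀ i j, AEStronglyMeasurable (fun p : ℝ × E3 => s.Du p.1 p.2 i j)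
    (volume.restrict (cyl Ω T))
  meas_Dtemp : AEStronglyMeasurable (fun p : ℝ × E3 => s.Dϑ p.1 p.2) (volume.restrict (cyl Ω T))
  -- values in the solid
  rho_solid : ∀ᵐ t ∂volume.restrict (Ioo 0 T), ∀ᵐ x ∂volume.restrict (solidAt B (s.h t)),
    s.ρ t x = M.ρs
  u_solid : ∀ᵐ t ∂volume.restrict (Ioo 0 T), ∀ᵐ x ∂volume.restrict (solidAt B (s.h t)),
    s.u t x = s.v t • e3 + cross (s.spin t • e3) (x - centerOfMass B (s.h t))
  -- signs and function spaces
  rho_nonneg : ∀ᵐ p ∂volume.restrict (cyl Ω T), 0 ≤ s.ρ p.1 p.2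
  temp_pos : ∀ᵐ p ∂volume.restrict (cyl Ω T), 0 < s.ϑ p.1 p.2
  u_space : ∀ᵐ t ∂volume.restrict (Ioo 0 T), IsW0Grad Ω (s.u t) (s.Du t)
  temp_space : ∀ᵐ t ∂volume.restrict (Ioo 0 T), HasWeakGradOn Ω (s.ϑ t) (s.Dϑ t)
  -- integrability of the terms of the continuity and momentum equations
  int_rho : IntegrableOn (fun p : ℝ × E3 => s.ρ p.1 p.2) (cyl Ω T)
  int_mom : IntegrableOn (fun p : ℝ × E3 => s.ρ p.1 p.2 • s.u p.1 p.2) (cyl Ω T)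
  int_conv : IntegrableOn (fun p : ℝ × E3 => s.ρ p.1 p.2 * ‖s.u p.1 p.2‖ ^ 2) (cyl Ω T)
  int_pressure : IntegrableOn (fun p : ℝ × E3 => M.pressure (s.ρ p.1 p.2) (s.ϑ p.1 p.2))
    (fluidCyl Ω B s.h T)
  int_stress : ∀ i j, IntegrableOn
    (fun p : ℝ × E3 => M.stress (s.ϑ p.1 p.2) (s.Du p.1 p.2) i j) (fluidCyl Ω B s.h T)
  -- continuity equation
  continuity : ∀ φ : ℝ × E3 → ℝ, IsTest univ T φ →
    (∫ p in cyl Ω T, (s.ρ p.1 p.2 * dt φ p + s.ρ p.1 p.2 * ∑ j, s.u p.1 p.2 j * dx j φ p))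
      + ∫ x in Ω, d.ρ₀ x * φ (0, x) = 0
  -- momentum equation
  momentum : ∀ φ : ℝ × E3 → E3, IsTest Ω T φ → IsRigidNearSolid B s.h T φ →
    (∫ p in cyl Ω T, (s.ρ p.1 p.2 * inner ℝ (s.u p.1 p.2) (dt φ p)
        + s.ρ p.1 p.2 * ∑ i, ∑ j, s.u p.1 p.2 i * s.u p.1 p.2 j * gradMat φ p i j))
      + (∫ p in fluidCyl Ω B s.h T, (M.pressure (s.ρ p.1 p.2) (s.ϑ p.1 p.2) * (gradMat φ p).trace
        - frob (M.stress (s.ϑ p.1 p.2) (s.Du p.1 p.2)) (gradMat φ p)))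
      + (∫ p in cyl Ω T, s.ρ p.1 p.2 * inner ℝ (-M.g • e3) (φ p))
      + ∫ x in Ω, inner ℝ (d.m₀ x) (φ (0, x)) = 0
  -- entropy inequality
  int_entropy : IntegrableOn (fun p : ℝ × E3 =>
    M.entropyDensity (solidAt B (s.h p.1)) p.2 (s.ρ p.1 p.2) (s.ϑ p.1 p.2)) (cyl Ω T)
  int_entropy_flux : IntegrableOn (fun p : ℝ × E3 =>
    M.entropyDensity (solidAt B (s.h p.1)) p.2 (s.ρ p.1 p.2) (s.ϑ p.1 p.2) • s.u p.1 p.2) (cyl Ω T)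
  int_heat_flux : IntegrableOn (fun p : ℝ × E3 =>
    (M.κ (s.ϑ p.1 p.2) / s.ϑ p.1 p.2) • s.Dϑ p.1 p.2) (cyl Ω T)
  int_production : IntegrableOn (fun p : ℝ × E3 =>
    M.entropyProduction (s.ϑ p.1 p.2) (s.Du p.1 p.2) (s.Dϑ p.1 p.2)) (cyl Ω T)
  int_entropy_init : IntegrableOn (fun x =>
    M.entropyDensity (solidAt B d.h₀) x (d.ρ₀ x) (d.ϑ₀ x)) Ω
  entropy : ∀ φ : ℝ × E3 → ℝ, IsTest univ T φ → (∀ p, 0 ≤ φ p) →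
    (∫ p in cyl Ω T,
        (M.entropyDensity (solidAt B (s.h p.1)) p.2 (s.ρ p.1 p.2) (s.ϑ p.1 p.2)
            * (dt φ p + ∑ j, s.u p.1 p.2 j * dx j φ p)
          - M.κ (s.ϑ p.1 p.2) / s.ϑ p.1 p.2 * ∑ j, s.Dϑ p.1 p.2 j * dx j φ p
          + M.entropyProduction (s.ϑ p.1 p.2) (s.Du p.1 p.2) (s.Dϑ p.1 p.2) * φ p))
      + ∫ x in Ω, M.entropyDensity (solidAt B d.h₀) x (d.ρ₀ x) (d.ϑ₀ x) * φ (0, x) ≤ 0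
  -- energy inequality
  int_energy_init : IntegrableOn (fun x => ‖d.m₀ x‖ ^ 2 / (2 * d.ρ₀ x)
    + M.energyDensity (solidAt B d.h₀) x (d.ρ₀ x) (d.ϑ₀ x)) Ω
  int_energy : ∀ᵐ t ∂volume.restrict (Ioo 0 T), IntegrableOn (fun x =>
    s.ρ t x * ‖s.u t x‖ ^ 2 / 2
      + M.energyDensity (solidAt B (s.h t)) x (s.ρ t x) (s.ϑ t x)) Ω
  energy : ∀ᵐ t ∂volume.restrict (Ioo 0 T),
    (∫ x in Ω, (s.ρ t x * ‖s.u t x‖ ^ 2 / 2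
        + M.energyDensity (solidAt B (s.h t)) x (s.ρ t x) (s.ϑ t x)))
      ≤ (∫ x in Ω, (‖d.m₀ x‖ ^ 2 / (2 * d.ρ₀ x)
          + M.energyDensity (solidAt B d.h₀) x (d.ρ₀ x) (d.ϑ₀ x)))
        + ∫ p in cyl Ω t, s.ρ p.1 p.2 * inner ℝ (-M.g • e3) (s.u p.1 p.2)

/-- The uniform bounds on `(0,T)` with right-hand side `K`:
`‖ρ‖^γ` in `L^∞(0,T;L^γ(F(t)))`, `‖u‖²` in `L²(0,T;W₀^{1,2}(Ω))`, `ρ|u|²` in `L^∞(0,T;L¹(Ω))`, and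
`‖ϑ^{β/2}‖²` in `L²(0,T;W^{1,2}(Ω))`. -/
structure UniformBounds (Ω B : Set E3) (γ β T : ℝ) (s : Motion) (K : ℝ) : Prop where
  density : ∀ᵐ t ∂volume.restrict (Ioo 0 T),
    ∫⁻ x in Ω \ solidAt B (s.h t), ENNReal.ofReal (s.ρ t x ^ γ) ≤ ENNReal.ofReal K
  velocity : ∫⁻ p in cyl Ω T,
    ENNReal.ofReal (‖s.u p.1 p.2‖ ^ 2 + frob (s.Du p.1 p.2) (s.Du p.1 p.2)) ≤ ENNReal.ofReal K
  kinetic : ∀ᵐ t ∂volume.restrict (Ioo 0 T),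
    ∫⁻ x in Ω, ENNReal.ofReal (s.ρ t x * ‖s.u t x‖ ^ 2) ≤ ENNReal.ofReal K
  temperature : ∃ Dz : ℝ → E3 → E3,
    AEStronglyMeasurable (fun p : ℝ × E3 => Dz p.1 p.2) (volume.restrict (cyl Ω T)) ∧
    (∀ᵐ t ∂volume.restrict (Ioo 0 T), HasWeakGradOn Ω (fun x => s.ϑ t x ^ (β / 2)) (Dz t)) ∧
    ∫⁻ p in cyl Ω T, ENNReal.ofReal ((s.ϑ p.1 p.2 ^ (β / 2)) ^ 2 + ‖Dz p.1 p.2‖ ^ 2)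
      ≤ ENNReal.ofReal K

/-- The quantity `C₀ max{m^{-1/2}, m^{-3/2}} (1 + E₀^{1 + 1/γ})`, small for a heavy solid with small
initial speeds. -/
def collisionRatio (Ω B : Set E3) (M : Material) (d : InitialData) (C₀ : ℝ) : ℝ :=
  C₀ * max (solidMass B M ^ (-(1 / 2) : ℝ)) (solidMass B M ^ (-(3 / 2) : ℝ))
    * (1 + initialEnergy Ω B M d ^ (1 + 1 / M.γ))

end

/-!
The impulse of the weight of the solid over a time `T₁` is `g m T₁`. In a suitably tested momentum
equation every other term is bounded by the energy, with a factor that grows at most like `√m` for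
large `m`. A heavy solid therefore cannot stay above the floor for longer than the time stated.

Suppose that there is no contact up to the time `T₁ = A / (1 - A)`. The gap of width `h + r ^ (1 + α)`
between the floor and the body then stays open, and since the other parts of the boundary of the
container are far from the body, the solid is inside the container
(`CollisionGeometry.solid_subset`). The momentum equation is tested with the field
`ζ(t) curl (Ψ (-x₂, x₁, 0) / 2)`. The potential `Ψ` is `1` near the body and `0` far from it and in a
layer at the floor, and it passes from `0` to `1` inside the gap. The field is equal to `ζ(t) e₃` in
the solid, and it is solenoidal, so that the pressure does not contribute
(`CollisionGeometry.exists_adaptedField`). What remains is that `g m T₁` is at most the sum of the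
inertial and viscous terms, of the gravity of the fluid, and of the initial momentum
(`IsWeakSolution.exists_weight_le`).

Uniformly in the height `h > 0`, the field and its first derivatives are bounded by
`1 + x₃ ^ (-(1 + 2α) / (1 + α))` in the cusp `r ≤ b x₃ ^ (1 / (1 + α))`, and by a constant outside
(`exists_liftField_bounds`). The `q`-th power of this profile is integrable if
`q (1 + 2α) < 3 + α` (`lintegral_cusp_rpow_lt_top`). Hölder's inequality requires
`1 / q = 2 / 3 - 1 / γ` in the convective term, where `ρ ∈ L^γ` and `|u|² ∈ L³`, and
`1 / q = 1 / 2 - 1 / (3β)` in the viscous term, where `∇u ∈ L²` and `ϑ ∈ L^(3β)`; with these exponents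
the condition on `q` becomes the two conditions on `α` (`exists_sliceConstant`). The
integrability of `u` is the Sobolev embedding of `W₀^{1,2}` (`exists_sobolev_W0`). For
`ϑ ^ (β / 2)`, which does not vanish on the boundary, a Sobolev inequality is needed only where the
profile is singular, and there the boundary is flat, so that even reflection in the floor gives it
(`exists_sobolev_near_floor`).

The time derivative of the test field has two parts. The derivative of `ζ` has total variation at most
one and is paired with a momentum of size `1 + √m`. The motion of the body contributes its speed, which
is at most `√(K / m)` if `K` bounds the kinetic energy (`mass_mul_speed_sq_le`). Altogether
`g m T₁ ≤ C (1 + √m + 1 / √m) K ^ (1 + 1 / γ) (2 + T₂)`, where `T₂ > T₁` is the end of the support of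
`ζ`, and `C` depends only on the geometry, on gravity and on the viscosities
(`CollisionGeometry.exists_impulse_bound`). Since `1 + T₁ = 1 / (1 - A)`, this is an upper bound for
`A`, which fails if the constant in the definition of `A` is large (`impulse_div_le`).
-/

/-! ### Bounds for a function and its first two derivatives -/

lemma ContDiffAt.eventually_differentiableAt_two {E : Type*} [NormedAddCommGroup E]
    [NormedSpace ℝ E] {f : E → ℝ} {y : E} (hf : ContDiffAt ℝ 2 f y) :
    ∀ᶠ z in 𝓝 y, DifferentiableAt ℝ f z := by
  filter_upwards [hf.eventually (by simp)] with z hz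
  exact hz.differentiableAt (by norm_num)

lemma ContDiffAt.differentiableAt_fderiv_apply {E : Type*} [NormedAddCommGroup E]
    [NormedSpace ℝ E] {f : E → ℝ} {y : E} (hf : ContDiffAt ℝ 2 f y) (v : E) :
    DifferentiableAt ℝ (fun z => fderiv ℝ f z v) y :=
  ((hf.fderiv_right (m := 1) (by norm_num)).differentiableAt (by norm_num)).clm_apply
    (differentiableAt_const _)

/-- `f` is `C²` at `y`, and `a`, `b`, `c` bound there the norms of `f` and of its first and second
derivatives. -/
structure JetBound {E : Type*} [NormedAddCommGroup E] [NormedSpace ℝ E] (f : E → ℝ) (y : E)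
    (a b c : ℝ) : Prop where
  smooth : ContDiffAt ℝ 2 f y
  b_nonneg : 0 ≤ b
  c_nonneg : 0 ≤ c
  val : |f y| ≤ a
  d1 : ∀ v, |fderiv ℝ f y v| ≤ b * ‖v‖
  d2 : ∀ v w, |fderiv ℝ (fun z => fderiv ℝ f z v) y w| ≤ c * (‖v‖ * ‖w‖)

namespace JetBound

variable {E : Type*} [NormedAddCommGroup E] [NormedSpace ℝ E]
variable {f g : E → ℝ} {y : E} {a b c a' b' c' : ℝ}

lemma a_nonneg (hf : JetBound f y a b c) : 0 ≤ a := (abs_nonneg _).trans hf.val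

lemma mono (hf : JetBound f y a b c) (ha : a ≤ a') (hb : b ≤ b') (hc : c ≤ c') :
    JetBound f y a' b' c' :=
  ⟨hf.smooth, hf.b_nonneg.trans hb, hf.c_nonneg.trans hc, hf.val.trans ha,
    fun v => (hf.d1 v).trans (by gcongr), fun v w => (hf.d2 v w).trans (by gcongr)⟩

lemma congr (hf : JetBound f y a b c) (h : g =ᶠ[𝓝 y] f) : JetBound g y a b c := by
  refine ⟨hf.smooth.congr_of_eventuallyEq h, hf.b_nonneg, hf.c_nonneg, ?_, fun v => ?_,
    fun v w => ?_⟩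
  · rw [h.eq_of_nhds]; exact hf.val
  · rw [h.fderiv_eq]; exact hf.d1 v
  · have : (fun z => fderiv ℝ g z v) =ᶠ[𝓝 y] fun z => fderiv ℝ f z v := by
      filter_upwards [h.fderiv (𝕜 := ℝ)] with z hz
      rw [hz]
    rw [this.fderiv_eq]; exact hf.d2 v w

lemma const (r : ℝ) : JetBound (fun _ : E => r) y |r| 0 0 :=
  ⟨contDiffAt_const, le_rfl, le_rfl, le_rfl, fun v => by simp, fun v w => by simp⟩

lemma linear (L : E →L[ℝ] ℝ) {l : ℝ} (hl : 0 ≤ l) (h : ∀ v, |L v| ≤ l * ‖v‖) :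
    JetBound (fun z => L z) y |L y| l 0 :=
  ⟨L.contDiff.contDiffAt, hl, le_rfl, le_rfl, by simpa using h, by simp⟩

lemma add (hf : JetBound f y a b c) (hg : JetBound g y a' b' c') :
    JetBound (fun z => f z + g z) y (a + a') (b + b') (c + c') := by
  have hfd := hf.smooth.differentiableAt (by norm_num)
  have hgd := hg.smooth.differentiableAt (by norm_num)
  refine ⟨hf.smooth.add hg.smooth, add_nonneg hf.b_nonneg hg.b_nonneg,
    add_nonneg hf.c_nonneg hg.c_nonneg, (abs_add_le _ _).trans (add_le_add hf.val hg.val),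
    fun v => ?_, fun v w => ?_⟩
  · rw [fderiv_fun_add hfd hgd, add_apply, add_mul]
    exact (abs_add_le _ _).trans (add_le_add (hf.d1 v) (hg.d1 v))
  · have e : (fun z => fderiv ℝ (fun z => f z + g z) z v) =ᶠ[𝓝 y]
        fun z => fderiv ℝ f z v + fderiv ℝ g z v := by
      filter_upwards [hf.smooth.eventually_differentiableAt_two,
        hg.smooth.eventually_differentiableAt_two] with z h1 h2
      rw [fderiv_fun_add h1 h2, add_apply]
    rw [e.fderiv_eq, fderiv_fun_add (hf.smooth.differentiableAt_fderiv_apply v)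
      (hg.smooth.differentiableAt_fderiv_apply v), add_apply, add_mul]
    exact (abs_add_le _ _).trans (add_le_add (hf.d2 v w) (hg.d2 v w))

lemma mul (hf : JetBound f y a b c) (hg : JetBound g y a' b' c') :
    JetBound (fun z => f z * g z) y (a * a') (a * b' + b * a') (a * c' + 2 * (b * b') + c * a') := by
  have ha := hf.a_nonneg
  have ha' := hg.a_nonneg
  have hb := hf.b_nonneg
  have hb' := hg.b_nonneg
  have hc := hf.c_nonneg
  have hc' := hg.c_nonneg
  have hfd := hf.smooth.differentiableAt (by norm_num)
  have hgd := hg.smooth.differentiableAt (by norm_num)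
  have key : ∀ {p q r s : ℝ}, |p| ≤ r → |q| ≤ s → 0 ≤ r → |p * q| ≤ r * s := fun h1 h2 h3 => by
    rw [abs_mul]; exact mul_le_mul h1 h2 (abs_nonneg _) h3
  refine ⟨hf.smooth.mul hg.smooth, by positivity, by positivity, key hf.val hg.val ha,
    fun v => ?_, fun v w => ?_⟩
  · rw [fderiv_fun_mul hfd hgd]
    simp only [add_apply, smul_apply, smul_eq_mul]
    refine (abs_add_le _ _).trans ?_
    have k1 := key hf.val (hg.d1 v) ha
    have k2 := key hg.val (hf.d1 v) ha'
    linarith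
  · have e : (fun z => fderiv ℝ (fun z => f z * g z) z v) =ᶠ[𝓝 y]
        fun z => f z * fderiv ℝ g z v + g z * fderiv ℝ f z v := by
      filter_upwards [hf.smooth.eventually_differentiableAt_two,
        hg.smooth.eventually_differentiableAt_two] with z h1 h2
      rw [fderiv_fun_mul h1 h2]
      simp
    have d : HasFDerivAt (fun z => f z * fderiv ℝ g z v + g z * fderiv ℝ f z v) _ y :=
      (hfd.hasFDerivAt.mul (hg.smooth.differentiableAt_fderiv_apply v).hasFDerivAt).add
        (hgd.hasFDerivAt.mul (hf.smooth.differentiableAt_fderiv_apply v).hasFDerivAt)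
    rw [e.fderiv_eq, d.fderiv]
    simp only [add_apply, smul_apply, smul_eq_mul]
    have k1 := key hf.val (hg.d2 v w) ha
    have k2 := key (hg.d1 v) (hf.d1 w) (by positivity)
    have k3 := key hg.val (hf.d2 v w) ha'
    have k4 := key (hf.d1 v) (hg.d1 w) (by positivity)
    refine (abs_add_le _ _).trans ((add_le_add (abs_add_le _ _) (abs_add_le _ _)).trans ?_)
    refine (add_le_add (add_le_add k1 k2) (add_le_add k3 k4)).trans (le_of_eq ?_)
    ring

lemma const_mul (r : ℝ) (hf : JetBound f y a b c) :
    JetBound (fun z => r * f z) y (|r| * a) (|r| * b) (|r| * c) := by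
  simpa using (const (y := y) r).mul hf

/-- Composition with a function of one variable, whose derivatives up to order two at `f y` are
bounded by `e₀`, `e₁`, `e₂`. -/
lemma comp {φ : ℝ → ℝ} {e₀ e₁ e₂ : ℝ} (hf : JetBound f y a b c) (hφ : ContDiffAt ℝ 2 φ (f y))
    (h0 : |φ (f y)| ≤ e₀) (h1 : |deriv φ (f y)| ≤ e₁) (h2 : |deriv (deriv φ) (f y)| ≤ e₂) :
    JetBound (fun z => φ (f z)) y e₀ (e₁ * b) (e₁ * c + e₂ * b ^ 2) := by
  have hb := hf.b_nonneg
  have hc := hf.c_nonneg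
  have he1 : 0 ≤ e₁ := (abs_nonneg _).trans h1
  have he2 : 0 ≤ e₂ := (abs_nonneg _).trans h2
  have hfd := hf.smooth.differentiableAt (by norm_num)
  have hφd := hφ.differentiableAt (by norm_num)
  have hφ' : DifferentiableAt ℝ (deriv φ) (f y) := hφ.differentiableAt_fderiv_apply 1
  refine ⟨hφ.comp y hf.smooth, by positivity, by positivity, h0, fun v => ?_, fun v w => ?_⟩
  · have d : HasFDerivAt (fun z => φ (f z)) _ y := hφd.hasDerivAt.comp_hasFDerivAt y hfd.hasFDerivAt
    rw [d.fderiv, smul_apply, smul_eq_mul, abs_mul, mul_assoc]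
    exact mul_le_mul h1 (hf.d1 v) (abs_nonneg _) he1
  · have e : (fun z => fderiv ℝ (fun z => φ (f z)) z v) =ᶠ[𝓝 y]
        fun z => deriv φ (f z) * fderiv ℝ f z v := by
      filter_upwards [hf.smooth.eventually_differentiableAt_two,
        hf.smooth.continuousAt.eventually (hφ.eventually_differentiableAt_two)] with z h1 h2
      have d : HasFDerivAt (fun z => φ (f z)) _ z := h2.hasDerivAt.comp_hasFDerivAt z h1.hasFDerivAt
      rw [d.fderiv]
      simp
    have d : HasFDerivAt (fun z => deriv φ (f z) * fderiv ℝ f z v) _ y :=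
      (hφ'.hasDerivAt.comp_hasFDerivAt y hfd.hasFDerivAt).mul
        (hf.smooth.differentiableAt_fderiv_apply v).hasFDerivAt
    rw [e.fderiv_eq, d.fderiv]
    simp only [add_apply, smul_apply, smul_eq_mul, Function.comp_apply]
    refine (abs_add_le _ _).trans ?_
    rw [abs_mul, abs_mul, abs_mul]
    have k1 := mul_le_mul h1 (hf.d2 v w) (abs_nonneg _) he1
    have k2 := mul_le_mul (hf.d1 v) (mul_le_mul h2 (hf.d1 w) (abs_nonneg _) he2) (by positivity)
      (by positivity)
    refine (add_le_add k1 k2).trans (le_of_eq ?_)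
    ring

/-- Composition with a linear map on the inside. -/
lemma comp_linear {E' : Type*} [NormedAddCommGroup E'] [NormedSpace ℝ E'] {z : E'}
    (L : E' →L[ℝ] E) {l : ℝ} (hl : 0 ≤ l) (h : ∀ v, ‖L v‖ ≤ l * ‖v‖)
    (hf : JetBound f (L z) a b c) :
    JetBound (fun x => f (L x)) z a (b * l) (c * l ^ 2) := by
  have hb := hf.b_nonneg
  have hc := hf.c_nonneg
  refine ⟨hf.smooth.comp z L.contDiff.contDiffAt, by positivity, by positivity, hf.val,
    fun v => ?_, fun v w => ?_⟩
  · have d : HasFDerivAt (fun x => f (L x)) _ z :=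
      (hf.smooth.differentiableAt (by norm_num)).hasFDerivAt.comp z L.hasFDerivAt
    rw [d.fderiv]
    refine (hf.d1 (L v)).trans ?_
    rw [mul_assoc]
    exact mul_le_mul_of_nonneg_left (h v) hb
  · have e : (fun x => fderiv ℝ (fun x => f (L x)) x v) =ᶠ[𝓝 z]
        fun x => fderiv ℝ f (L x) (L v) := by
      filter_upwards [L.continuous.continuousAt.eventually
        hf.smooth.eventually_differentiableAt_two] with x h1
      have d : HasFDerivAt (fun x => f (L x)) _ x := h1.hasFDerivAt.comp x L.hasFDerivAt
      rw [d.fderiv]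
      rfl
    have d : HasFDerivAt (fun x => fderiv ℝ f (L x) (L v)) _ z :=
      (hf.smooth.differentiableAt_fderiv_apply (L v)).hasFDerivAt.comp z L.hasFDerivAt
    rw [e.fderiv_eq, d.fderiv]
    refine (hf.d2 (L v) (L w)).trans ?_
    calc c * (‖L v‖ * ‖L w‖) ≤ c * ((l * ‖v‖) * (l * ‖w‖)) := by
          gcongr
          exacts [h v, h w]
      _ = c * l ^ 2 * (‖v‖ * ‖w‖) := by ring

end JetBound

/-- A compactly supported smooth function has uniformly bounded derivatives. -/
lemma HasCompactSupport.exists_jetBound {E : Type*} [NormedAddCommGroup E] [NormedSpace ℝ E]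
    {f : E → ℝ} (hf : HasCompactSupport f) (hs : ContDiff ℝ 2 f) :
    ∃ C, 1 ≤ C ∧ ∀ y, JetBound f y C C C := by
  have hs1 : ContDiff ℝ 1 (fderiv ℝ f) := hs.fderiv_right (by norm_num)
  obtain ⟨C0, hC0⟩ := hf.isCompact.exists_bound_of_continuousOn hs.continuous.continuousOn
  obtain ⟨C1, hC1⟩ := hf.isCompact.exists_bound_of_continuousOn hs1.continuous.continuousOn
  obtain ⟨C2, hC2⟩ := hf.isCompact.exists_bound_of_continuousOn
    (hs1.continuous_fderiv one_ne_zero).continuousOn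
  refine ⟨1 + |C0| + |C1| + |C2|, by linarith [abs_nonneg C0, abs_nonneg C1, abs_nonneg C2],
    fun y => ?_⟩
  by_cases hy : y ∈ tsupport f
  · refine ⟨hs.contDiffAt, by positivity, by positivity, (hC0 y hy).trans ?_, fun v => ?_,
      fun v w => ?_⟩
    · linarith [le_abs_self C0, abs_nonneg C1, abs_nonneg C2]
    · refine ((fderiv ℝ f y).le_of_opNorm_le (hC1 y hy) v).trans ?_
      gcongr
      linarith [le_abs_self C1, abs_nonneg C0, abs_nonneg C2]
    · have e : fderiv ℝ (fun z => fderiv ℝ f z v) y w = fderiv ℝ (fderiv ℝ f) y w v := by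
        have d : HasFDerivAt (fun z => fderiv ℝ f z v) _ y :=
          (hs1.differentiable one_ne_zero y).hasFDerivAt.clm_apply (hasFDerivAt_const v y)
        rw [d.fderiv]; simp
      have k1 := (fderiv ℝ (fderiv ℝ f) y).le_of_opNorm_le (hC2 y hy) w
      have k2 := (fderiv ℝ (fderiv ℝ f) y w).le_of_opNorm_le k1 v
      rw [e]
      refine k2.trans ?_
      rw [mul_assoc, mul_comm ‖w‖]
      gcongr
      linarith [le_abs_self C2, abs_nonneg C0, abs_nonneg C1]
  · have h0 : JetBound f y |(0 : ℝ)| 0 0 :=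
      (JetBound.const 0).congr (notMem_tsupport_iff_eventuallyEq.1 hy)
    exact h0.mono (by rw [abs_zero]; positivity) (by positivity) (by positivity)

/-! ### The transition layer between the body and the floor -/

/-- A smooth function comparable with the gap `h + r ^ (1 + α)` between the floor and the body at
height `h`. Its regularization at the scale `h` makes it smooth for `h > 0`, and its second
derivatives are bounded by its reciprocal. -/
noncomputable def barrier (α c : ℝ) (y : ℝ × E3) : ℝ :=
  c * (y.1 + (y.1 * y.1 + (y.2 0 * y.2 0 + y.2 1 * y.2 1)) ^ ((1 + α) / 2))

/-- A smooth step, `0` on `(-∞, 1/4]` and `1` on `[3/4, ∞)`. -/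
noncomputable def ramp (s : ℝ) : ℝ := Real.smoothTransition (2 * s - 1 / 2)

lemma contDiff_ramp : ContDiff ℝ 2 ramp :=
  (Real.smoothTransition.contDiff (n := 2)).comp
    ((contDiff_const.mul contDiff_id).sub contDiff_const)

lemma ramp_eq_zero {s : ℝ} (h : s ≤ 1 / 4) : ramp s = 0 :=
  Real.smoothTransition.zero_of_nonpos (by linarith)

lemma ramp_eq_one {s : ℝ} (h : 3 / 4 ≤ s) : ramp s = 1 :=
  Real.smoothTransition.one_of_one_le (by linarith)

lemma abs_ramp_le (s : ℝ) : |ramp s| ≤ 1 := by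
  rw [ramp, abs_of_nonneg (Real.smoothTransition.nonneg _)]
  exact Real.smoothTransition.le_one _

/-- On `[-1, 1]`, outside which `ramp` is locally constant, its derivatives are bounded. -/
lemma exists_deriv_ramp_bound : ∃ R : ℝ, 1 ≤ R ∧ ∀ s, |s| ≤ 1 →
    |deriv ramp s| ≤ R ∧ |deriv (deriv ramp) s| ≤ R := by
  have h1 : ContDiff ℝ 1 (deriv ramp) := by
    have := contDiff_succ_iff_deriv (n := 1) (𝕜 := ℝ) (f := ramp)
    exact (this.1 contDiff_ramp).2.2
  have h2 : Continuous (deriv (deriv ramp)) := h1.continuous_deriv le_rfl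
  obtain ⟨C1, hC1⟩ := (isCompact_Icc (a := (-1 : ℝ)) (b := 1)).exists_bound_of_continuousOn
    h1.continuous.continuousOn
  obtain ⟨C2, hC2⟩ := (isCompact_Icc (a := (-1 : ℝ)) (b := 1)).exists_bound_of_continuousOn
    h2.continuousOn
  refine ⟨1 + |C1| + |C2|, by linarith [abs_nonneg C1, abs_nonneg C2], fun s hs => ⟨?_, ?_⟩⟩
  · have := hC1 s (abs_le.1 hs)
    rw [Real.norm_eq_abs] at this
    linarith [le_abs_self C1, abs_nonneg C2]
  · have := hC2 s (abs_le.1 hs)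
    rw [Real.norm_eq_abs] at this
    linarith [le_abs_self C2, abs_nonneg C1]

lemma rad_nonneg (x : E3) : 0 ≤ rad x := Real.sqrt_nonneg _

lemma rad_sq (x : E3) : rad x ^ 2 = x 0 ^ 2 + x 1 ^ 2 := Real.sq_sqrt (by positivity)

lemma abs_coord_le_norm (x : E3) (i : Fin 3) : |x i| ≤ ‖x‖ := by
  simpa using PiLp.norm_apply_le x i

lemma barrier_pos {α c h : ℝ} (hc : 0 < c) (hh : 0 < h) (x : E3) : 0 < barrier α c (h, x) := by
  have : 0 ≤ (h * h + (x 0 * x 0 + x 1 * x 1)) ^ ((1 + α) / 2) :=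
    Real.rpow_nonneg (add_nonneg (mul_self_nonneg _)
      (add_nonneg (mul_self_nonneg _) (mul_self_nonneg _))) _
  unfold barrier
  positivity

lemma rad_rpow (x : E3) (α : ℝ) : rad x ^ (1 + α) = (x 0 * x 0 + x 1 * x 1) ^ ((1 + α) / 2) := by
  rw [rad, Real.sqrt_eq_rpow, ← Real.rpow_mul (by positivity), sq, sq]
  congr 1
  ring

lemma barrier_lower {α c h : ℝ} (hα : 0 < α) (hc : 0 < c) (x : E3) :
    c * (h + rad x ^ (1 + α)) ≤ barrier α c (h, x) := by
  unfold barrier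
  rw [rad_rpow]
  have h0 : 0 ≤ x 0 * x 0 + x 1 * x 1 := add_nonneg (mul_self_nonneg _) (mul_self_nonneg _)
  have h1 := mul_self_nonneg h
  refine mul_le_mul_of_nonneg_left (add_le_add_right ?_ _) hc.le
  exact Real.rpow_le_rpow h0 (by simp only; linarith) (by linarith)

/-- The smallness of `c` leaves room between the surface `x₃ = barrier` and the body, so that the
layer in which the test field varies ends below the body. -/
lemma barrier_upper {α c h N : ℝ} (hα : 0 < α) (hα1 : α < 1) (hh : 0 < h) (hN : h ≤ N)
    (hc : 0 < c) (hcN : c * (6 * (1 + N)) ≤ 1) (x : E3) :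
    barrier α c (h, x) ≤ (h + rad x ^ (1 + α)) / 2 := by
  have h0 : 0 ≤ x 0 * x 0 + x 1 * x 1 := add_nonneg (mul_self_nonneg _) (mul_self_nonneg _)
  have hp : 0 < (1 + α) / 2 := by linarith
  set t := x 0 * x 0 + x 1 * x 1 with ht
  have key : (h * h + t) ^ ((1 + α) / 2) ≤ h ^ (1 + α) + t ^ ((1 + α) / 2) := by
    have e : h ^ (1 + α) = (h * h) ^ ((1 + α) / 2) := by
      rw [← sq, ← Real.rpow_natCast, ← Real.rpow_mul hh.le]
      congr 1
      push_cast
      ring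
    rw [e]
    exact Real.rpow_add_le_add_rpow (by positivity) h0 hp.le (by linarith)
  have k2 : h ^ (1 + α) ≤ h * (1 + N) := by
    rw [Real.rpow_add hh, Real.rpow_one]
    gcongr
    calc h ^ α ≤ (1 + N) ^ α := by gcongr; linarith
      _ ≤ (1 + N) ^ (1 : ℝ) := Real.rpow_le_rpow_of_exponent_le (by linarith) hα1.le
      _ = 1 + N := Real.rpow_one _
  have hr := rad_rpow x α
  have hr0 : 0 ≤ rad x ^ (1 + α) := Real.rpow_nonneg (rad_nonneg x) _
  unfold barrier
  rw [hr] at *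
  simp only
  rw [← ht]
  rw [← ht] at hr0
  calc c * (h + (h * h + t) ^ ((1 + α) / 2))
      ≤ c * (h * (2 + N) + t ^ ((1 + α) / 2)) := by
        refine mul_le_mul_of_nonneg_left ?_ hc.le; linarith
    _ ≤ (h + t ^ ((1 + α) / 2)) / 2 := by
        have a1 : c ≤ 1 / 2 := by nlinarith
        have a2 : c * (2 + N) ≤ 1 / 2 := by nlinarith
        nlinarith [mul_le_mul_of_nonneg_right a1 hr0, mul_le_mul_of_nonneg_right a2 hh.le]

/-- The height of the body above the floor, as a linear map on `ℝ × E3`. -/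
noncomputable def fstL : (ℝ × E3) →L[ℝ] ℝ := ContinuousLinearMap.fst ℝ ℝ E3

/-- The spatial coordinates as linear maps on `ℝ × E3`. -/
noncomputable def coordL (i : Fin 3) : (ℝ × E3) →L[ℝ] ℝ :=
  (EuclideanSpace.proj (𝕜 := ℝ) i).comp (ContinuousLinearMap.snd ℝ ℝ E3)

@[simp] lemma fstL_apply (y : ℝ × E3) : fstL y = y.1 := rfl

@[simp] lemma coordL_apply (i : Fin 3) (y : ℝ × E3) : coordL i y = y.2 i := rfl

lemma jetBound_fst (y : ℝ × E3) : JetBound (fun z : ℝ × E3 => z.1) y |y.1| 1 0 :=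
  JetBound.linear fstL zero_le_one fun v => by
    rw [one_mul, fstL_apply]; exact norm_fst_le v

lemma jetBound_coord (i : Fin 3) (y : ℝ × E3) :
    JetBound (fun z : ℝ × E3 => z.2 i) y |y.2 i| 1 0 :=
  JetBound.linear (coordL i) zero_le_one fun v => by
    rw [one_mul, coordL_apply]; exact (abs_coord_le_norm _ _).trans (norm_snd_le v)

lemma deriv_rpow_bounds {p q : ℝ} (hp : 0 < p) (hp1 : p < 1) (hq : 0 < q) :
    |deriv (fun s : ℝ => s ^ p) q| ≤ q ^ (p - 1) ∧
      |deriv (deriv (fun s : ℝ => s ^ p)) q| ≤ q ^ (p - 2) := by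
  have h0 : ∀ s : ℝ, 0 < s → deriv (fun s : ℝ => s ^ p) s = p * s ^ (p - 1) := fun s hs =>
    (Real.hasDerivAt_rpow_const (Or.inl hs.ne')).deriv
  have h1 : deriv (fun s : ℝ => s ^ p) =ᶠ[𝓝 q] fun s => p * s ^ (p - 1) := by
    filter_upwards [lt_mem_nhds hq] with s hs
    exact h0 s hs
  constructor
  · rw [h0 q hq, abs_of_nonneg (by positivity)]
    exact mul_le_of_le_one_left (by positivity) hp1.le
  · rw [h1.deriv_eq, ((Real.hasDerivAt_rpow_const (Or.inl hq.ne')).const_mul p).deriv,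
      abs_mul, abs_mul, abs_of_pos hp, abs_of_nonneg (Real.rpow_nonneg hq.le _), ← mul_assoc,
      show p - 1 - 1 = p - 2 by ring]
    refine mul_le_of_le_one_left (by positivity) ?_
    rw [abs_of_neg (by linarith)]
    nlinarith

/-- With `H` the value of the barrier, its first derivatives are bounded and its second ones are of
order `1 / H`: for `q = h² + r²` the exponent `(1 + α) / 2` of `q` makes them of order `q ^ (α / 2)`
and `q ^ ((α - 1) / 2)`, while `H` is at most of order `√q`. -/
lemma jetBound_barrier {α c h N : ℝ} (hα : 0 < α) (hα1 : α < 1) (hh : 0 < h) (hN : h ≤ N)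
    (hc : 0 < c) (hc1 : c ≤ 1) {x : E3} (hx : ‖x‖ ≤ 1) :
    JetBound (barrier α c) (h, x) (barrier α c (h, x)) (100 * (N ^ 2 + 3))
      (100 * (N ^ 2 + 3) / barrier α c (h, x)) := by
  set H := barrier α c (h, x) with hH
  have Hpos : 0 < H := barrier_pos hc hh x
  set q := h * h + (x 0 * x 0 + x 1 * x 1) with hq
  have x0 : |x 0| ≤ 1 := (abs_coord_le_norm x 0).trans hx
  have x1 : |x 1| ≤ 1 := (abs_coord_le_norm x 1).trans hx
  have hq0 : 0 < q := by nlinarith [mul_self_nonneg (x 0), mul_self_nonneg (x 1)]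
  set Q := N ^ 2 + 3 with hQ
  have hqQ : q ≤ Q := by
    have a0 := abs_le.1 x0
    have a1 := abs_le.1 x1
    nlinarith
  set ρ := Real.sqrt q with hρ
  have hρh : h ≤ ρ := Real.le_sqrt_of_sq_le (by nlinarith [mul_self_nonneg (x 0), mul_self_nonneg (x 1)])
  have hρ0 : |x 0| ≤ ρ := Real.le_sqrt_of_sq_le (by
    rw [sq_abs]; nlinarith [mul_self_nonneg h, mul_self_nonneg (x 1)])
  have hρ1 : |x 1| ≤ ρ := Real.le_sqrt_of_sq_le (by
    rw [sq_abs]; nlinarith [mul_self_nonneg h, mul_self_nonneg (x 0)])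
  set p := (1 + α) / 2 with hp
  have hp0 : 0 < p := by rw [hp]; linarith
  have hp1 : p < 1 := by rw [hp]; linarith
  have j0 : JetBound (fun z : ℝ × E3 => z.1 * z.1 + (z.2 0 * z.2 0 + z.2 1 * z.2 1)) (h, x)
      q (6 * ρ) 6 := by
    refine (((jetBound_fst (h, x)).mul (jetBound_fst (h, x))).add
      (((jetBound_coord 0 (h, x)).mul (jetBound_coord 0 (h, x))).add
      ((jetBound_coord 1 (h, x)).mul (jetBound_coord 1 (h, x))))).mono ?_ ?_ ?_
    · simp [hq]
    · simp only [abs_of_pos hh]; linarith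
    · linarith
  obtain ⟨e1, e2⟩ := deriv_rpow_bounds hp0 hp1 hq0
  have j1 := j0.comp (φ := fun s => s ^ p) (Real.contDiffAt_rpow_const_of_ne hq0.ne')
    (e₀ := q ^ p) (le_of_eq (abs_of_nonneg (Real.rpow_nonneg hq0.le _))) e1 e2
  have j2 := ((jetBound_fst (h, x)).add j1).const_mul c
  have f1 : ρ = q ^ (1 / 2 : ℝ) := Real.sqrt_eq_rpow q
  have f2 : q ^ (p - 1) * (6 * ρ) = 6 * q ^ (α / 2) := by
    rw [f1, mul_left_comm, ← Real.rpow_add hq0]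
    congr 2
    rw [hp]; ring
  have f3 : q ^ (p - 2) * (6 * ρ) ^ 2 = 36 * q ^ (p - 1) := by
    rw [mul_pow, hρ, Real.sq_sqrt hq0.le, show p - 2 = p - 1 - 1 by ring,
      Real.rpow_sub_one hq0.ne' (p - 1)]
    field_simp
    norm_num
  have pw : ∀ t : ℝ, 0 ≤ t → t ≤ 1 → q ^ t ≤ Q := fun t ht ht1 => by
    have hQ1 : 1 ≤ Q := by rw [hQ]; nlinarith [sq_nonneg N]
    calc q ^ t ≤ Q ^ t := by gcongr
      _ ≤ Q ^ (1 : ℝ) := Real.rpow_le_rpow_of_exponent_le hQ1 ht1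
      _ = Q := Real.rpow_one _
  have hQ1 : 1 ≤ Q := by rw [hQ]; nlinarith [sq_nonneg N]
  have f4 : H * q ^ (p - 1) ≤ c * (2 * Q) := by
    have : H = c * (h + q ^ p) := rfl
    rw [this, mul_assoc]
    refine mul_le_mul_of_nonneg_left ?_ hc.le
    rw [add_mul, ← Real.rpow_add hq0]
    have g1 : h * q ^ (p - 1) ≤ q ^ (α / 2) := by
      calc h * q ^ (p - 1) ≤ q ^ (1 / 2 : ℝ) * q ^ (p - 1) := by rw [← f1]; gcongr
        _ = q ^ (α / 2) := by
          rw [← Real.rpow_add hq0]; congr 1; rw [hp]; ring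
    have g2 := pw (α / 2) (by linarith) (by linarith)
    have g3 := pw (p + (p - 1)) (by rw [hp]; linarith) (by linarith)
    linarith
  refine j2.mono ?_ ?_ ?_
  · simp only [abs_of_pos hc, abs_of_pos hh]
    exact le_of_eq rfl
  · rw [f2, abs_of_pos hc]
    have g2 := pw (α / 2) (by linarith) (by linarith)
    nlinarith
  · rw [f3, abs_of_pos hc, le_div_iff₀ Hpos]
    have : c * (0 + (q ^ (p - 1) * 6 + 36 * q ^ (p - 1))) * H = 42 * c * (H * q ^ (p - 1)) := by
      ring
    rw [this]
    calc 42 * c * (H * q ^ (p - 1)) ≤ 42 * 1 * (1 * (2 * Q)) := by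
          refine mul_le_mul (by linarith) (f4.trans ?_) (by positivity) (by norm_num)
          exact mul_le_mul_of_nonneg_right hc1 (by linarith)
      _ ≤ 100 * Q := by linarith

/-! ### The potential of the test field -/

lemma norm_stdVec (j : Fin 3) : ‖stdVec j‖ = 1 := by simp [stdVec]

lemma norm_e3 : ‖e3‖ = 1 := norm_stdVec 2

/-- The potential of the test field: a cutoff `η` that moves with the body, times a factor that
vanishes in a layer at the floor below the tip of the body; `χ` localizes this layer. -/
noncomputable def potential (η χ : E3 → ℝ) (α c : ℝ) (y : ℝ × E3) : ℝ :=
  η (y.2 - y.1 • e3) * (1 - χ y.2 * (1 - ramp (y.2 2 / barrier α c y)))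

/-- The set of points at which the derivatives of the potential at height `h` are not bounded
uniformly in `h`. -/
def layer (χ : E3 → ℝ) (α c h : ℝ) : Set E3 :=
  {x | x ∈ tsupport χ ∧ barrier α c (h, x) / 4 ≤ x 2 ∧ x 2 ≤ 3 * barrier α c (h, x) / 4}

/-- The map to the frame of the body. -/
noncomputable def shiftL : (ℝ × E3) →L[ℝ] E3 :=
  ContinuousLinearMap.snd ℝ ℝ E3 - (ContinuousLinearMap.fst ℝ ℝ E3).smulRight e3

@[simp] lemma shiftL_apply (y : ℝ × E3) : shiftL y = y.2 - y.1 • e3 := rfl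

lemma norm_shiftL_le (v : ℝ × E3) : ‖shiftL v‖ ≤ 2 * ‖v‖ := by
  rw [shiftL_apply]
  refine (norm_sub_le _ _).trans ?_
  rw [norm_smul, norm_e3, mul_one]
  linarith [norm_fst_le v, norm_snd_le v]

lemma deriv_inv_bounds {H : ℝ} (hH : 0 < H) :
    |deriv (fun s : ℝ => s⁻¹) H| ≤ 1 / H ^ 2 ∧
      |deriv (deriv (fun s : ℝ => s⁻¹)) H| ≤ 2 / H ^ 3 := by
  have h0 : deriv (fun s : ℝ => s⁻¹) = fun s => -(s ^ 2)⁻¹ := by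
    ext s; simp
  constructor
  · rw [h0, abs_neg, abs_of_nonneg (by positivity), one_div]
  · rw [h0]
    have h1 : HasDerivAt (fun s : ℝ => -(s ^ 2)⁻¹) (2 / H ^ 3) H := by
      have := ((hasDerivAt_pow 2 H).inv (pow_ne_zero 2 hH.ne')).neg
      refine this.congr_deriv ?_
      simp only [Nat.cast_ofNat, Nat.add_one_sub_one, pow_one]
      field_simp
    rw [h1.deriv, abs_of_nonneg (by positivity)]

/-- In the layer, the step function varies on the scale of the gap. -/
lemma exists_jetBound_ramp (N : ℝ) : ∃ C : ℝ, 1 ≤ C ∧ ∀ {α c h : ℝ}, 0 < α → α < 1 → 0 < h →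
    h ≤ N → 0 < c → c ≤ 1 → ∀ {x : E3}, ‖x‖ ≤ 1 → |x 2| ≤ barrier α c (h, x) →
    JetBound (fun y : ℝ × E3 => ramp (y.2 2 / barrier α c y)) (h, x) 1
      (C / barrier α c (h, x)) (C / barrier α c (h, x) ^ 2) := by
  obtain ⟨R, hR, hRd⟩ := exists_deriv_ramp_bound
  set A := 100 * (N ^ 2 + 3) with hA
  have hA1 : 1 ≤ A := by rw [hA]; nlinarith [sq_nonneg N]
  refine ⟨R * (3 * A + 2 * A ^ 2) + R * (A + 1) ^ 2, by nlinarith [sq_nonneg (A + 1)], ?_⟩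
  intro α c h hα hα1 hh hN hc hc1 x hx hxH
  set H := barrier α c (h, x) with hH
  have Hpos : 0 < H := barrier_pos hc hh x
  have j0 := jetBound_barrier hα hα1 hh hN hc hc1 hx
  rw [← hA, ← hH] at j0
  obtain ⟨e1, e2⟩ := deriv_inv_bounds Hpos
  have j1 := j0.comp (φ := fun s => s⁻¹) (contDiffAt_inv ℝ Hpos.ne') (e₀ := 1 / H)
    (by rw [abs_of_pos (inv_pos.2 Hpos), one_div]) e1 e2
  have j2 := ((jetBound_coord 2 (h, x)).mono hxH le_rfl le_rfl).mul j1
  have j3 : JetBound (fun y : ℝ × E3 => y.2 2 / barrier α c y) (h, x) 1 ((A + 1) / H)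
      ((3 * A + 2 * A ^ 2) / H ^ 2) := by
    refine j2.mono ?_ ?_ ?_
    · field_simp; rfl
    · apply le_of_eq; field_simp
    · apply le_of_eq; field_simp; ring
  have hs : |x 2 / H| ≤ 1 := j3.val
  have j4 := j3.comp (φ := ramp) contDiff_ramp.contDiffAt (abs_ramp_le _) (hRd _ hs).1 (hRd _ hs).2
  refine j4.mono le_rfl ?_ ?_
  · rw [← mul_div_assoc]
    gcongr
    nlinarith [mul_nonneg (by linarith : 0 ≤ R) (sq_nonneg A)]
  · apply le_of_eq; field_simp

/-- Bounds that scale like powers of `l` are stable under products. -/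
lemma JetBound.mul_scaled {E : Type*} [NormedAddCommGroup E] [NormedSpace ℝ E] {f g : E → ℝ}
    {y : E} {a b l : ℝ} (hf : JetBound f y a (a * l) (a * l ^ 2))
    (hg : JetBound g y b (b * l) (b * l ^ 2)) :
    JetBound (fun z => f z * g z) y (4 * (a * b)) (4 * (a * b) * l) (4 * (a * b) * l ^ 2) := by
  have h0 : 0 ≤ a * b := mul_nonneg hf.a_nonneg hg.a_nonneg
  have h1 : 0 ≤ a * b * l := by
    rw [mul_assoc]; exact mul_nonneg hf.a_nonneg hg.b_nonneg
  refine (hf.mul hg).mono (by linarith) (by linarith) (le_of_eq (by ring))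

lemma JetBound.one_sub_scaled {E : Type*} [NormedAddCommGroup E] [NormedSpace ℝ E] {f : E → ℝ}
    {y : E} {a l : ℝ} (hl : 0 ≤ l) (hf : JetBound f y a (a * l) (a * l ^ 2)) :
    JetBound (fun z => 1 + (-1) * f z) y (1 + a) ((1 + a) * l) ((1 + a) * l ^ 2) := by
  refine ((JetBound.const (y := y) 1).add (hf.const_mul (-1))).mono ?_ ?_ ?_ <;>
  simp only [abs_neg, abs_one, one_mul, zero_add, le_refl, add_mul] <;> nlinarith [sq_nonneg l]

lemma exists_jetBound_shift {η : E3 → ℝ} (hη : ContDiff ℝ 2 η) (hηc : HasCompactSupport η) :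
    ∃ C : ℝ, 1 ≤ C ∧ ∀ y, JetBound (fun y : ℝ × E3 => η (y.2 - y.1 • e3)) y C C C := by
  obtain ⟨C, hC, j⟩ := hηc.exists_jetBound hη
  exact ⟨4 * C, by linarith, fun y =>
    (JetBound.comp_linear shiftL (z := y) (by norm_num) norm_shiftL_le (j (shiftL y))).mono
      (by linarith) (by linarith) (by linarith)⟩

lemma exists_jetBound_snd {χ : E3 → ℝ} (hχ : ContDiff ℝ 2 χ) (hχc : HasCompactSupport χ) :
    ∃ C : ℝ, 1 ≤ C ∧ ∀ y, JetBound (fun y : ℝ × E3 => χ y.2) y C C C := by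
  obtain ⟨C, hC, j⟩ := hχc.exists_jetBound hχ
  exact ⟨C, hC, fun y =>
    (JetBound.comp_linear (ContinuousLinearMap.snd ℝ ℝ E3) (z := y) zero_le_one
      (fun v => by rw [one_mul]; exact norm_snd_le v) (j y.2)).mono le_rfl
      (by linarith) (by linarith)⟩

lemma barrier_le_of_norm_le_one {α c h N : ℝ} (hα : 0 < α) (hα1 : α < 1) (hh : 0 < h) (hN : h ≤ N)
    (hc : 0 < c) (hcN : c * (6 * (1 + N)) ≤ 1) {x : E3} (hx : ‖x‖ ≤ 1) :
    barrier α c (h, x) ≤ N + 2 := by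
  have h1 := barrier_upper hα hα1 hh hN hc hcN x
  have h2 : rad x ^ (1 + α) ≤ 2 ^ (1 + α) := by
    refine Real.rpow_le_rpow (rad_nonneg x) ?_ (by linarith)
    refine Real.sqrt_le_iff.2 ⟨by norm_num, ?_⟩
    have a0 := abs_le.1 ((abs_coord_le_norm x 0).trans hx)
    have a1 := abs_le.1 ((abs_coord_le_norm x 1).trans hx)
    nlinarith
  have h3 : (2 : ℝ) ^ (1 + α) ≤ 2 ^ (2 : ℝ) :=
    Real.rpow_le_rpow_of_exponent_le (by norm_num) (by linarith)
  have h4 : (2 : ℝ) ^ (2 : ℝ) = 4 := by norm_num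
  linarith

/-- Bounds with powers of `1 / H` are bounds with powers of `k / H`. -/
lemma JetBound.rescale {E : Type*} [NormedAddCommGroup E] [NormedSpace ℝ E] {f : E → ℝ}
    {y : E} {a H k : ℝ} (hH : 0 < H) (ha : 1 ≤ a) (hk : 1 ≤ k)
    (hf : JetBound f y 1 (a / H) (a / H ^ 2)) :
    JetBound f y a (a * (k / H)) (a * (k / H) ^ 2) := by
  refine hf.mono ha ?_ ?_
  · rw [← mul_div_assoc]
    gcongr
    nlinarith
  · rw [div_pow, ← mul_div_assoc]
    gcongr
    exact le_mul_of_one_le_right (by linarith) (one_le_pow₀ hk)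

lemma JetBound.unscale {E : Type*} [NormedAddCommGroup E] [NormedSpace ℝ E] {f : E → ℝ}
    {y : E} {a H k : ℝ} (hH : 0 < H) (hk : 1 ≤ k)
    (hf : JetBound f y a (a * (k / H)) (a * (k / H) ^ 2)) :
    JetBound f y (a * k ^ 2) (a * k ^ 2 / H) (a * k ^ 2 / H ^ 2) := by
  have ha := hf.a_nonneg
  refine hf.mono (le_mul_of_one_le_right ha (one_le_pow₀ hk)) ?_ ?_
  · rw [← mul_div_assoc]
    gcongr
    nlinarith
  · rw [div_pow, ← mul_div_assoc]

lemma JetBound.scale_of_one_le {E : Type*} [NormedAddCommGroup E] [NormedSpace ℝ E] {f : E → ℝ}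
    {y : E} {a l : ℝ} (hl : 1 ≤ l) (hf : JetBound f y a a a) :
    JetBound f y a (a * l) (a * l ^ 2) :=
  hf.mono le_rfl (le_mul_of_one_le_right hf.a_nonneg hl)
    (le_mul_of_one_le_right hf.a_nonneg (one_le_pow₀ hl))

/-- In the layer, the derivatives of the potential scale like powers of the reciprocal of the gap,
uniformly in the height. -/
lemma exists_jetBound_potential_layer {η χ : E3 → ℝ} (hη : ContDiff ℝ 2 η)
    (hηc : HasCompactSupport η) (hχ : ContDiff ℝ 2 χ) (hχs : tsupport χ ⊆ Metric.closedBall 0 1)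
    {N : ℝ} (hN0 : 0 < N) {α c : ℝ} (hα : 0 < α) (hα1 : α < 1) (hc : 0 < c)
    (hcN : c * (6 * (1 + N)) ≤ 1) :
    ∃ C : ℝ, 1 ≤ C ∧ ∀ h, 0 < h → h ≤ N → ∀ x ∈ layer χ α c h,
      JetBound (potential η χ α c) (h, x) C (C / barrier α c (h, x))
        (C / barrier α c (h, x) ^ 2) := by
  have hχc : HasCompactSupport χ :=
    (isCompact_closedBall (0 : E3) 1).of_isClosed_subset (isClosed_tsupport χ) hχs
  obtain ⟨Cη, hCη, jη⟩ := exists_jetBound_shift hη hηc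
  obtain ⟨Cχ, hCχ, jχ⟩ := exists_jetBound_snd hχ hχc
  obtain ⟨Cr, hCr, jr⟩ := exists_jetBound_ramp N
  refine ⟨4 * (Cη * (1 + 4 * (Cχ * (1 + Cr)))) * (N + 2) ^ 2, ?_, fun h hh hN x hx => ?_⟩
  · have h1 : 1 ≤ 1 + 4 * (Cχ * (1 + Cr)) := by nlinarith
    have h2 : 1 ≤ Cη * (1 + 4 * (Cχ * (1 + Cr))) := by nlinarith
    have h3 : 1 ≤ (N + 2) ^ 2 := by nlinarith
    nlinarith
  obtain ⟨hx1, hx2, hx3⟩ := hx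
  have hxn : ‖x‖ ≤ 1 := by simpa using hχs hx1
  have Hpos : 0 < barrier α c (h, x) := barrier_pos hc hh x
  have hc1 : c ≤ 1 := by nlinarith
  have jramp := jr hα hα1 hh hN hc hc1 hxn (by rw [abs_of_nonneg (by linarith)]; linarith)
  have HN := barrier_le_of_norm_le_one hα hα1 hh hN hc hcN hxn
  have hk : 1 ≤ N + 2 := by linarith
  have i1 : 1 ≤ (N + 2) / barrier α c (h, x) := by rwa [le_div_iff₀ Hpos, one_mul]
  have i0 : 0 ≤ (N + 2) / barrier α c (h, x) := zero_le_one.trans i1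
  have j := ((jη (h, x)).scale_of_one_le i1).mul_scaled ((((jχ (h, x)).scale_of_one_le i1).mul_scaled
    ((jramp.rescale Hpos hCr hk).one_sub_scaled i0)).one_sub_scaled i0)
  refine (j.congr (Eventually.of_forall fun y => ?_)).unscale Hpos hk
  simp only [potential]
  ring

/-- Outside the layer, the derivatives of the potential are bounded uniformly in the height. -/
lemma exists_jetBound_potential_off {η χ : E3 → ℝ} (hη : ContDiff ℝ 2 η)
    (hηc : HasCompactSupport η) (hχ : ContDiff ℝ 2 χ) (hχs : tsupport χ ⊆ Metric.closedBall 0 1)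
    {N : ℝ} (hN0 : 0 < N) {α c : ℝ} (hα : 0 < α) (hα1 : α < 1) (hc : 0 < c)
    (hcN : c * (6 * (1 + N)) ≤ 1) :
    ∃ C : ℝ, 1 ≤ C ∧ ∀ h, 0 < h → h ≤ N → ∀ x ∉ layer χ α c h,
      JetBound (potential η χ α c) (h, x) C C C := by
  have hχc : HasCompactSupport χ :=
    (isCompact_closedBall (0 : E3) 1).of_isClosed_subset (isClosed_tsupport χ) hχs
  obtain ⟨Cη, hCη, jη⟩ := exists_jetBound_shift hη hηc
  obtain ⟨Cχ, hCχ, jχ⟩ := exists_jetBound_snd hχ hχc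
  have jout : ∀ y : ℝ × E3, JetBound (fun y : ℝ × E3 => η (y.2 - y.1 • e3) * (1 + (-1) * χ y.2)) y
      (4 * (Cη * (1 + Cχ))) (4 * (Cη * (1 + Cχ))) (4 * (Cη * (1 + Cχ))) := fun y => by
    have := ((jη y).scale_of_one_le le_rfl).mul_scaled
      (((jχ y).scale_of_one_le le_rfl).one_sub_scaled zero_le_one)
    simpa using this
  have hC : Cη ≤ 4 * (Cη * (1 + Cχ)) := by nlinarith
  refine ⟨4 * (Cη * (1 + Cχ)), hCη.trans hC, fun h hh hN x hx => ?_⟩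
  have jη2 := (jη (h, x)).mono hC hC hC
  by_cases hx1 : x ∈ tsupport χ
  · have hxn : ‖x‖ ≤ 1 := by simpa using hχs hx1
    have hc1 : c ≤ 1 := by nlinarith
    have hcont : ContinuousAt (barrier α c) (h, x) :=
      (jetBound_barrier hα hα1 hh hN hc hc1 hxn).smooth.continuousAt
    have hcoord : ContinuousAt (fun y : ℝ × E3 => y.2 2) (h, x) :=
      (jetBound_coord 2 (h, x)).smooth.continuousAt
    have hpos : ∀ᶠ y in 𝓝 (h, x), 0 < barrier α c y :=
      hcont.eventually (lt_mem_nhds (barrier_pos hc hh x))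
    rcases lt_or_ge (x 2) (barrier α c (h, x) / 4) with hlt | hge
    · refine (jout (h, x)).congr ?_
      have : ∀ᶠ y in 𝓝 (h, x), y.2 2 < barrier α c y / 4 :=
        hcoord.eventually_lt (hcont.div_const 4) hlt
      filter_upwards [this, hpos] with y hy hp
      rw [potential, ramp_eq_zero (by rw [div_le_iff₀ hp]; linarith)]
      ring
    · have hgt : 3 * barrier α c (h, x) / 4 < x 2 := by
        by_contra hcon
        exact hx ⟨hx1, hge, not_lt.1 hcon⟩
      refine jη2.congr ?_
      have : ∀ᶠ y in 𝓝 (h, x), 3 * barrier α c y / 4 < y.2 2 :=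
        ((hcont.const_mul 3).div_const 4).eventually_lt hcoord hgt
      filter_upwards [this, hpos] with y hy hp
      rw [potential, ramp_eq_one (by rw [le_div_iff₀ hp]; linarith)]
      ring
  · refine jη2.congr ?_
    have : ∀ᶠ y : ℝ × E3 in 𝓝 (h, x), χ y.2 = 0 :=
      continuousAt_snd.eventually (notMem_tsupport_iff_eventuallyEq.1 hx1)
    filter_upwards [this] with y hy
    rw [potential, hy]
    ring

/-! ### The solenoidal field of a potential -/

/-- Spatial partial derivative of a function of the height and the position. -/
noncomputable def pd (Ψ : ℝ × E3 → ℝ) (j : Fin 3) (y : ℝ × E3) : ℝ := fderiv ℝ Ψ y (0, stdVec j)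

/-- The components of `curl (Ψ (-x₂, x₁, 0) / 2)`. -/
noncomputable def liftComp (Ψ : ℝ × E3 → ℝ) (i : Fin 3) (y : ℝ × E3) : ℝ :=
  ![-(1 / 2) * (y.2 0 * pd Ψ 2 y), -(1 / 2) * (y.2 1 * pd Ψ 2 y),
    Ψ y + (1 / 2) * (y.2 0 * pd Ψ 0 y + y.2 1 * pd Ψ 1 y)] i

/-- The solenoidal field `curl (Ψ (-x₂, x₁, 0) / 2)`; it is `e₃` where `Ψ = 1`. -/
noncomputable def liftField (Ψ : ℝ × E3 → ℝ) (y : ℝ × E3) : E3 :=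
  WithLp.toLp 2 fun i => liftComp Ψ i y

lemma liftField_apply (Ψ : ℝ × E3 → ℝ) (y : ℝ × E3) (i : Fin 3) :
    liftField Ψ y i = liftComp Ψ i y := rfl

lemma contDiffAt_pd {Ψ : ℝ × E3 → ℝ} {y : ℝ × E3} (h : ContDiffAt ℝ 2 Ψ y) (j : Fin 3) :
    ContDiffAt ℝ 1 (pd Ψ j) y :=
  (h.fderiv_right (m := 1) (by norm_num)).clm_apply contDiffAt_const

lemma contDiff_coord (i : Fin 3) : ContDiff ℝ 1 (fun y : ℝ × E3 => y.2 i) := (coordL i).contDiff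

lemma contDiffAt_liftComp {Ψ : ℝ × E3 → ℝ} {y : ℝ × E3} (h : ContDiffAt ℝ 2 Ψ y) (i : Fin 3) :
    ContDiffAt ℝ 1 (liftComp Ψ i) y := by
  have h1 : ContDiffAt ℝ 1 Ψ y := h.of_le (by norm_num)
  have c0 := (contDiff_coord 0).contDiffAt (x := y)
  have c1 := (contDiff_coord 1).contDiffAt (x := y)
  fin_cases i
  · exact contDiffAt_const.mul (c0.mul (contDiffAt_pd h 2))
  · exact contDiffAt_const.mul (c1.mul (contDiffAt_pd h 2))
  · exact h1.add (contDiffAt_const.mul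
      ((c0.mul (contDiffAt_pd h 0)).add (c1.mul (contDiffAt_pd h 1))))

lemma contDiffAt_liftField {Ψ : ℝ × E3 → ℝ} {y : ℝ × E3} (h : ContDiffAt ℝ 2 Ψ y) :
    ContDiffAt ℝ 1 (liftField Ψ) y :=
  contDiffAt_euclidean.2 fun i => contDiffAt_liftComp h i

lemma fderiv_liftField_apply {Ψ : ℝ × E3 → ℝ} {y : ℝ × E3} (h : ContDiffAt ℝ 2 Ψ y) (v : ℝ × E3)
    (i : Fin 3) : (fderiv ℝ (liftField Ψ) y v) i = fderiv ℝ (liftComp Ψ i) y v := by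
  have hd := (contDiffAt_liftField h).differentiableAt one_ne_zero
  have : HasFDerivAt (fun z => liftField Ψ z i) _ y :=
    (EuclideanSpace.proj (𝕜 := ℝ) i : E3 →L[ℝ] ℝ).hasFDerivAt.comp y hd.hasFDerivAt
  have e : (fun z => liftField Ψ z i) = liftComp Ψ i := rfl
  rw [e] at this
  rw [this.fderiv]
  rfl

/-- The derivatives of a component of the field in terms of those of the potential. -/
lemma fderiv_coord_mul_pd {Ψ : ℝ × E3 → ℝ} {y : ℝ × E3} (h : ContDiffAt ℝ 2 Ψ y) (v : ℝ × E3)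
    (i j : Fin 3) : fderiv ℝ (fun z : ℝ × E3 => z.2 i * pd Ψ j z) y v
      = y.2 i * fderiv ℝ (pd Ψ j) y v + pd Ψ j y * v.2 i := by
  have d : HasFDerivAt (fun z : ℝ × E3 => z.2 i * pd Ψ j z) _ y :=
    (coordL i).hasFDerivAt.mul ((contDiffAt_pd h j).differentiableAt one_ne_zero).hasFDerivAt
  rw [d.fderiv]
  simp

lemma differentiableAt_coord_mul_pd {Ψ : ℝ × E3 → ℝ} {y : ℝ × E3} (h : ContDiffAt ℝ 2 Ψ y)
    (i j : Fin 3) : DifferentiableAt ℝ (fun z : ℝ × E3 => z.2 i * pd Ψ j z) y :=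
  ((contDiff_coord i).contDiffAt.mul (contDiffAt_pd h j)).differentiableAt one_ne_zero

lemma fderiv_liftComp_horizontal {Ψ : ℝ × E3 → ℝ} {y : ℝ × E3} (h : ContDiffAt ℝ 2 Ψ y)
    (v : ℝ × E3) {i : Fin 3} (hi : i ≠ 2) : fderiv ℝ (liftComp Ψ i) y v
      = -(1 / 2) * (y.2 i * fderiv ℝ (pd Ψ 2) y v + pd Ψ 2 y * v.2 i) := by
  have e : liftComp Ψ i = fun z => -(1 / 2) * (z.2 i * pd Ψ 2 z) := by
    fin_cases i
    · rfl
    · rfl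
    · exact absurd rfl hi
  rw [e, fderiv_const_mul (differentiableAt_coord_mul_pd h i 2), smul_apply,
    fderiv_coord_mul_pd h, smul_eq_mul]

lemma fderiv_liftComp_vertical {Ψ : ℝ × E3 → ℝ} {y : ℝ × E3} (h : ContDiffAt ℝ 2 Ψ y)
    (v : ℝ × E3) : fderiv ℝ (liftComp Ψ 2) y v
      = fderiv ℝ Ψ y v + (1 / 2) * ((y.2 0 * fderiv ℝ (pd Ψ 0) y v + pd Ψ 0 y * v.2 0)
        + (y.2 1 * fderiv ℝ (pd Ψ 1) y v + pd Ψ 1 y * v.2 1)) := by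
  have e : liftComp Ψ 2 = fun z => Ψ z + (1 / 2) * (z.2 0 * pd Ψ 0 z + z.2 1 * pd Ψ 1 z) := rfl
  have d0 := differentiableAt_coord_mul_pd h 0 0
  have d1 := differentiableAt_coord_mul_pd h 1 1
  have d : HasFDerivAt (fun z => Ψ z + (1 / 2) * (z.2 0 * pd Ψ 0 z + z.2 1 * pd Ψ 1 z)) _ y :=
    (h.differentiableAt two_ne_zero).hasFDerivAt.add
      ((d0.hasFDerivAt.add d1.hasFDerivAt).const_mul (1 / 2))
  rw [e, d.fderiv, add_apply, smul_apply, add_apply, fderiv_coord_mul_pd h, fderiv_coord_mul_pd h,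
    smul_eq_mul]

lemma fderiv_pd_symm {Ψ : ℝ × E3 → ℝ} {y : ℝ × E3} (h : ContDiffAt ℝ 2 Ψ y) (i j : Fin 3) :
    fderiv ℝ (pd Ψ i) y (0, stdVec j) = fderiv ℝ (pd Ψ j) y (0, stdVec i) := by
  have hs : IsSymmSndFDerivAt ℝ Ψ y := h.isSymmSndFDerivAt (by simp)
  have hd : DifferentiableAt ℝ (fderiv ℝ Ψ) y :=
    (h.fderiv_right (m := 1) (by norm_num)).differentiableAt one_ne_zero
  have e : ∀ (k : Fin 3) (w : ℝ × E3),
      fderiv ℝ (pd Ψ k) y w = fderiv ℝ (fderiv ℝ Ψ) y w (0, stdVec k) := fun k w => by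
    have d : HasFDerivAt (pd Ψ k) _ y :=
      hd.hasFDerivAt.clm_apply (hasFDerivAt_const (0, stdVec k) y)
    rw [d.fderiv]
    simp
  rw [e, e, hs.eq]

lemma stdVec_apply (i j : Fin 3) : stdVec i j = if j = i then 1 else 0 := by
  simp [stdVec]

/-- The field of a potential is solenoidal. -/
lemma liftField_div {Ψ : ℝ × E3 → ℝ} {y : ℝ × E3} (h : ContDiffAt ℝ 2 Ψ y) :
    ∑ i, (fderiv ℝ (liftField Ψ) y (0, stdVec i)) i = 0 := by
  simp only [fderiv_liftField_apply h, Fin.sum_univ_three]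
  rw [fderiv_liftComp_horizontal h _ (by decide), fderiv_liftComp_horizontal h _ (by decide),
    fderiv_liftComp_vertical h, fderiv_pd_symm h 2 0, fderiv_pd_symm h 2 1]
  simp only [stdVec_apply]
  simp only [Fin.isValue, if_true, Fin.reduceEq, if_false]
  change _ + _ + (pd Ψ 2 y + _) = 0
  ring

lemma abs_coord_le_rad (x : E3) : |x 0| ≤ rad x ∧ |x 1| ≤ rad x :=
  ⟨Real.abs_le_sqrt (by nlinarith [sq_nonneg (x 1)]),
    Real.abs_le_sqrt (by nlinarith [sq_nonneg (x 0)])⟩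

lemma norm_zero_stdVec (j : Fin 3) : ‖((0 : ℝ), stdVec j)‖ = 1 := by
  rw [Prod.norm_mk, norm_stdVec]; simp

lemma norm_le_of_coord {w : E3} {b : ℝ} (h : ∀ i, |w i| ≤ b) : ‖w‖ ≤ 3 * b := by
  have hb : 0 ≤ b := (abs_nonneg _).trans (h 0)
  rw [EuclideanSpace.norm_eq, Fin.sum_univ_three]
  refine Real.sqrt_le_iff.2 ⟨by linarith, ?_⟩
  simp only [Real.norm_eq_abs]
  nlinarith [abs_nonneg (w 0), abs_nonneg (w 1), abs_nonneg (w 2), h 0, h 1, h 2,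
    mul_self_le_mul_self (abs_nonneg (w 0)) (h 0), mul_self_le_mul_self (abs_nonneg (w 1)) (h 1),
    mul_self_le_mul_self (abs_nonneg (w 2)) (h 2)]

lemma JetBound.abs_pd_le {Ψ : ℝ × E3 → ℝ} {y : ℝ × E3} {a b c : ℝ} (j : JetBound Ψ y a b c)
    (i : Fin 3) : |pd Ψ i y| ≤ b := by
  have := j.d1 (0, stdVec i)
  rwa [norm_zero_stdVec, mul_one] at this

lemma JetBound.abs_fderiv_pd_le {Ψ : ℝ × E3 → ℝ} {y : ℝ × E3} {a b c : ℝ} (j : JetBound Ψ y a b c)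
    (i : Fin 3) (v : ℝ × E3) : |fderiv ℝ (pd Ψ i) y v| ≤ c * ‖v‖ := by
  have := j.d2 (0, stdVec i) v
  rwa [norm_zero_stdVec, one_mul] at this

lemma abs_mul_le_mul {p q r s : ℝ} (h1 : |p| ≤ r) (h2 : |q| ≤ s) : |p * q| ≤ r * s := by
  rw [abs_mul]; exact mul_le_mul h1 h2 (abs_nonneg _) ((abs_nonneg _).trans h1)

lemma norm_liftField_le {Ψ : ℝ × E3 → ℝ} {y : ℝ × E3} {a b c : ℝ} (j : JetBound Ψ y a b c) :
    ‖liftField Ψ y‖ ≤ 3 * (a + rad y.2 * b) := by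
  obtain ⟨h0, h1⟩ := abs_coord_le_rad y.2
  have ha := j.a_nonneg
  have hb := j.b_nonneg
  have hr := rad_nonneg y.2
  have k2 := j.abs_pd_le 2
  have m02 := abs_mul_le_mul h0 (j.abs_pd_le 2)
  have m12 := abs_mul_le_mul h1 (j.abs_pd_le 2)
  have m00 := abs_mul_le_mul h0 (j.abs_pd_le 0)
  have m11 := abs_mul_le_mul h1 (j.abs_pd_le 1)
  have hv := j.val
  refine norm_le_of_coord fun i => ?_
  rw [liftField_apply]
  rw [abs_le] at *
  fin_cases i
  · change _ ≤ -(1 / 2) * (y.2 0 * pd Ψ 2 y) ∧ -(1 / 2) * (y.2 0 * pd Ψ 2 y) ≤ _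
    constructor <;> linarith
  · change _ ≤ -(1 / 2) * (y.2 1 * pd Ψ 2 y) ∧ -(1 / 2) * (y.2 1 * pd Ψ 2 y) ≤ _
    constructor <;> linarith
  · change _ ≤ Ψ y + (1 / 2) * (y.2 0 * pd Ψ 0 y + y.2 1 * pd Ψ 1 y) ∧
      Ψ y + (1 / 2) * (y.2 0 * pd Ψ 0 y + y.2 1 * pd Ψ 1 y) ≤ _
    constructor <;> linarith

lemma abs_fderiv_liftField_le {Ψ : ℝ × E3 → ℝ} {y : ℝ × E3} {a b c : ℝ} (j : JetBound Ψ y a b c)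
    {v : ℝ × E3} (hv : ‖v‖ ≤ 1) (i : Fin 3) :
    |(fderiv ℝ (liftField Ψ) y v) i| ≤ 2 * b + rad y.2 * c := by
  obtain ⟨h0, h1⟩ := abs_coord_le_rad y.2
  have hb := j.b_nonneg
  have hc := j.c_nonneg
  have hr := rad_nonneg y.2
  have hv2 : ∀ i, |v.2 i| ≤ 1 := fun i => (abs_coord_le_norm _ i).trans ((norm_snd_le v).trans hv)
  have kc : ∀ i, |fderiv ℝ (pd Ψ i) y v| ≤ c := fun i =>
    (j.abs_fderiv_pd_le i v).trans (mul_le_of_le_one_right hc hv)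
  have kd : |fderiv ℝ Ψ y v| ≤ b := (j.d1 v).trans (mul_le_of_le_one_right hb hv)
  have hor : ∀ i j', i ≠ 2 → |y.2 i * fderiv ℝ (pd Ψ j') y v + pd Ψ j' y * v.2 i|
      ≤ rad y.2 * c + b := fun i j' hi => by
    have hy : |y.2 i| ≤ rad y.2 := by
      fin_cases i
      · exact h0
      · exact h1
      · exact absurd rfl hi
    refine (abs_add_le _ _).trans (add_le_add (abs_mul_le_mul hy (kc j')) ?_)
    simpa using abs_mul_le_mul (j.abs_pd_le j') (hv2 i)
  have hrc : 0 ≤ rad y.2 * c := by positivity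
  rw [fderiv_liftField_apply j.smooth]
  by_cases hi : i = 2
  · subst hi
    rw [fderiv_liftComp_vertical j.smooth]
    have a0 := hor 0 0 (by decide)
    have a1 := hor 1 1 (by decide)
    rw [abs_le] at *
    constructor <;> linarith
  · rw [fderiv_liftComp_horizontal j.smooth v hi]
    have a0 := hor i 2 hi
    rw [abs_le] at *
    constructor <;> linarith

lemma pd_eq_zero_of_eventually_const {Ψ : ℝ × E3 → ℝ} {y : ℝ × E3} {r : ℝ}
    (h : ∀ᶠ z in 𝓝 y, Ψ z = r) (j : Fin 3) : pd Ψ j y = 0 := by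
  have : Ψ =ᶠ[𝓝 y] fun _ => r := h
  rw [pd, this.fderiv_eq]
  simp

lemma liftField_eq_of_eventually_const {Ψ : ℝ × E3 → ℝ} {y : ℝ × E3} {r : ℝ}
    (h : ∀ᶠ z in 𝓝 y, Ψ z = r) : liftField Ψ y = r • e3 := by
  ext i
  rw [liftField_apply]
  fin_cases i <;>
  simp [liftComp, pd_eq_zero_of_eventually_const h, h.self_of_nhds, e3, stdVec]

/-! ### Geometry of the body and the container -/

lemma rad_sub_smul_e3 (x : E3) (h : ℝ) : rad (x - h • e3) = rad x := by
  simp [rad, e3, stdVec]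

lemma sub_smul_e3_apply_two (x : E3) (h : ℝ) : (x - h • e3) 2 = x 2 - h := by
  simp [e3, stdVec]

lemma rad_le_norm (x : E3) : rad x ≤ ‖x‖ := by
  rw [rad, EuclideanSpace.norm_eq, Fin.sum_univ_three]
  refine Real.sqrt_le_sqrt ?_
  simp only [Real.norm_eq_abs, sq_abs]
  nlinarith [sq_nonneg (x 2)]

lemma rad_triangle (x y : E3) : rad x ≤ rad y + ‖x - y‖ := by
  have h1 := rad_sq x
  have h2 := rad_sq y
  have h3 := rad_sq (x - y)
  have n1 := rad_nonneg x
  have n2 := rad_nonneg y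
  have n3 := rad_nonneg (x - y)
  have h4 := rad_le_norm (x - y)
  simp only [PiLp.sub_apply] at h3
  have cs : x 0 * y 0 + x 1 * y 1 ≤ rad x * rad y := by
    refine le_of_abs_le (abs_le_of_sq_le_sq ?_ (by positivity))
    rw [mul_pow, h1, h2]
    nlinarith [sq_nonneg (x 0 * y 1 - x 1 * y 0)]
  have : rad x - rad y ≤ rad (x - y) := by
    refine le_of_abs_le (abs_le_of_sq_le_sq ?_ n3)
    nlinarith
  linarith

lemma norm_le_rad_add (x : E3) : ‖x‖ ≤ rad x + |x 2| := by
  rw [EuclideanSpace.norm_eq, Fin.sum_univ_three]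
  refine Real.sqrt_le_iff.2 ⟨by have := rad_nonneg x; positivity, ?_⟩
  have h1 := rad_sq x
  simp only [Real.norm_eq_abs, sq_abs]
  nlinarith [mul_nonneg (rad_nonneg x) (abs_nonneg (x 2)), sq_abs (x 2)]

/-- Rotations about the vertical axis are transitive on circles. -/
lemma exists_rotated {z z' : E3} (hr : rad z = rad z') (h2 : z 2 = z' 2) (y : E3) :
    ∃ y' : E3, rad y' = rad y ∧ y' 2 = y 2 ∧ dist y' z' = dist y z := by
  have e1 := rad_sq z
  have e2 := rad_sq z'
  rcases (rad_nonneg z).eq_or_lt with h0 | h0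
  · refine ⟨y, rfl, rfl, ?_⟩
    have a0 : z 0 = 0 := by nlinarith [sq_nonneg (z 0), sq_nonneg (z 1)]
    have a1 : z 1 = 0 := by nlinarith [sq_nonneg (z 0), sq_nonneg (z 1)]
    have b0 : z' 0 = 0 := by nlinarith [sq_nonneg (z' 0), sq_nonneg (z' 1)]
    have b1 : z' 1 = 0 := by nlinarith [sq_nonneg (z' 0), sq_nonneg (z' 1)]
    have : z = z' := by
      ext i
      fin_cases i
      · exact a0.trans b0.symm
      · exact a1.trans b1.symm
      · exact h2
    rw [this]
  · set r := rad z with hrz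
    have hr0 : r ^ 2 ≠ 0 := by positivity
    obtain ⟨c, hc⟩ : ∃ c, c = (z 0 * z' 0 + z 1 * z' 1) / r ^ 2 := ⟨_, rfl⟩
    obtain ⟨s, hs⟩ : ∃ s, s = (z 0 * z' 1 - z 1 * z' 0) / r ^ 2 := ⟨_, rfl⟩
    rw [eq_div_iff hr0] at hc hs
    rw [← hr] at e2
    have hcs : c ^ 2 + s ^ 2 = 1 := by
      have : (c ^ 2 + s ^ 2) * (r ^ 2) ^ 2 = 1 * (r ^ 2) ^ 2 := by
        calc (c ^ 2 + s ^ 2) * (r ^ 2) ^ 2 = (c * r ^ 2) ^ 2 + (s * r ^ 2) ^ 2 := by ring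
          _ = (z 0 ^ 2 + z 1 ^ 2) * (z' 0 ^ 2 + z' 1 ^ 2) := by rw [hc, hs]; ring
          _ = 1 * (r ^ 2) ^ 2 := by rw [← e1, ← e2]; ring
      exact mul_right_cancel₀ (pow_ne_zero 2 hr0) this
    have k0 : c * z 0 - s * z 1 = z' 0 := by
      apply mul_right_cancel₀ hr0
      calc (c * z 0 - s * z 1) * r ^ 2 = (c * r ^ 2) * z 0 - (s * r ^ 2) * z 1 := by ring
        _ = z' 0 * (z 0 ^ 2 + z 1 ^ 2) := by rw [hc, hs]; ring
        _ = z' 0 * r ^ 2 := by rw [← e1]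
    have k1 : s * z 0 + c * z 1 = z' 1 := by
      apply mul_right_cancel₀ hr0
      calc (s * z 0 + c * z 1) * r ^ 2 = (s * r ^ 2) * z 0 + (c * r ^ 2) * z 1 := by ring
        _ = z' 1 * (z 0 ^ 2 + z 1 ^ 2) := by rw [hc, hs]; ring
        _ = z' 1 * r ^ 2 := by rw [← e1]
    refine ⟨!₂[c * y 0 - s * y 1, s * y 0 + c * y 1, y 2], ?_, by simp, ?_⟩
    · unfold rad
      congr 1
      simp only [Fin.isValue, Matrix.cons_val_zero, Matrix.cons_val_one]
      linear_combination (y 0 ^ 2 + y 1 ^ 2) * hcs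
    · rw [EuclideanSpace.dist_eq, EuclideanSpace.dist_eq]
      congr 1
      simp only [Fin.sum_univ_three, Real.dist_eq, sq_abs]
      simp only [Fin.isValue, Matrix.cons_val_zero, Matrix.cons_val_one,
        Matrix.cons_val]
      rw [← k0, ← k1, ← h2]
      linear_combination ((y 0 - z 0) ^ 2 + (y 1 - z 1) ^ 2) * hcs

lemma exists_frontier_mem_segment {D : Set E3} {x y : E3} (hx : x ∈ D) (hy : y ∉ D) :
    ∃ z ∈ segment ℝ x y, z ∈ frontier D := by
  by_contra! hcon
  have hcov : ∀ z ∈ segment ℝ x y, z ∈ interior D ∨ z ∈ (closure D)ᶜ := fun z hz => by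
    by_cases h : z ∈ closure D
    · exact Or.inl (by_contra fun hi => hcon z hz ⟨h, hi⟩)
    · exact Or.inr h
  obtain ⟨z, -, hz1, hz2⟩ := (convex_segment (𝕜 := ℝ) x y).isPreconnected (interior D)
    (closure D)ᶜ isOpen_interior isClosed_closure.isOpen_compl hcov
    ⟨x, left_mem_segment ℝ x y, (hcov x (left_mem_segment ℝ x y)).resolve_right
      fun h => h (subset_closure hx)⟩
    ⟨y, right_mem_segment ℝ x y, (hcov y (right_mem_segment ℝ x y)).resolve_left
      fun h => hy (interior_subset h)⟩
  exact hz2 (subset_closure (interior_subset hz1))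

lemma dist_le_of_mem_segment {x y z : E3} (h : z ∈ segment ℝ x y) :
    dist x z ≤ dist x y ∧ dist y z ≤ dist x y := by
  obtain ⟨a, b, ha, hb, hab, rfl⟩ := h
  have e1 : x - (a • x + b • y) = b • (x - y) := by
    have : a = 1 - b := by linarith
    subst this; module
  have e2 : y - (a • x + b • y) = (-a) • (x - y) := by
    have : b = 1 - a := by linarith
    subst this; module
  rw [dist_eq_norm, dist_eq_norm, dist_eq_norm, e1, e2, norm_smul, norm_smul, Real.norm_eq_abs,
    Real.norm_eq_abs, abs_neg, abs_of_nonneg ha, abs_of_nonneg hb]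
  constructor <;> nlinarith [norm_nonneg (x - y)]

section Geometry

variable {Ω B : Set E3} {α r₀ : ℝ}

/-- Beyond an edge of the flat square there are boundary points of the container outside the square,
because the boundary separates the points above the edge from those below it. -/
lemma CollisionGeometry.exists_frontier_near_edge (hg : CollisionGeometry Ω B α r₀) {b : ℝ}
    (hb : |b| ≤ 2 * r₀) {ε : ℝ} (hε : 0 < ε) :
    ∃ z ∈ frontier Ω \ floorSquare r₀, dist z !₂[2 * r₀, b, 0] < ε := by
  obtain ⟨l, hl, hfl⟩ := hg.flat_floor
  have hr := hg.r₀_pos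
  obtain ⟨s, hs0, hsl, hsε⟩ : ∃ s, 0 < s ∧ s < l ∧ 2 * s < ε :=
    ⟨min (l / 2) (ε / 4), by positivity, (min_le_left _ _).trans_lt (by linarith), by
      linarith [min_le_right (l / 2) (ε / 4)]⟩
  set pt : ℝ → ℝ → E3 := fun u w => !₂[2 * r₀ + u, b, w] with hpt
  have p0 : ∀ u w, (pt u w) 0 = 2 * r₀ + u := fun u w => by simp [hpt]
  have p1 : ∀ u w, (pt u w) 1 = b := fun u w => by simp [hpt]
  have p2 : ∀ u w, (pt u w) 2 = w := fun u w => by simp [hpt]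
  have up : pt 0 s ∈ Ω := by
    refine (hfl _ ?_ ?_ ?_).2 ?_
    · rw [p0, add_zero, abs_of_pos (by linarith)]
    · rw [p1]; exact hb
    · rw [p2, abs_of_pos hs0]; exact hsl
    · rw [p2]; exact hs0
  have down : pt 0 (-s) ∉ Ω := fun h => by
    have := (hfl _ ?_ ?_ ?_).1 h
    · rw [p2] at this; linarith
    · rw [p0, add_zero, abs_of_pos (by linarith)]
    · rw [p1]; exact hb
    · rw [p2, abs_neg, abs_of_pos hs0]; exact hsl
  have near : ∀ z : E3, z 0 - 2 * r₀ ∈ Icc 0 s → z 1 = b → |z 2| ≤ s →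
      dist z !₂[2 * r₀, b, 0] < ε := fun z h0 h1 h2 => by
    rw [dist_eq_norm]
    refine (norm_le_rad_add _).trans_lt ?_
    have e0 : (z - !₂[2 * r₀, b, 0]) 0 = z 0 - 2 * r₀ := by simp
    have e1 : (z - !₂[2 * r₀, b, 0]) 1 = 0 := by simp [h1]
    have e2 : (z - !₂[2 * r₀, b, 0]) 2 = z 2 := by simp
    rw [rad, e0, e1, e2, zero_pow two_ne_zero, add_zero, Real.sqrt_sq h0.1]
    linarith [h0.2]
  have main : ∀ σ : ℝ, |σ| = s → ∀ z ∈ frontier Ω, z ∈ segment ℝ (pt s 0) (pt 0 σ) →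
      ∃ z ∈ frontier Ω \ floorSquare r₀, dist z !₂[2 * r₀, b, 0] < ε := by
    rintro σ hσ z hz ⟨a, a', ha, ha', haa, rfl⟩
    have c0 : (a • pt s 0 + a' • pt 0 σ) 0 = 2 * r₀ + a * s := by
      simp only [PiLp.add_apply, PiLp.smul_apply, p0, smul_eq_mul]
      linear_combination 2 * r₀ * haa
    have c1 : (a • pt s 0 + a' • pt 0 σ) 1 = b := by
      simp only [PiLp.add_apply, PiLp.smul_apply, p1, smul_eq_mul]
      linear_combination b * haa
    have c2 : (a • pt s 0 + a' • pt 0 σ) 2 = a' * σ := by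
      simp only [PiLp.add_apply, PiLp.smul_apply, p2, smul_eq_mul]
      ring
    refine ⟨_, ⟨hz, fun hf => ?_⟩, near _ ?_ c1 ?_⟩
    · have h2 := hf.2.2
      rw [c2, mul_eq_zero, ← abs_eq_zero (a := σ), hσ] at h2
      have h0 := hf.1
      have ha1 : a = 1 := by linarith [h2.resolve_right hs0.ne']
      rw [c0, ha1, abs_of_pos (by linarith)] at h0
      linarith
    · rw [c0]; constructor <;> nlinarith
    · rw [c2, abs_mul, hσ, abs_of_nonneg ha']; nlinarith
  -- the path from above the edge to below it that passes beyond the edge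
  by_cases hmid : pt s 0 ∈ Ω
  · obtain ⟨z, hz, hzf⟩ := exists_frontier_mem_segment hmid down
    exact main (-s) (by rw [abs_neg, abs_of_pos hs0]) z hzf hz
  · obtain ⟨z, hz, hzf⟩ := exists_frontier_mem_segment up hmid
    rw [segment_symm] at hz
    exact main s (abs_of_pos hs0) z hzf hz

/-- Boundary points close to the body lie in the flat square, at a distance from its edge: otherwise
the rotational symmetry would bring the body close to the boundary beyond an edge. -/
lemma CollisionGeometry.near_frontier (hg : CollisionGeometry Ω B α r₀) {d₀ h : ℝ}
    (hd : ∀ x ∈ solidAt B h, ∀ y ∈ frontier Ω \ floorSquare r₀, d₀ ≤ dist x y) {y z : E3}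
    (hy : y ∈ solidAt B h) (hz : z ∈ frontier Ω) (hyz : dist y z < d₀) :
    z 2 = 0 ∧ rad z + d₀ ≤ 2 * r₀ + dist y z := by
  have hr := hg.r₀_pos
  have hzf : z ∈ floorSquare r₀ := by
    by_contra hcon
    exact absurd (hd y hy z ⟨hz, hcon⟩) (not_le.2 hyz)
  obtain ⟨z0, z1, z2⟩ := hzf
  refine ⟨z2, ?_⟩
  have key : ∀ (z' : E3) (b : ℝ), |b| ≤ 2 * r₀ → rad z = rad z' → z' 2 = 0 →
      d₀ ≤ dist y z + dist z' !₂[2 * r₀, b, 0] := by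
    intro z' b hb hrz hz'
    obtain ⟨y', hy1, hy2, hy3⟩ := exists_rotated hrz (z2.trans hz'.symm) y
    have hy' : y' ∈ solidAt B h := by
      refine (hg.symmetric (y' - h • e3) (y - h • e3) ?_ ?_).2 hy
      · rw [rad_sub_smul_e3, rad_sub_smul_e3, hy1]
      · rw [sub_smul_e3_apply_two, sub_smul_e3_apply_two, hy2]
    refine le_of_forall_pos_le_add fun ε hε => ?_
    obtain ⟨w, hw, hwd⟩ := hg.exists_frontier_near_edge hb hε
    have h1 := hd y' hy' w hw
    have h2 := dist_triangle4 y' z' !₂[2 * r₀, b, 0] w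
    rw [dist_comm !₂[2 * r₀, b, 0] w] at h2
    linarith
  rcases le_or_gt (rad z) (2 * r₀) with hle | hgt
  · have e : rad z = rad (!₂[rad z, 0, 0] : E3) := by
      conv_rhs => rw [rad]
      simp [Real.sqrt_sq (rad_nonneg z)]
    have k := key !₂[rad z, 0, 0] 0 (by rw [abs_zero]; linarith) e (by simp)
    have e2 : dist (!₂[rad z, 0, 0] : E3) !₂[2 * r₀, 0, 0] = 2 * r₀ - rad z := by
      rw [EuclideanSpace.dist_eq, Fin.sum_univ_three]
      simp only [Real.dist_eq, sq_abs, Fin.isValue, Matrix.cons_val_zero, Matrix.cons_val_one,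
        Matrix.cons_val, sub_self, zero_pow two_ne_zero, add_zero]
      rw [Real.sqrt_sq_eq_abs, abs_of_nonpos (by linarith)]
      ring
    rw [e2] at k
    linarith
  · have hz2 := rad_sq z
    have q0 := abs_le.1 z0
    have q1 := abs_le.1 z1
    have hnn : 0 ≤ rad z ^ 2 - (2 * r₀) ^ 2 := by nlinarith
    have k := key !₂[2 * r₀, Real.sqrt (rad z ^ 2 - (2 * r₀) ^ 2), 0]
      (Real.sqrt (rad z ^ 2 - (2 * r₀) ^ 2)) ?_ ?_ (by simp)
    · rw [dist_self] at k
      linarith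
    · rw [abs_of_nonneg (Real.sqrt_nonneg _)]
      refine Real.sqrt_le_iff.2 ⟨by linarith, ?_⟩
      nlinarith
    · conv_rhs => rw [rad]
      simp only [Fin.isValue, Matrix.cons_val_zero, Matrix.cons_val_one]
      rw [Real.sq_sqrt hnn, add_sub_cancel, Real.sqrt_sq (rad_nonneg z)]

/-- Near the axis the body lies above its lower profile. -/
lemma CollisionGeometry.profile_le (hg : CollisionGeometry Ω B α r₀) {h : ℝ} {y : E3}
    (hy : y ∈ solidAt B h) (hr : rad y ≤ 2 * r₀) : h + rad y ^ (1 + α) ≤ y 2 := by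
  obtain ⟨l, hl, hp⟩ := hg.profile
  by_contra hcon
  have := (hp (y - h • e3) (by rwa [rad_sub_smul_e3]) (by
    rw [rad_sub_smul_e3, sub_smul_e3_apply_two]; linarith)).1 hy
  rw [rad_sub_smul_e3, sub_smul_e3_apply_two] at this
  linarith

lemma CollisionGeometry.zero_mem_solid (hg : CollisionGeometry Ω B α r₀) (hα : 0 < α) :
    (0 : E3) ∈ solidAt B 0 := by
  obtain ⟨l, hl, hp⟩ := hg.profile
  have h0 : rad (0 : E3) = 0 := by simp [rad]
  have hr := hg.r₀_pos
  have : (0 : E3) - (0 : ℝ) • e3 = 0 := by simp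
  rw [solidAt, mem_ofPred_eq, this, hp 0 (by rw [h0]; linarith)] <;>
  rw [h0, Real.zero_rpow (by linarith)]
  · simp
  · simpa using hl

lemma CollisionGeometry.zero_mem_frontier (hg : CollisionGeometry Ω B α r₀) :
    (0 : E3) ∈ frontier Ω := by
  obtain ⟨l, hl, hfl⟩ := hg.flat_floor
  have hr := hg.r₀_pos
  rw [hg.container.isOpen.frontier_eq]
  refine ⟨?_, fun h => ?_⟩
  · rw [Metric.mem_closure_iff]
    intro ε hε
    have hs : 0 < min (l / 2) (ε / 2) := by positivity
    refine ⟨min (l / 2) (ε / 2) • e3, (hfl _ ?_ ?_ ?_).2 ?_, ?_⟩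
    · simp [e3, stdVec]; exact hr.le
    · simp [e3, stdVec]; exact hr.le
    · simp only [e3, stdVec, PiLp.smul_apply, PiLp.single_apply, if_true, smul_eq_mul,
        mul_one]
      rw [abs_of_pos hs]
      linarith [min_le_left (l / 2) (ε / 2)]
    · simpa [e3, stdVec] using ⟨hl, hε⟩
    · rw [dist_zero_left, norm_smul, norm_e3, mul_one, Real.norm_eq_abs, abs_of_pos hs]
      linarith [min_le_right (l / 2) (ε / 2)]
  · have := (hfl 0 (by simp [hr.le]) (by simp [hr.le]) (by simpa using hl)).1 h
    simp at this

/-- As long as its height is positive, the body does not touch the boundary. -/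
lemma CollisionGeometry.solid_subset (hg : CollisionGeometry Ω B α r₀) {d₀ h : ℝ} (hd₀ : 0 < d₀)
    (hh : 0 < h) (hd : ∀ x ∈ solidAt B h, ∀ y ∈ frontier Ω \ floorSquare r₀, d₀ ≤ dist x y)
    (hs : solidAt B h ⊆ closure Ω) : solidAt B h ⊆ Ω := by
  intro y hy
  by_contra hcon
  have hf : y ∈ frontier Ω := by
    rw [hg.container.isOpen.frontier_eq]
    exact ⟨hs hy, hcon⟩
  obtain ⟨h2, h3⟩ := hg.near_frontier hd hy hf (by rwa [dist_self])
  rw [dist_self] at h3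
  have := hg.profile_le hy (by linarith)
  linarith [Real.rpow_nonneg (rad_nonneg y) (1 + α)]

/-- Points close to the body but outside the container are close to the origin. -/
lemma CollisionGeometry.exists_near_origin (hg : CollisionGeometry Ω B α r₀) {d₀ a : ℝ}
    (hd₀ : 0 < d₀) (hα : 0 < α) (ha : 0 < a) : ∃ ε > 0, ∀ h, 0 < h →
      (∀ x ∈ solidAt B h, ∀ y ∈ frontier Ω \ floorSquare r₀, d₀ ≤ dist x y) →
      solidAt B h ⊆ closure Ω → ∀ x, ∀ y ∈ solidAt B h, dist y x < ε → x ∉ Ω → ‖x‖ < a := by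
  refine ⟨min (min (d₀ / 2) (a / 4)) ((a / 4) ^ (1 + α)), by positivity, ?_⟩
  set ε := min (min (d₀ / 2) (a / 4)) ((a / 4) ^ (1 + α)) with hε
  intro h hh hd hs x y hy hyx hx
  have e1 : ε ≤ d₀ / 2 := (min_le_left _ _).trans (min_le_left _ _)
  have e2 : ε ≤ a / 4 := (min_le_left _ _).trans (min_le_right _ _)
  have e3' : ε ≤ (a / 4) ^ (1 + α) := min_le_right _ _
  obtain ⟨z, hz, hzf⟩ := exists_frontier_mem_segment (hg.solid_subset hd₀ hh hd hs hy) hx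
  obtain ⟨d1, d2⟩ := dist_le_of_mem_segment hz
  obtain ⟨z2, hz3⟩ := hg.near_frontier hd hy hzf (by linarith)
  have hyr := rad_triangle y z
  rw [← dist_eq_norm] at hyr
  have hp := hg.profile_le hy (by linarith)
  have hy2 : y 2 ≤ dist y z := by
    have := (le_abs_self _).trans (abs_coord_le_norm (y - z) 2)
    rwa [PiLp.sub_apply, z2, sub_zero, ← dist_eq_norm] at this
  have hx2 : |x 2| ≤ dist x z := by
    have := abs_coord_le_norm (x - z) 2
    rwa [PiLp.sub_apply, z2, sub_zero, ← dist_eq_norm] at this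
  have hry : rad y < a / 4 := by
    by_contra hcon
    have : (a / 4) ^ (1 + α) ≤ rad y ^ (1 + α) :=
      Real.rpow_le_rpow (by positivity) (not_lt.1 hcon) (by linarith)
    linarith
  have hxr := rad_triangle x y
  rw [← dist_eq_norm, dist_comm] at hxr
  linarith [norm_le_rad_add x]

lemma CollisionGeometry.isCompact_body (hg : CollisionGeometry Ω B α r₀) : IsCompact B := by
  rw [← hg.body_regular]
  exact hg.body.isBounded.isCompact_closure

lemma CollisionGeometry.interior_body_nonempty (hg : CollisionGeometry Ω B α r₀) :
    (interior B).Nonempty := hg.body.isConnected.nonempty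

end Geometry

/-! ### Sobolev inequalities -/

open scoped NNReal ENNReal in
/-- The Gagliardo–Nirenberg–Sobolev inequality `‖u‖₆ ≤ C ‖∇u‖₂` in space dimension three. -/
lemma exists_sobolev_const (F : Type*) [NormedAddCommGroup F] [InnerProductSpace ℝ F] :
    ∃ C : ℝ≥0, ∀ u : E3 → F, ContDiff ℝ 1 u → HasCompactSupport u →
      eLpNorm u 6 volume ≤ C * eLpNorm (fderiv ℝ u) 2 volume := by
  refine ⟨eLpNormLESNormFDerivOfEqInnerConst (volume : Measure E3) 2, fun u hu hc => ?_⟩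
  have := eLpNorm_le_eLpNorm_fderiv_of_eq_inner (μ := (volume : Measure E3)) (F' := F) hu hc
    (p := 2) (p' := 6) (by norm_num) (by simp) (by simp; norm_num)
  simpa using this

lemma eLpNorm_le_of_tendsto_of_le {X F : Type*} [MeasurableSpace X] {ν : Measure X}
    [NormedAddCommGroup F] {p : ENNReal} {f : ℕ → X → F} {g : X → F} {b : ℕ → ENNReal}
    {b' : ENNReal} (hf : ∀ n, AEStronglyMeasurable (f n) ν)
    (hlim : ∀ᵐ x ∂ν, Tendsto (fun n => f n x) atTop (𝓝 (g x)))
    (hb : ∀ n, eLpNorm (f n) p ν ≤ b n) (hb' : Tendsto b atTop (𝓝 b')) : eLpNorm g p ν ≤ b' := by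
  refine (Lp.eLpNorm_lim_le_liminf_eLpNorm hf g hlim).trans ?_
  rw [← hb'.liminf_eq]
  exact liminf_le_liminf (Eventually.of_forall hb)

lemma sum_smul_stdVec (v : E3) : ∑ j, v j • stdVec j = v := by
  ext i
  rw [Fin.sum_univ_three]
  fin_cases i <;> simp [stdVec]

lemma eLpNorm_fderiv_le_sum {u : E3 → E3} {ν : Measure E3} (hu : ContDiff ℝ 1 u) :
    eLpNorm (fderiv ℝ u) 2 ν ≤
      ∑ i, ∑ j, eLpNorm (fun x => (fderiv ℝ u x (stdVec j)) i) 2 ν := by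
  have hm : ∀ i j, AEStronglyMeasurable (fun x => (fderiv ℝ u x (stdVec j)) i) ν := fun i j =>
    ((EuclideanSpace.proj (𝕜 := ℝ) i : E3 →L[ℝ] ℝ).continuous.comp
      ((hu.continuous_fderiv one_ne_zero).clm_apply continuous_const)).aestronglyMeasurable
  calc eLpNorm (fderiv ℝ u) 2 ν
      ≤ eLpNorm (fun x => ∑ i, ∑ j, ‖(fderiv ℝ u x (stdVec j)) i‖) 2 ν := by
        refine eLpNorm_mono_real fun x => ?_
        refine ContinuousLinearMap.opNorm_le_bound _
          (Finset.sum_nonneg fun i _ => Finset.sum_nonneg fun j _ => norm_nonneg _) fun v => ?_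
        have h1 : ∀ w : E3, ‖w‖ ≤ ∑ i, ‖w i‖ := fun w => by
          conv_lhs => rw [← sum_smul_stdVec w]
          refine (norm_sum_le _ _).trans (le_of_eq ?_)
          simp [norm_smul, norm_stdVec]
        have h2 : fderiv ℝ u x v = ∑ j, v j • fderiv ℝ u x (stdVec j) := by
          conv_lhs => rw [← sum_smul_stdVec v]
          simp
        rw [h2, Finset.sum_comm, Finset.sum_mul]
        refine (norm_sum_le _ _).trans (Finset.sum_le_sum fun j _ => ?_)
        rw [norm_smul, mul_comm]
        exact mul_le_mul (h1 _) (abs_coord_le_norm v j) (norm_nonneg _)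
          (Finset.sum_nonneg fun i _ => norm_nonneg _)
    _ ≤ ∑ i, ∑ j, eLpNorm (fun x => (fderiv ℝ u x (stdVec j)) i) 2 ν := by
        have h3 : (fun x => ∑ i, ∑ j, ‖(fderiv ℝ u x (stdVec j)) i‖)
            = ∑ i, fun x => ∑ j, ‖(fderiv ℝ u x (stdVec j)) i‖ := by
          ext x; simp
        have h4 : ∀ i, (fun x => ∑ j, ‖(fderiv ℝ u x (stdVec j)) i‖)
            = ∑ j, fun x => ‖(fderiv ℝ u x (stdVec j)) i‖ := fun i => by
          ext x; simp
        rw [h3]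
        refine (eLpNorm_sum_le (fun i _ => ?_) (by norm_num)).trans (Finset.sum_le_sum fun i _ => ?_)
        · rw [h4]
          exact Finset.aestronglyMeasurable_sum _ fun j _ => (hm i j).norm
        · rw [h4]
          refine (eLpNorm_sum_le (fun j _ => (hm i j).norm) (by norm_num)).trans
            (Finset.sum_le_sum fun j _ => ?_)
          exact le_of_eq (eLpNorm_norm _)

open scoped NNReal ENNReal in
/-- The Sobolev inequality in `W₀^{1,2}(D)`. -/
lemma exists_sobolev_W0 : ∃ C : ℝ≥0, ∀ (D : Set E3) (u : E3 → E3)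
    (Du : E3 → Matrix (Fin 3) (Fin 3) ℝ), IsOpen D → IsW0Grad D u Du →
      eLpNorm u 6 (volume.restrict D) ≤
        C * ∑ i, ∑ j, eLpNorm (fun x => Du x i j) 2 (volume.restrict D) := by
  obtain ⟨C, hC⟩ := exists_sobolev_const E3
  refine ⟨C, fun D u Du hD hu => ?_⟩
  obtain ⟨hu2, hDu, φ, hφ, hlim, hlimD⟩ := hu
  have hφm : ∀ n, AEStronglyMeasurable (φ n) (volume.restrict D) := fun n =>
    (hφ n).1.continuous.aestronglyMeasurable
  obtain ⟨ns, hns, hae⟩ := (tendstoInMeasure_of_tendsto_eLpNorm two_ne_zero hφm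
    hu2.aestronglyMeasurable hlim).exists_seq_tendsto_ae
  have hφ1 : ∀ n, ContDiff ℝ 1 (φ n) := fun n => (hφ n).1.of_le (by exact_mod_cast le_top)
  have hb : ∀ n, eLpNorm (φ n) 6 (volume.restrict D) ≤ C * ∑ i, ∑ j,
      (eLpNorm (fun x => (fderiv ℝ (φ n) x (stdVec j)) i - Du x i j) 2 (volume.restrict D)
        + eLpNorm (fun x => Du x i j) 2 (volume.restrict D)) := fun n => by
    have hcomp : ∀ i j, eLpNorm (fun x => (fderiv ℝ (φ n) x (stdVec j)) i) 2 volume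
        = eLpNorm (fun x => (fderiv ℝ (φ n) x (stdVec j)) i) 2 (volume.restrict D) := fun i j => by
      refine (eLpNorm_restrict_eq_of_support_subset fun x hx => ?_).symm
      refine (hφ n).2.2 (support_fderiv_subset ℝ fun h0 => hx ?_)
      simp only [h0, zero_apply, PiLp.zero_apply]
    calc eLpNorm (φ n) 6 (volume.restrict D) ≤ eLpNorm (φ n) 6 volume := eLpNorm_restrict_le _ _ _ _
      _ ≤ C * eLpNorm (fderiv ℝ (φ n)) 2 volume := hC _ (hφ1 n) (hφ n).2.1
      _ ≤ _ := by
          gcongr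
          refine (eLpNorm_fderiv_le_sum (hφ1 n)).trans (Finset.sum_le_sum fun i _ =>
            Finset.sum_le_sum fun j _ => ?_)
          have hm : AEStronglyMeasurable (fun x => (fderiv ℝ (φ n) x (stdVec j)) i)
              (volume.restrict D) :=
            ((EuclideanSpace.proj (𝕜 := ℝ) i : E3 →L[ℝ] ℝ).continuous.comp
              (((hφ1 n).continuous_fderiv one_ne_zero).clm_apply
                continuous_const)).aestronglyMeasurable
          rw [hcomp]
          refine le_trans (le_of_eq ?_) (eLpNorm_add_le (hm.sub (hDu i j).aestronglyMeasurable)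
            (hDu i j).aestronglyMeasurable (by norm_num))
          congr 1
          ext x
          simp
  refine eLpNorm_le_of_tendsto_of_le (fun n => hφm (ns n)) hae (fun n => hb (ns n)) ?_
  refine ENNReal.Tendsto.const_mul ?_ (Or.inr ENNReal.coe_ne_top)
  refine tendsto_finsetSum _ fun i _ => tendsto_finsetSum _ fun j _ => ?_
  have := ((hlimD i j).comp hns.tendsto_atTop).add_const
    (eLpNorm (fun x => Du x i j) 2 (volume.restrict D))
  simpa using this

/-! ### Mollification of weakly differentiable functions -/

open scoped ENNReal in
/-- Averaging with a probability density does not increase the `L²` norm. -/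
lemma eLpNorm_average_le {k : E3 → ℝ} (hk : Continuous k) (hk1 : ∫⁻ x, ‖k x‖ₑ = 1) {f : E3 → ℝ}
    (hf : AEStronglyMeasurable f volume) :
    eLpNorm (fun x => ∫ t, f t * k (x - t)) 2 volume ≤ eLpNorm f 2 volume := by
  have hkm : Measurable fun x => ‖k x‖ₑ := hk.measurable.enorm
  have hkx : ∀ x : E3, Measurable fun t => ‖k (x - t)‖ₑ := fun x =>
    hkm.comp (measurable_const.sub measurable_id)
  have hfm : AEMeasurable (fun t => ‖f t‖ₑ) volume := hf.enorm
  have hk1x : ∀ x : E3, ∫⁻ t, ‖k (x - t)‖ₑ = 1 := fun x => by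
    rw [← hk1]; exact lintegral_sub_left_eq_self (fun t => ‖k t‖ₑ) x
  have hk1t : ∀ t : E3, ∫⁻ x, ‖k (x - t)‖ₑ = 1 := fun t => by
    rw [← hk1]; exact lintegral_sub_right_eq_self (fun t => ‖k t‖ₑ) t
  have hpt : ∀ x, ‖∫ t, f t * k (x - t)‖ₑ ^ (2 : ℝ) ≤ ∫⁻ t, ‖f t‖ₑ ^ (2 : ℝ) * ‖k (x - t)‖ₑ := by
    intro x
    have h1 : ‖∫ t, f t * k (x - t)‖ₑ ≤
        ∫⁻ t, (‖f t‖ₑ * ‖k (x - t)‖ₑ ^ (1 / 2 : ℝ)) * ‖k (x - t)‖ₑ ^ (1 / 2 : ℝ) := by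
      refine (enorm_integral_le_lintegral_enorm _).trans (le_of_eq (lintegral_congr fun t => ?_))
      rw [enorm_mul, mul_assoc, ← ENNReal.rpow_add_of_nonneg _ _ (by norm_num) (by norm_num)]
      norm_num
    have h2 := ENNReal.lintegral_mul_le_Lp_mul_Lq volume Real.HolderConjugate.two_two
      (hfm.mul ((hkx x).aemeasurable.pow_const (1 / 2 : ℝ))) ((hkx x).aemeasurable.pow_const (1 / 2 : ℝ))
    have h3 : ∫⁻ t, (‖k (x - t)‖ₑ ^ (1 / 2 : ℝ)) ^ (2 : ℝ) = 1 := by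
      rw [← hk1x x]
      refine lintegral_congr fun t => ?_
      rw [← ENNReal.rpow_mul]; norm_num
    have h4 : ∫⁻ t, (‖f t‖ₑ * ‖k (x - t)‖ₑ ^ (1 / 2 : ℝ)) ^ (2 : ℝ)
        = ∫⁻ t, ‖f t‖ₑ ^ (2 : ℝ) * ‖k (x - t)‖ₑ := by
      refine lintegral_congr fun t => ?_
      rw [ENNReal.mul_rpow_of_nonneg _ _ (by norm_num), ← ENNReal.rpow_mul _ (1 / 2 : ℝ)]
      norm_num
    simp only [Pi.mul_apply] at h2
    rw [h3, h4, ENNReal.one_rpow, mul_one] at h2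
    calc ‖∫ t, f t * k (x - t)‖ₑ ^ (2 : ℝ)
        ≤ ((∫⁻ t, ‖f t‖ₑ ^ (2 : ℝ) * ‖k (x - t)‖ₑ) ^ (1 / 2 : ℝ)) ^ (2 : ℝ) :=
          ENNReal.rpow_le_rpow (h1.trans h2) (by norm_num)
      _ = _ := by rw [← ENNReal.rpow_mul]; norm_num
  rw [eLpNorm_eq_lintegral_rpow_enorm_toReal two_ne_zero ENNReal.ofNat_ne_top,
    eLpNorm_eq_lintegral_rpow_enorm_toReal two_ne_zero ENNReal.ofNat_ne_top]
  refine ENNReal.rpow_le_rpow ?_ (by positivity)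
  simp only [ENNReal.toReal_ofNat]
  calc ∫⁻ x, ‖∫ t, f t * k (x - t)‖ₑ ^ (2 : ℝ)
      ≤ ∫⁻ x, ∫⁻ t, ‖f t‖ₑ ^ (2 : ℝ) * ‖k (x - t)‖ₑ := lintegral_mono hpt
    _ = ∫⁻ t, ∫⁻ x, ‖f t‖ₑ ^ (2 : ℝ) * ‖k (x - t)‖ₑ := by
        refine lintegral_lintegral_swap ?_
        refine AEMeasurable.mul ((hfm.pow_const 2).comp_snd) ?_
        exact (hkm.comp (measurable_fst.sub measurable_snd)).aemeasurable
    _ = ∫⁻ t, ‖f t‖ₑ ^ (2 : ℝ) := by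
        refine lintegral_congr fun t => ?_
        have hm : Measurable fun x => ‖k (x - t)‖ₑ :=
          hkm.comp (measurable_id.sub measurable_const)
        rw [lintegral_const_mul _ hm, hk1t, mul_one]

/-- `g` is the weak `i`-th partial derivative of `f` on the whole space. -/
def HasWeakPartial (f : E3 → ℝ) (i : Fin 3) (g : E3 → ℝ) : Prop :=
  ∀ φ : E3 → ℝ, ContDiff ℝ ∞ φ → HasCompactSupport φ →
    ∫ x, f x * fderiv ℝ φ x (stdVec i) = -∫ x, g x * φ x

lemma norm_fderiv_le_sum_coord (L : E3 →L[ℝ] ℝ) : ‖L‖ ≤ ∑ i, ‖L (stdVec i)‖ := by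
  refine ContinuousLinearMap.opNorm_le_bound _ (Finset.sum_nonneg fun i _ => norm_nonneg _)
    fun v => ?_
  conv_lhs => rw [← sum_smul_stdVec v]
  rw [map_sum, Finset.sum_mul]
  refine (norm_sum_le _ _).trans (Finset.sum_le_sum fun j _ => ?_)
  rw [map_smul, norm_smul, mul_comm]
  exact mul_le_mul_of_nonneg_left (abs_coord_le_norm v j) (norm_nonneg _)

open scoped NNReal ENNReal Convolution in
/-- The Sobolev inequality for compactly supported functions with weak partial derivatives, by
mollification. -/
lemma exists_sobolev_weak : ∃ C : ℝ≥0, ∀ (f : E3 → ℝ) (g : Fin 3 → E3 → ℝ), Integrable f →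
    (∀ i, Integrable (g i)) → HasCompactSupport f → (∀ i, HasWeakPartial f i (g i)) →
    eLpNorm f 6 volume ≤ C * ∑ i, eLpNorm (g i) 2 volume := by
  obtain ⟨C, hC⟩ := exists_sobolev_const ℝ
  refine ⟨C, fun f g hf hg hfc hw => ?_⟩
  set b : ℕ → ContDiffBump (0 : E3) := fun n =>
    { rIn := 1 / (n + 1), rOut := 2 / (n + 1), rIn_pos := by positivity,
      rIn_lt_rOut := by gcongr; norm_num } with hb
  set k : ℕ → E3 → ℝ := fun n => (b n).normed volume with hk
  have kc : ∀ n, ContDiff ℝ ∞ (k n) := fun n => (b n).contDiff_normed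
  have ks : ∀ n, HasCompactSupport (k n) := fun n => (b n).hasCompactSupport_normed
  have kcont : ∀ n, Continuous (k n) := fun n => (kc n).continuous
  have k1 : ∀ n, ∫⁻ x, ‖k n x‖ₑ = 1 := fun n => by
    have h1 : ∫⁻ x, ‖k n x‖ₑ = ∫⁻ x, ENNReal.ofReal (k n x) :=
      lintegral_congr fun x => Real.enorm_of_nonneg ((b n).nonneg_normed x)
    rw [h1, ← ofReal_integral_eq_lintegral_ofReal ((kcont n).integrable_of_hasCompactSupport (ks n))
      (Eventually.of_forall fun x => (b n).nonneg_normed x), (b n).integral_normed, ENNReal.ofReal_one]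
  set F : ℕ → E3 → ℝ := fun n => f ⋆[ContinuousLinearMap.mul ℝ ℝ, volume] k n with hF
  have Fdiff : ∀ n, ContDiff ℝ 1 (F n) := fun n =>
    (ks n).contDiff_convolution_right _ hf.locallyIntegrable ((kc n).of_le (by exact_mod_cast le_top))
  have Fsupp : ∀ n, HasCompactSupport (F n) := fun n => hfc.convolution _ (ks n)
  have Fd : ∀ n x i, fderiv ℝ (F n) x (stdVec i) = ∫ t, g i t * k n (x - t) := fun n x i => by
    have hd := (ks n).hasFDerivAt_convolution_right (ContinuousLinearMap.mul ℝ ℝ)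
      hf.locallyIntegrable ((kc n).of_le (by exact_mod_cast le_top)) x
    have hφ : ContDiff ℝ ∞ fun t => k n (x - t) := (kc n).comp (contDiff_const.sub contDiff_id)
    have hφs : HasCompactSupport fun t => k n (x - t) :=
      (ks n).comp_homeomorph (Homeomorph.subLeft x)
    have h := hw i _ hφ hφs
    have hφd : ∀ t, fderiv ℝ (fun t => k n (x - t)) t (stdVec i)
        = -(fderiv ℝ (k n) (x - t) (stdVec i)) := fun t => by
      have h1 : HasFDerivAt (fun t => k n (x - t)) _ t :=
        ((kc n).differentiable (by simp) (x - t)).hasFDerivAt.comp t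
          ((hasFDerivAt_id t).const_sub x)
      rw [h1.fderiv]
      simp
    simp only [hφd, mul_neg, integral_neg, neg_inj] at h
    rw [← h, hd.fderiv, convolution]
    have hint := (HasCompactSupport.convolutionExists_right
      (ContinuousLinearMap.precompR E3 (ContinuousLinearMap.mul ℝ ℝ)) ((ks n).fderiv ℝ)
      hf.locallyIntegrable (((kc n).of_le (m := 1) (by exact_mod_cast le_top)).continuous_fderiv
      one_ne_zero) x).integrable
    rw [ContinuousLinearMap.integral_apply hint]
    rfl
  have hbound : ∀ n, eLpNorm (F n) 6 volume ≤ C * ∑ i, eLpNorm (g i) 2 volume := fun n => by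
    refine (hC _ (Fdiff n) (Fsupp n)).trans ?_
    gcongr
    have hm : ∀ i, AEStronglyMeasurable (fun x => fderiv ℝ (F n) x (stdVec i)) volume := fun i =>
      (((Fdiff n).continuous_fderiv one_ne_zero).clm_apply continuous_const).aestronglyMeasurable
    calc eLpNorm (fderiv ℝ (F n)) 2 volume
        ≤ eLpNorm (fun x => ∑ i, ‖fderiv ℝ (F n) x (stdVec i)‖) 2 volume :=
          eLpNorm_mono_real fun x => norm_fderiv_le_sum_coord _
      _ = eLpNorm (∑ i, fun x => ‖fderiv ℝ (F n) x (stdVec i)‖) 2 volume := by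
          congr 1
      _ ≤ ∑ i, eLpNorm (fun x => ‖fderiv ℝ (F n) x (stdVec i)‖) 2 volume :=
          eLpNorm_sum_le (fun i _ => (hm i).norm) (by norm_num)
      _ ≤ ∑ i, eLpNorm (g i) 2 volume := by
          refine Finset.sum_le_sum fun i _ => ?_
          rw [eLpNorm_norm]
          simp only [Fd]
          exact eLpNorm_average_le (kcont n) (k1 n) (hg i).aestronglyMeasurable
  refine eLpNorm_le_of_tendsto_of_le (f := F) (fun n => (Fdiff n).continuous.aestronglyMeasurable)
    ?_ hbound tendsto_const_nhds
  have hconv := ContDiffBump.ae_convolution_tendsto_right_of_locallyIntegrable (φ := b) (l := atTop)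
    (K := 2) (μ := (volume : Measure E3)) (g := f) ?_ ?_ hf.locallyIntegrable
  · filter_upwards [hconv] with x hx
    refine hx.congr fun n => ?_
    rw [hF]
    simp only
    rw [convolution_lsmul_swap]
    simp only [convolution, ContinuousLinearMap.mul_apply', smul_eq_mul]
    exact integral_congr_ae (Eventually.of_forall fun t => mul_comm _ _)
  · have : Tendsto (fun n : ℕ => 2 * (1 / ((n : ℝ) + 1))) atTop (𝓝 (2 * 0)) :=
      tendsto_one_div_add_atTop_nhds_zero_nat.const_mul 2
    rw [mul_zero] at this
    refine this.congr fun n => ?_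
    change 2 * (1 / ((n : ℝ) + 1)) = 2 / ((n : ℝ) + 1)
    ring
  · refine Eventually.of_forall fun n => ?_
    change 2 / ((n : ℝ) + 1) ≤ 2 * (1 / ((n : ℝ) + 1))
    rw [mul_one_div]

/-! ### Integration by parts up to the floor -/

/-- The sign picked up by the `i`-th coordinate under reflection in the floor. -/
def flipSign (i : Fin 3) : ℝ := if i = 2 then -1 else 1

lemma flipSign_sq (i : Fin 3) : flipSign i * flipSign i = 1 := by
  unfold flipSign; split_ifs <;> norm_num

/-- Reflection in the plane of the floor. -/
noncomputable def mirror : E3 ≃ₗᵢ[ℝ] E3 :=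
  LinearIsometryEquiv.piLpCongrRight 2
    (fun i : Fin 3 => if i = 2 then LinearIsometryEquiv.neg ℝ else LinearIsometryEquiv.refl ℝ ℝ)

lemma mirror_apply (x : E3) (i : Fin 3) : mirror x i = flipSign i * x i := by
  simp only [mirror, LinearIsometryEquiv.piLpCongrRight_apply, flipSign]
  split_ifs with h <;> simp

lemma mirror_mirror (x : E3) : mirror (mirror x) = x := by
  ext i
  rw [mirror_apply, mirror_apply, ← mul_assoc, flipSign_sq, one_mul]

lemma mirror_stdVec (i : Fin 3) : mirror (stdVec i) = flipSign i • stdVec i := by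
  ext j
  rw [mirror_apply, PiLp.smul_apply, stdVec_apply, smul_eq_mul]
  split_ifs with h <;> simp [h]

lemma integral_comp_mirror (f : E3 → ℝ) : ∫ x, f (mirror x) = ∫ x, f x :=
  (mirror.measurePreserving).integral_comp mirror.toHomeomorph.measurableEmbedding f

lemma contDiff_ramp_top : ContDiff ℝ ∞ ramp :=
  (Real.smoothTransition.contDiff (n := ⊤)).comp
    ((contDiff_const.mul contDiff_id).sub contDiff_const)

lemma fderiv_ramp_scaled (c : ℝ) (x : E3) (i : Fin 3) :
    fderiv ℝ (fun x : E3 => ramp (c * x 2)) x (stdVec i)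
      = deriv ramp (c * x 2) * (c * (if i = 2 then 1 else 0)) := by
  have h1 : HasFDerivAt (fun x : E3 => c * x 2)
      (c • (EuclideanSpace.proj (𝕜 := ℝ) 2 : E3 →L[ℝ] ℝ)) x :=
    (EuclideanSpace.proj (𝕜 := ℝ) 2 : E3 →L[ℝ] ℝ).hasFDerivAt.const_mul c
  have h2 : HasFDerivAt (fun x : E3 => ramp (c * x 2)) _ x :=
    ((contDiff_ramp.differentiable two_ne_zero _).hasDerivAt).comp_hasFDerivAt x h1
  rw [h2.fderiv]
  simp only [smul_apply, smul_eq_mul]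
  congr 2
  change (stdVec i) 2 = _
  rw [stdVec_apply]
  simp only [eq_comm]

lemma deriv_ramp_eq_zero {s : ℝ} (h : s < 1 / 4 ∨ 3 / 4 < s) : deriv ramp s = 0 := by
  rcases h with h | h
  · have : ramp =ᶠ[𝓝 s] fun _ => 0 := by
      filter_upwards [gt_mem_nhds h] with t ht
      exact ramp_eq_zero (le_of_lt ht)
    rw [this.deriv_eq]; simp
  · have : ramp =ᶠ[𝓝 s] fun _ => 1 := by
      filter_upwards [lt_mem_nhds h] with t ht
      exact ramp_eq_one (le_of_lt ht)
    rw [this.deriv_eq]; simp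

lemma mul_deriv_ramp_bounded : ∃ R, 0 ≤ R ∧ ∀ s : ℝ, |s * deriv ramp s| ≤ R := by
  obtain ⟨R, hR, h⟩ := exists_deriv_ramp_bound
  refine ⟨R, by linarith, fun s => ?_⟩
  by_cases hs : |s| ≤ 1
  · rw [abs_mul]
    calc |s| * |deriv ramp s| ≤ 1 * R := mul_le_mul hs (h s hs).1 (abs_nonneg _) zero_le_one
      _ = R := one_mul R
  · rw [deriv_ramp_eq_zero]
    · simp; linarith
    · rcases le_or_gt 0 s with h0 | h0
      · right; rw [abs_of_nonneg h0] at hs; linarith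
      · left; linarith

/-- Integration by parts in the half-ball against functions that need not vanish on the floor, in
the vertical direction under the condition that they vanish there to first order. -/
lemma integral_halfBall_by_parts {D : Set E3} {a : ℝ}
    (hD : ∀ x : E3, ‖x‖ < a → (x ∈ D ↔ 0 < x 2)) {z : E3 → ℝ} {Dz : E3 → E3}
    (hz : HasWeakGradOn D z Dz) (hDm : MeasurableSet D) {ψ : E3 → ℝ} (hψ : ContDiff ℝ ∞ ψ)
    (hψs : HasCompactSupport ψ) (hψa : tsupport ψ ⊆ Metric.ball 0 a) (i : Fin 3) {L : ℝ}
    (hL : i = 2 → ∀ x, |ψ x| ≤ L * |x 2|) :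
    ∫ x in D, z x * fderiv ℝ ψ x (stdVec i) = -∫ x in D, Dz x i * ψ x := by
  obtain ⟨hzi, hDzi, hw⟩ := hz
  obtain ⟨R, hR0, hR⟩ := mul_deriv_ramp_bounded
  obtain ⟨C0, hC0⟩ := hψs.exists_bound_of_continuous hψ.continuous
  have hψ1 : Continuous fun x => fderiv ℝ ψ x (stdVec i) :=
    (hψ.continuous_fderiv (by simp)).clm_apply continuous_const
  obtain ⟨C1, hC1⟩ := (hψs.fderiv_apply ℝ (stdVec i)).exists_bound_of_continuous hψ1
  -- cut off near the floor at scale `1 / (n + 1)`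
  set cut : ℕ → E3 → ℝ := fun n x => ramp ((n + 1) * x 2) with hcut
  have cutc : ∀ n, ContDiff ℝ ∞ (cut n) := fun n =>
    contDiff_ramp_top.comp (contDiff_const.mul
      (EuclideanSpace.proj (𝕜 := ℝ) 2 : E3 →L[ℝ] ℝ).contDiff)
  have hn0 : ∀ n : ℕ, (0 : ℝ) < n + 1 := fun n => by positivity
  have hd : ∀ n x, fderiv ℝ (fun x => ψ x * cut n x) x (stdVec i)
      = cut n x * fderiv ℝ ψ x (stdVec i)
        + ψ x * (deriv ramp ((n + 1) * x 2) * ((n + 1) * (if i = 2 then 1 else 0))) := by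
    intro n x
    have := fderiv_fun_mul ((hψ.differentiable (by simp)) x) ((cutc n).differentiable (by simp) x)
    rw [this]
    simp only [add_apply, smul_apply, smul_eq_mul]
    rw [show fderiv ℝ (cut n) x (stdVec i) = _ from fderiv_ramp_scaled _ x i]
    ring
  have hid : ∀ n, ∫ x in D, z x * fderiv ℝ (fun x => ψ x * cut n x) x (stdVec i)
      = -∫ x in D, Dz x i * (ψ x * cut n x) := fun n => by
    refine hw _ (hψ.mul (cutc n)) hψs.mul_right ?_ i
    have hcl : IsClosed {x : E3 | 1 / 4 ≤ ((n : ℝ) + 1) * x 2} :=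
      isClosed_le continuous_const (by fun_prop)
    have hsub : tsupport (fun x => ψ x * cut n x) ⊆ {x : E3 | 1 / 4 ≤ ((n : ℝ) + 1) * x 2} := by
      refine closure_minimal (fun x hx => ?_) hcl
      by_contra hcon
      refine hx ?_
      simp only [hcut]
      rw [ramp_eq_zero (not_le.1 hcon).le, mul_zero]
    intro x hx
    have hxa : ‖x‖ < a := by simpa using hψa (tsupport_mul_subset_left hx)
    refine (hD x hxa).2 ?_
    have h2 : 1 / 4 ≤ ((n : ℝ) + 1) * x 2 := hsub hx
    by_contra hcon
    nlinarith [hn0 n]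
  have hpos : ∀ x ∈ D, ‖x‖ < a → 0 < x 2 := fun x hx hxa => (hD x hxa).1 hx
  have hout : ∀ x, ¬ ‖x‖ < a → ψ x = 0 ∧ fderiv ℝ ψ x = 0 := fun x hx => by
    have : x ∉ tsupport ψ := fun h => hx (by simpa using hψa h)
    exact ⟨image_eq_zero_of_notMem_tsupport this, fderiv_of_notMem_tsupport ℝ this⟩
  have hlarge : ∀ x : E3, 0 < x 2 → ∀ᶠ n : ℕ in atTop, 1 < ((n : ℝ) + 1) * x 2 := fun x hx => by
    have h1 : Tendsto (fun n : ℕ => ((n : ℝ) + 1) * x 2) atTop atTop :=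
      (tendsto_atTop_add_const_right _ 1 tendsto_natCast_atTop_atTop).atTop_mul_const hx
    exact h1.eventually_gt_atTop 1
  have lim1 : Tendsto (fun n => ∫ x in D, z x * fderiv ℝ (fun x => ψ x * cut n x) x (stdVec i)) atTop
      (𝓝 (∫ x in D, z x * fderiv ℝ ψ x (stdVec i))) := by
    refine tendsto_integral_of_dominated_convergence (fun x => ‖z x‖ * (C1 + |L| * R)) (fun n => ?_)
      (hzi.norm.mul_const _) (fun n => ?_) ?_
    · refine hzi.aestronglyMeasurable.mul ?_
      exact (((hψ.mul (cutc n)).continuous_fderiv (by simp)).clm_apply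
        continuous_const).aestronglyMeasurable
    · refine (ae_restrict_iff' hDm).2 (Eventually.of_forall fun x hx => ?_)
      rw [norm_mul]
      refine mul_le_mul_of_nonneg_left ?_ (norm_nonneg _)
      rw [hd]
      refine (norm_add_le _ _).trans (add_le_add ?_ ?_)
      · rw [norm_mul]
        exact (mul_le_of_le_one_left (norm_nonneg _) (abs_ramp_le _)).trans (hC1 x)
      · by_cases hi : i = 2
        · rw [if_pos hi, mul_one, norm_mul, norm_mul]
          calc ‖ψ x‖ * (‖deriv ramp ((n + 1) * x 2)‖ * ‖(n : ℝ) + 1‖)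
              ≤ (L * |x 2|) * (‖deriv ramp ((n + 1) * x 2)‖ * ‖(n : ℝ) + 1‖) := by
                gcongr
                exact hL hi x
            _ = L * |((n + 1) * x 2) * deriv ramp ((n + 1) * x 2)| := by
                rw [abs_mul, abs_mul, Real.norm_eq_abs, Real.norm_eq_abs]; ring
            _ ≤ |L| * R := mul_le_mul (le_abs_self L) (hR _) (abs_nonneg _) (abs_nonneg _)
        · rw [if_neg hi]
          simp only [mul_zero, norm_zero]
          positivity
    · refine (ae_restrict_iff' hDm).2 (Eventually.of_forall fun x hx => ?_)
      by_cases hxa : ‖x‖ < a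
      · refine tendsto_const_nhds.congr' ?_
        filter_upwards [hlarge x (hpos x hx hxa)] with n hn
        rw [hd, deriv_ramp_eq_zero (Or.inr (by linarith))]
        simp only [hcut]
        rw [ramp_eq_one (by linarith)]
        ring
      · refine tendsto_const_nhds.congr fun n => ?_
        rw [hd, (hout x hxa).1, (hout x hxa).2]
        simp
  have lim2 : Tendsto (fun n => -∫ x in D, Dz x i * (ψ x * cut n x)) atTop
      (𝓝 (-∫ x in D, Dz x i * ψ x)) := by
    refine Tendsto.neg ?_
    refine tendsto_integral_of_dominated_convergence (fun x => ‖Dz x i‖ * C0) (fun n => ?_)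
      ((hDzi i).norm.mul_const _) (fun n => ?_) ?_
    · exact (hDzi i).aestronglyMeasurable.mul
        (hψ.mul (cutc n)).continuous.aestronglyMeasurable
    · refine Eventually.of_forall fun x => ?_
      rw [norm_mul, norm_mul]
      refine mul_le_mul_of_nonneg_left ?_ (norm_nonneg _)
      exact (mul_le_of_le_one_right (norm_nonneg _) (abs_ramp_le _)).trans (hC0 x)
    · refine (ae_restrict_iff' hDm).2 (Eventually.of_forall fun x hx => ?_)
      by_cases hxa : ‖x‖ < a
      · refine tendsto_const_nhds.congr' ?_
        filter_upwards [hlarge x (hpos x hx hxa)] with n hn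
        simp only [hcut]
        rw [ramp_eq_one (by linarith), mul_one]
      · refine tendsto_const_nhds.congr fun n => ?_
        rw [(hout x hxa).1]
        simp
  simp only [hid] at lim1
  exact tendsto_nhds_unique lim1 lim2

/-! ### Even reflection in the floor -/

lemma MeasureTheory.Integrable.mul_continuous_compact {f g : E3 → ℝ} (hf : Integrable f)
    (hg : Continuous g) (hgs : HasCompactSupport g) : Integrable fun x => f x * g x := by
  obtain ⟨C, hC⟩ := hgs.exists_bound_of_continuous hg
  exact hf.mul_bdd hg.aestronglyMeasurable (Eventually.of_forall hC)

lemma integrable_comp_mirror {f : E3 → ℝ} (hf : Integrable f) : Integrable fun x => f (mirror x) :=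
  (mirror.measurePreserving).integrable_comp_of_integrable hf

lemma eLpNorm_comp_mirror {f : E3 → ℝ} (hf : Integrable f) (p : ENNReal) :
    eLpNorm (fun x => f (mirror x)) p volume = eLpNorm f p volume :=
  eLpNorm_comp_measurePreserving hf.aestronglyMeasurable mirror.measurePreserving

lemma fderiv_comp_mirror {ψ : E3 → ℝ} (hψ : ContDiff ℝ ∞ ψ) (x : E3) (i : Fin 3) :
    fderiv ℝ (fun y => ψ (mirror y)) x (stdVec i)
      = flipSign i * fderiv ℝ ψ (mirror x) (stdVec i) := by
  have h : HasFDerivAt (fun y => ψ (mirror y)) _ x :=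
    ((hψ.differentiable (by simp)) (mirror x)).hasFDerivAt.comp x
      (mirror.toContinuousLinearEquiv : E3 →L[ℝ] E3).hasFDerivAt
  rw [h.fderiv]
  change fderiv ℝ ψ (mirror x) (mirror (stdVec i)) = _
  rw [mirror_stdVec, map_smul, smul_eq_mul]

/-- The even reflection of a Sobolev function on a half-ball is weakly differentiable in the whole
ball: the even (odd, in the vertical direction) part of a test function is admissible in the
half-ball. -/
lemma integral_reflected_by_parts {D : Set E3} {a : ℝ}
    (hD : ∀ x : E3, ‖x‖ < a → (x ∈ D ↔ 0 < x 2)) {z : E3 → ℝ} {Dz : E3 → E3}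
    (hz : HasWeakGradOn D z Dz) (hDm : MeasurableSet D) {ψ : E3 → ℝ} (hψ : ContDiff ℝ ∞ ψ)
    (hψs : HasCompactSupport ψ) (hψa : tsupport ψ ⊆ Metric.ball 0 a) (i : Fin 3) :
    ∫ x, (D.indicator z x + D.indicator z (mirror x)) * fderiv ℝ ψ x (stdVec i)
      = -∫ x, (D.indicator (fun x => Dz x i) x
          + flipSign i * D.indicator (fun x => Dz x i) (mirror x)) * ψ x := by
  set zp := D.indicator z with hzp
  set Dp := D.indicator (fun x => Dz x i) with hDp
  have zi : Integrable zp := (integrable_indicator_iff hDm).2 hz.1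
  have Di : Integrable Dp := (integrable_indicator_iff hDm).2 (hz.2.1 i)
  set ψm : E3 → ℝ := fun x => ψ (mirror x) with hψm
  have ψmc : ContDiff ℝ ∞ ψm := hψ.comp (mirror.toContinuousLinearEquiv : E3 →L[ℝ] E3).contDiff
  have ψms : HasCompactSupport ψm := hψs.comp_homeomorph mirror.toHomeomorph
  have ψma : tsupport ψm ⊆ Metric.ball 0 a := by
    intro x hx
    have : mirror x ∈ tsupport ψ :=
      tsupport_comp_subset_preimage ψ mirror.continuous hx
    simpa using hψa this
  set Ψ : E3 → ℝ := fun x => ψ x + flipSign i * ψm x with hΨ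
  have Ψc : ContDiff ℝ ∞ Ψ := hψ.add (contDiff_const.mul ψmc)
  have Ψs : HasCompactSupport Ψ := hψs.add (ψms.mul_left)
  have Ψa : tsupport Ψ ⊆ Metric.ball 0 a := by
    refine (tsupport_add ψ _).trans (union_subset hψa ?_)
    exact (tsupport_mul_subset_right (f := fun _ => flipSign i) (g := ψm)).trans ψma
  have dψ : ∀ {f : E3 → ℝ}, ContDiff ℝ ∞ f → Continuous fun x => fderiv ℝ f x (stdVec i) :=
    fun hf => (hf.continuous_fderiv (by simp)).clm_apply continuous_const
  obtain ⟨L, hL⟩ : ∃ L : ℝ, i = 2 → ∀ x, |Ψ x| ≤ L * |x 2| := by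
    obtain ⟨C, hC⟩ := (hψ.of_le (by simp : (1 : WithTop ℕ∞) ≤ ∞)).lipschitzWith_of_hasCompactSupport
      hψs (by simp)
    refine ⟨C * 2, fun hi x => ?_⟩
    have h1 : Ψ x = ψ x - ψ (mirror x) := by
      simp only [hΨ, hψm, hi, flipSign, if_true]; ring
    rw [h1, ← Real.norm_eq_abs, ← dist_eq_norm]
    refine (hC.dist_le_mul _ _).trans ?_
    rw [mul_assoc]
    refine mul_le_mul_of_nonneg_left ?_ C.2
    have h2 : x - mirror x = (2 * x 2) • stdVec 2 := by
      ext j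
      rw [PiLp.sub_apply, mirror_apply, PiLp.smul_apply, stdVec_apply, smul_eq_mul]
      unfold flipSign
      by_cases hj : j = 2
      · subst hj; simp; ring
      · rw [if_neg hj, if_neg (by simpa [eq_comm] using hj)]; ring
    rw [dist_eq_norm, h2, norm_smul, norm_stdVec, mul_one, norm_mul]
    simp
  have key := integral_halfBall_by_parts hD hz hDm Ψc Ψs Ψa i hL
  have e1 : ∫ x in D, z x * fderiv ℝ Ψ x (stdVec i) = ∫ x, zp x * fderiv ℝ Ψ x (stdVec i) := by
    rw [← integral_indicator hDm]
    refine integral_congr_ae (Eventually.of_forall fun x => ?_)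
    simp only [hzp, indicator]; split_ifs <;> simp
  have e2 : ∫ x in D, Dz x i * Ψ x = ∫ x, Dp x * Ψ x := by
    rw [← integral_indicator hDm]
    refine integral_congr_ae (Eventually.of_forall fun x => ?_)
    simp only [hDp, indicator]; split_ifs <;> simp
  have dΨ : ∀ x, fderiv ℝ Ψ x (stdVec i)
      = fderiv ℝ ψ x (stdVec i) + fderiv ℝ ψ (mirror x) (stdVec i) := fun x => by
    have h1 := fderiv_fun_add ((hψ.differentiable (by simp)) x)
      (((contDiff_const (c := flipSign i)).mul ψmc).differentiable (by simp) x)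
    rw [hΨ, h1, add_apply, fderiv_const_mul (ψmc.differentiable (by simp) x)]
    rw [smul_apply, fderiv_comp_mirror hψ, smul_eq_mul, ← mul_assoc, flipSign_sq, one_mul]
  have i1 : Integrable fun x => zp x * fderiv ℝ ψ x (stdVec i) :=
    zi.mul_continuous_compact (dψ hψ) (hψs.fderiv_apply ℝ _)
  have i2 : Integrable fun x => zp (mirror x) * fderiv ℝ ψ x (stdVec i) :=
    (integrable_comp_mirror zi).mul_continuous_compact (dψ hψ) (hψs.fderiv_apply ℝ _)
  have i2' : Integrable fun x => zp x * fderiv ℝ ψ (mirror x) (stdVec i) := by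
    have := integrable_comp_mirror i2
    simpa only [mirror_mirror] using this
  have j1 : Integrable fun x => Dp x * ψ x := Di.mul_continuous_compact hψ.continuous hψs
  have j2 : Integrable fun x => Dp (mirror x) * ψ x :=
    (integrable_comp_mirror Di).mul_continuous_compact hψ.continuous hψs
  have j2' : Integrable fun x => Dp x * ψm x := Di.mul_continuous_compact ψmc.continuous ψms
  have l1 : ∫ x, (zp x + zp (mirror x)) * fderiv ℝ ψ x (stdVec i)
      = ∫ x, zp x * fderiv ℝ Ψ x (stdVec i) := by
    simp only [add_mul, dΨ, mul_add]
    rw [integral_add i1 i2, integral_add i1 i2',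
      ← integral_comp_mirror fun x => zp (mirror x) * fderiv ℝ ψ x (stdVec i)]
    simp only [mirror_mirror]
  have l2 : ∫ x, (Dp x + flipSign i * Dp (mirror x)) * ψ x = ∫ x, Dp x * Ψ x := by
    have h1 : ∀ x, (Dp x + flipSign i * Dp (mirror x)) * ψ x
        = Dp x * ψ x + flipSign i * (Dp (mirror x) * ψ x) := fun x => by ring
    have h2 : ∀ x, Dp x * Ψ x = Dp x * ψ x + flipSign i * (Dp x * ψm x) := fun x => by
      simp only [hΨ]; ring
    simp only [h1, h2]
    rw [integral_add j1 (j2.const_mul _), integral_add j1 (j2'.const_mul _), integral_const_mul,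
      integral_const_mul, ← integral_comp_mirror fun x => Dp (mirror x) * ψ x]
    simp only [mirror_mirror, hψm]
  rw [l1, l2, ← e1, ← e2, key]

lemma eLpNorm_two_indicator_le {D : Set E3} (hDm : MeasurableSet D) {f : E3 → ℝ}
    {q : E3 → ℝ} (h : ∀ x, f x ^ 2 ≤ q x) :
    eLpNorm (D.indicator f) 2 volume ≤ (∫⁻ x in D, ENNReal.ofReal (q x)) ^ (1 / 2 : ℝ) := by
  rw [eLpNorm_indicator_eq_eLpNorm_restrict hDm,
    eLpNorm_eq_lintegral_rpow_enorm_toReal two_ne_zero ENNReal.ofNat_ne_top]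
  simp only [ENNReal.toReal_ofNat]
  gcongr with x
  rw [← ofReal_norm, ENNReal.ofReal_rpow_of_nonneg (norm_nonneg _) (by norm_num)]
  refine ENNReal.ofReal_le_ofReal ?_
  rw [Real.rpow_two, Real.norm_eq_abs, sq_abs]
  exact h x

open scoped NNReal ENNReal in
set_option maxHeartbeats 1000000 in
/-- The Sobolev inequality near a flat piece of the boundary, by even reflection. -/
lemma exists_sobolev_near_floor {a : ℝ} (ha : 0 < a) : ∃ C : ℝ≥0, ∀ (D : Set E3), MeasurableSet D →
    (∀ x : E3, ‖x‖ < a → (x ∈ D ↔ 0 < x 2)) → ∀ (z : E3 → ℝ) (Dz : E3 → E3),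
    HasWeakGradOn D z Dz →
    eLpNorm z 6 (volume.restrict (D ∩ Metric.ball 0 (a / 2)))
      ≤ C * (∫⁻ x in D, ENNReal.ofReal (z x ^ 2 + ‖Dz x‖ ^ 2)) ^ (1 / 2 : ℝ) := by
  obtain ⟨C, hC⟩ := exists_sobolev_weak
  let θ : ContDiffBump (0 : E3) :=
    { rIn := a / 2, rOut := 3 * a / 4, rIn_pos := by positivity, rIn_lt_rOut := by linarith }
  have θc : ContDiff ℝ ∞ θ := θ.contDiff
  have θs : HasCompactSupport θ := θ.hasCompactSupport
  have θa : tsupport θ ⊆ Metric.ball 0 a := by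
    rw [θ.tsupport_eq]
    exact Metric.closedBall_subset_ball (by change 3 * a / 4 < a; linarith)
  have dθ : ∀ i, Continuous fun x => fderiv ℝ θ x (stdVec i) :=
    fun i => (θc.continuous_fderiv (by simp)).clm_apply continuous_const
  have bd : ∃ R : ℝ≥0, ∀ i x, ‖fderiv ℝ θ x (stdVec i)‖ ≤ R := by
    have : ∀ i, ∃ R, ∀ x, ‖fderiv ℝ θ x (stdVec i)‖ ≤ R := fun i =>
      (θs.fderiv_apply ℝ (stdVec i)).exists_bound_of_continuous (dθ i)
    choose R hR using this
    refine ⟨∑ i, (R i).toNNReal, fun i x => (hR i x).trans ((Real.le_coe_toNNReal _).trans ?_)⟩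
    exact NNReal.coe_le_coe.2 (Finset.single_le_sum (f := fun i => (R i).toNNReal)
      (fun j _ => zero_le) (Finset.mem_univ i))
  obtain ⟨R, hR⟩ := bd
  refine ⟨C * (3 * (2 * R + 2)), fun D hDm hD z Dz hz => ?_⟩
  set zp := D.indicator z with hzp
  set Dp : Fin 3 → E3 → ℝ := fun i => D.indicator (fun x => Dz x i) with hDp
  have zi : Integrable zp := (integrable_indicator_iff hDm).2 hz.1
  have Di : ∀ i, Integrable (Dp i) := fun i => (integrable_indicator_iff hDm).2 (hz.2.1 i)
  set Y : E3 → ℝ := fun x => zp x + zp (mirror x) with hY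
  set G : Fin 3 → E3 → ℝ := fun i x => Dp i x + flipSign i * Dp i (mirror x) with hG
  have Yi : Integrable Y := zi.add (integrable_comp_mirror zi)
  have Gi : ∀ i, Integrable (G i) := fun i =>
    (Di i).add ((integrable_comp_mirror (Di i)).const_mul _)
  set E : Fin 3 → E3 → ℝ := fun i x => Y x * fderiv ℝ θ x (stdVec i) + G i x * θ x with hE
  have hZi : Integrable fun x => Y x * θ x := Yi.mul_continuous_compact θc.continuous θs
  have hEi : ∀ i, Integrable (E i) := fun i =>
    (Yi.mul_continuous_compact (dθ i) (θs.fderiv_apply ℝ _)).add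
      ((Gi i).mul_continuous_compact θc.continuous θs)
  have hw : ∀ i, HasWeakPartial (fun x => Y x * θ x) i (E i) := by
    intro i φ hφ hφs
    have key := integral_reflected_by_parts hD hz hDm (θc.mul hφ) (θs.mul_right)
      ((tsupport_mul_subset_left).trans θa) i
    have dφ : Continuous fun x => fderiv ℝ φ x (stdVec i) :=
      (hφ.continuous_fderiv (by simp)).clm_apply continuous_const
    have d : ∀ x, fderiv ℝ (fun x => θ x * φ x) x (stdVec i)
        = θ x * fderiv ℝ φ x (stdVec i) + φ x * fderiv ℝ θ x (stdVec i) := fun x => by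
      rw [fderiv_fun_mul (θc.differentiable (by simp) x) (hφ.differentiable (by simp) x)]
      rfl
    have I1 : Integrable fun x => Y x * θ x * fderiv ℝ φ x (stdVec i) :=
      hZi.mul_continuous_compact dφ (hφs.fderiv_apply ℝ _)
    have I2 : Integrable fun x => Y x * fderiv ℝ θ x (stdVec i) * φ x :=
      (Yi.mul_continuous_compact (dθ i) (θs.fderiv_apply ℝ _)).mul_continuous_compact
        hφ.continuous hφs
    have I3 : Integrable fun x => G i x * θ x * φ x :=
      ((Gi i).mul_continuous_compact θc.continuous θs).mul_continuous_compact hφ.continuous hφs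
    have k1 : ∫ x, Y x * fderiv ℝ (fun x => θ x * φ x) x (stdVec i)
        = (∫ x, Y x * θ x * fderiv ℝ φ x (stdVec i))
          + ∫ x, Y x * fderiv ℝ θ x (stdVec i) * φ x := by
      rw [← integral_add I1 I2]
      congr 1; ext x; rw [d]; ring
    have k2 : ∫ x, E i x * φ x = (∫ x, Y x * fderiv ℝ θ x (stdVec i) * φ x)
        + ∫ x, G i x * θ x * φ x := by
      rw [← integral_add I2 I3]
      congr 1; ext x; simp only [hE]; ring
    have k3 : ∫ x, G i x * (θ x * φ x) = ∫ x, G i x * θ x * φ x := by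
      congr 1; ext x; ring
    have key' : ∫ x, Y x * fderiv ℝ (fun x => θ x * φ x) x (stdVec i)
        = -∫ x, G i x * (θ x * φ x) := key
    rw [k1, k3] at key'
    rw [k2]
    linarith
  have main := hC _ E hZi hEi (θs.mul_left) hw
  set Q : ℝ≥0∞ := (∫⁻ x in D, ENNReal.ofReal (z x ^ 2 + ‖Dz x‖ ^ 2)) ^ (1 / 2 : ℝ) with hQ
  have zQ : eLpNorm zp 2 volume ≤ Q :=
    eLpNorm_two_indicator_le hDm fun x => by nlinarith [sq_nonneg ‖Dz x‖]
  have DQ : ∀ i, eLpNorm (Dp i) 2 volume ≤ Q := fun i =>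
    eLpNorm_two_indicator_le hDm fun x => by
      have h1 := abs_coord_le_norm (Dz x) i
      have h2 : (Dz x i) ^ 2 ≤ ‖Dz x‖ ^ 2 := sq_le_sq' (by linarith [neg_abs_le (Dz x i)])
        ((le_abs_self _).trans h1)
      nlinarith [sq_nonneg (z x)]
  have YQ : eLpNorm Y 2 volume ≤ 2 * Q := by
    refine (eLpNorm_add_le zi.aestronglyMeasurable
      (integrable_comp_mirror zi).aestronglyMeasurable (by norm_num)).trans ?_
    rw [eLpNorm_comp_mirror zi, two_mul]
    exact add_le_add zQ zQ
  have GQ : ∀ i, eLpNorm (G i) 2 volume ≤ 2 * Q := fun i => by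
    refine (eLpNorm_add_le (Di i).aestronglyMeasurable
      ((integrable_comp_mirror (Di i)).const_mul _).aestronglyMeasurable (by norm_num)).trans ?_
    rw [two_mul]
    refine add_le_add (DQ i) ?_
    refine le_trans (le_of_eq ?_) (DQ i)
    rw [← eLpNorm_comp_mirror (Di i) 2]
    refine eLpNorm_congr_norm_ae (Eventually.of_forall fun x => ?_)
    unfold flipSign; split_ifs <;> simp
  have EQ : ∀ i, eLpNorm (E i) 2 volume ≤ (2 * R + 2) * Q := fun i => by
    refine (eLpNorm_add_le
      (Yi.mul_continuous_compact (dθ i) (θs.fderiv_apply ℝ _)).aestronglyMeasurable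
      ((Gi i).mul_continuous_compact θc.continuous θs).aestronglyMeasurable (by norm_num)).trans ?_
    rw [add_mul]
    refine add_le_add ?_ ?_
    · have h1 : eLpNorm (fun x => Y x * fderiv ℝ θ x (stdVec i)) 2 volume
          ≤ (R : ℝ≥0∞) * eLpNorm Y 2 volume :=
        (eLpNorm_le_nnreal_smul_eLpNorm_of_ae_le_mul (c := R) (Eventually.of_forall fun x => by
          rw [← NNReal.coe_le_coe]
          push_cast
          rw [norm_mul, mul_comm]
          exact mul_le_mul_of_nonneg_right (hR i x) (norm_nonneg _)) 2)
      refine h1.trans ?_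
      calc (R : ℝ≥0∞) * eLpNorm Y 2 volume ≤ R * (2 * Q) := by gcongr
        _ = 2 * R * Q := by ring
    · refine (eLpNorm_mono fun x => ?_).trans (GQ i)
      rw [norm_mul]
      refine mul_le_of_le_one_right (norm_nonneg _) ?_
      rw [Real.norm_eq_abs, abs_of_nonneg θ.nonneg]
      exact θ.le_one
  have hlhs : eLpNorm z 6 (volume.restrict (D ∩ Metric.ball 0 (a / 2)))
      ≤ eLpNorm (fun x => Y x * θ x) 6 volume := by
    refine le_trans (le_of_eq ?_) (eLpNorm_restrict_le (fun x => Y x * θ x) 6 volume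
      (D ∩ Metric.ball 0 (a / 2)))
    refine eLpNorm_congr_ae ((ae_restrict_iff' (hDm.inter measurableSet_ball)).2
      (Eventually.of_forall fun x hx => ?_))
    have hxa : ‖x‖ < a / 2 := by simpa using hx.2
    have h1 : θ x = 1 := θ.one_of_mem_closedBall (by
      rw [mem_closedBall_zero_iff]; exact hxa.le)
    have h2 : mirror x ∉ D := by
      rw [hD _ (by rw [mirror.norm_map]; linarith), mirror_apply]
      have := (hD x (by linarith)).1 hx.1
      simp [flipSign]; exact this.le
    change z x = (D.indicator z x + D.indicator z (mirror x)) * θ x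
    rw [indicator_of_mem hx.1, indicator_of_notMem h2, h1]; ring
  refine hlhs.trans (main.trans ?_)
  calc (C : ℝ≥0∞) * ∑ i, eLpNorm (E i) 2 volume
      ≤ C * ∑ _i : Fin 3, (2 * R + 2) * Q := by
        gcongr with i; exact EQ i
    _ = (C * (3 * (2 * R + 2)) : ℝ≥0) * Q := by
        push_cast
        simp only [Finset.sum_const, Finset.card_univ, Fintype.card_fin, nsmul_eq_mul]
        push_cast; ring

/-! ### The singular profile in the cusp -/

/-- The cusp `r ≤ b x₃ ^ (1 / (1 + α))` between the floor and the body, within distance `R` of the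
origin. -/
def cuspSet (α b R : ℝ) : Set E3 := {x | 0 < x 2 ∧ rad x ≤ b * x 2 ^ (1 / (1 + α)) ∧ ‖x‖ ≤ R}

/-- The singular profile `x₃ ^ (-(1 + 2α) / (1 + α))` in the cusp, extended by zero. -/
noncomputable def cusp (α b R : ℝ) : E3 → ℝ :=
  (cuspSet α b R).indicator fun x => x 2 ^ (-((1 + 2 * α) / (1 + α)))

lemma continuous_rad : Continuous rad := by unfold rad; fun_prop

lemma measurableSet_cuspSet {α b R : ℝ} : MeasurableSet (cuspSet α b R) := by
  have h2 : Measurable fun x : E3 => x 2 := (by fun_prop : Continuous fun x : E3 => x 2).measurable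
  refine (measurableSet_lt measurable_const h2).inter
    ((measurableSet_le continuous_rad.measurable (measurable_const.mul (h2.pow_const _))).inter
      (measurableSet_le continuous_norm.measurable measurable_const))

lemma measurable_cusp {α b R : ℝ} : Measurable (cusp α b R) := by
  have h2 : Measurable fun x : E3 => x 2 := (by fun_prop : Continuous fun x : E3 => x 2).measurable
  exact (h2.pow_const _).indicator measurableSet_cuspSet

lemma cusp_nonneg {α b R : ℝ} (x : E3) : 0 ≤ cusp α b R x :=
  indicator_nonneg (fun _ hx => Real.rpow_nonneg hx.1.le _) x

lemma cusp_eq_zero {α b R : ℝ} {x : E3} (h : R < ‖x‖) : cusp α b R x = 0 :=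
  indicator_of_notMem (fun hx => absurd hx.2.2 (not_le.2 h)) _

/-- Splitting off the vertical coordinate. -/
lemma lintegral_le_vertical_slices (f : ℝ → (Fin 2 → ℝ) → ENNReal) :
    ∫⁻ x : E3, f (x 2) ![x 0, x 1] ≤ ∫⁻ s, ∫⁻ y, f s y := by
  have h1 := (EuclideanSpace.volume_preserving_symm_measurableEquiv_toLp (Fin 3)).symm
  have h2 := volume_preserving_piFinSuccAbove (fun _ : Fin 3 => ℝ) 2
  rw [← h1.lintegral_comp_emb (MeasurableEquiv.measurableEmbedding _)]
  rw [← (h2.symm _).lintegral_comp_emb (MeasurableEquiv.measurableEmbedding _)]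
  refine le_trans (le_of_eq ?_) (lintegral_prod_le (fun p : ℝ × (Fin 2 → ℝ) => f p.1 p.2))
  refine lintegral_congr fun p => ?_
  congr 1
  ext j
  fin_cases j <;> rfl

/-- The cusp is thin enough for powers of the profile to be integrable: its section at height `t` has
an area of order `t ^ (2 / (1 + α))`, so that the `q`-th power of the profile contributes
`t ^ ((2 - q (1 + 2α)) / (1 + α))`, whose exponent exceeds `-1`. -/
lemma lintegral_cusp_rpow_lt_top {α b R q : ℝ} (hα : 0 < α) (hb : 0 ≤ b) (hR : R ≤ 1) (hq : 0 < q)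
    (hqα : q * (1 + 2 * α) < 3 + α) : ∫⁻ x, ENNReal.ofReal (cusp α b R x ^ q) < ⊤ := by
  set p : ℝ := 1 / (1 + α) with hp
  set s : ℝ := (1 + 2 * α) / (1 + α) with hs
  have h1α : 0 < 1 + α := by linarith
  have hexp : -1 < 2 * p + -s * q := by
    have : 2 * p + -s * q = (2 - q * (1 + 2 * α)) / (1 + α) := by
      rw [hp, hs]; field_simp; ring
    rw [this, lt_div_iff₀ h1α]; linarith
  set f : ℝ → (Fin 2 → ℝ) → ENNReal := fun t y =>
    (Ioc 0 1).indicator (fun t => ENNReal.ofReal (t ^ (-s * q))) t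
      * (Icc (fun _ => -(b * t ^ p)) (fun _ => b * t ^ p)).indicator 1 y with hf
  have hle : ∀ x : E3, ENNReal.ofReal (cusp α b R x ^ q) ≤ f (x 2) ![x 0, x 1] := by
    intro x
    by_cases hx : x ∈ cuspSet α b R
    · have h1 : cusp α b R x = x 2 ^ (-s) := indicator_of_mem hx _
      have h2 : x 2 ∈ Ioc (0 : ℝ) 1 :=
        ⟨hx.1, ((le_abs_self _).trans (abs_coord_le_norm x 2)).trans (hx.2.2.trans hR)⟩
      have h3 : ![x 0, x 1] ∈ Icc (fun _ : Fin 2 => -(b * x 2 ^ p)) (fun _ => b * x 2 ^ p) := by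
        have h := abs_coord_le_rad x
        rw [mem_Icc, Pi.le_def, Pi.le_def]
        simp only [Fin.forall_fin_two]
        have h0 := abs_le.1 (h.1.trans hx.2.1)
        have h1 := abs_le.1 (h.2.trans hx.2.1)
        exact ⟨⟨h0.1, h1.1⟩, ⟨h0.2, h1.2⟩⟩
      simp only [hf]
      rw [indicator_of_mem h2, indicator_of_mem h3, h1, ← Real.rpow_mul hx.1.le]
      simp
    · have h1 : cusp α b R x = 0 := indicator_of_notMem hx _
      rw [h1, Real.zero_rpow hq.ne']
      simp
  have hslice : ∀ t, ∫⁻ y, f t y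
      ≤ (Ioc 0 1).indicator (fun t => ENNReal.ofReal ((2 * b) ^ 2 * t ^ (2 * p + -s * q))) t := by
    intro t
    by_cases ht : t ∈ Ioc (0 : ℝ) 1
    · simp only [hf]
      rw [indicator_of_mem ht, indicator_of_mem ht, lintegral_const_mul' _ _ ENNReal.ofReal_ne_top,
        lintegral_indicator_one measurableSet_Icc, Real.volume_Icc_pi]
      have ht0 : 0 ≤ b * t ^ p := mul_nonneg hb (Real.rpow_nonneg ht.1.le _)
      simp only [Finset.prod_const, Finset.card_univ, Fintype.card_fin]
      rw [← ENNReal.ofReal_pow (by linarith), ← ENNReal.ofReal_mul (Real.rpow_nonneg ht.1.le _)]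
      refine ENNReal.ofReal_le_ofReal (le_of_eq ?_)
      rw [Real.rpow_add ht.1, two_mul p, Real.rpow_add ht.1]
      ring
    · simp only [hf]
      rw [indicator_of_notMem ht]; simp
  refine lt_of_le_of_lt (lintegral_mono hle) (lt_of_le_of_lt (lintegral_le_vertical_slices f)
    (lt_of_le_of_lt (lintegral_mono hslice) ?_))
  rw [lintegral_indicator measurableSet_Ioc]
  have hi : IntegrableOn (fun t : ℝ => (2 * b) ^ 2 * t ^ (2 * p + -s * q)) (Ioc 0 1) := by
    have := (intervalIntegral.intervalIntegrable_rpow' (a := 0) (b := 1) hexp).const_mul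
      ((2 * b) ^ 2)
    rwa [intervalIntegrable_iff_integrableOn_Ioc_of_le zero_le_one] at this
  exact hi.lintegral_lt_top

/-! ### Bounds of the test field -/

/-- The powers of the height `t` by which the test field and its derivatives are bounded in the
cusp. -/
lemma cusp_powers {α t : ℝ} (hα : 0 < α) (hα1 : α < 1) (ht : 0 < t) (ht1 : t ≤ 1) :
    1 / t ≤ t ^ (-((1 + 2 * α) / (1 + α))) ∧
    t ^ (1 / (1 + α)) * (1 / t ^ 2) = t ^ (-((1 + 2 * α) / (1 + α))) ∧
    (t ^ (1 / (1 + α)) * (1 / t)) ^ 3 ≤ t ^ (-((1 + 2 * α) / (1 + α))) := by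
  have h1α : 0 < 1 + α := by linarith
  refine ⟨?_, ?_, ?_⟩
  · rw [one_div, ← Real.rpow_neg_one]
    refine Real.rpow_le_rpow_of_exponent_ge ht ht1 ?_
    rw [neg_le_neg_iff, le_div_iff₀ h1α]; linarith
  · rw [one_div (t ^ 2), ← Real.rpow_two, ← Real.rpow_neg ht.le, ← Real.rpow_add ht]
    congr 1; field_simp; ring
  · rw [one_div t, ← Real.rpow_neg_one t, ← Real.rpow_add ht, ← Real.rpow_natCast,
      ← Real.rpow_mul ht.le]
    refine Real.rpow_le_rpow_of_exponent_ge ht ht1 ?_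
    rw [div_add' _ _ _ h1α.ne', div_mul_eq_mul_div, ← neg_div, div_le_div_iff_of_pos_right h1α]
    push_cast; linarith

lemma one_add_cube_le {w : ℝ} (hw : 0 ≤ w) : (1 + w) ^ 3 ≤ 4 * (1 + w ^ 3) ∧ 1 + w ≤ (1 + w) ^ 3 := by
  have h1 := mul_nonneg (sq_nonneg (1 - w)) (by linarith : (0 : ℝ) ≤ 1 + w)
  have h2 := mul_nonneg hw (sq_nonneg w)
  have h3 := sq_nonneg w
  constructor <;> ring_nf at * <;> linarith

set_option maxHeartbeats 800000 in
/-- The test field and its first derivatives are controlled by the singular profile of the cusp,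
uniformly in the height of the body. -/
lemma exists_liftField_bounds {η χ : E3 → ℝ} (hη : ContDiff ℝ 2 η) (hηc : HasCompactSupport η)
    (hχ : ContDiff ℝ 2 χ) {R : ℝ} (hR : R ≤ 1) (hχs : tsupport χ ⊆ Metric.closedBall 0 R)
    {N : ℝ} (hN0 : 0 < N) {α c : ℝ} (hα : 0 < α) (hα1 : α < 1) (hc : 0 < c)
    (hcN : c * (6 * (1 + N)) ≤ 1) (P : ℝ) :
    ∃ b C : ℝ, 0 ≤ b ∧ 0 < C ∧ ∀ h, 0 < h → h ≤ N → ∀ x : E3, rad x ≤ P →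
      ‖liftField (potential η χ α c) (h, x)‖ ≤ C * (1 + cusp α b R x) ∧
      ‖liftField (potential η χ α c) (h, x)‖ ^ 3 ≤ C * (1 + cusp α b R x) ∧
      ∀ v : ℝ × E3, ‖v‖ ≤ 1 → ∀ i,
        |(fderiv ℝ (liftField (potential η χ α c)) (h, x) v) i| ≤ C * (1 + cusp α b R x) := by
  have hχ1 : tsupport χ ⊆ Metric.closedBall 0 1 := hχs.trans (Metric.closedBall_subset_closedBall hR)
  obtain ⟨C1, hC1, j1⟩ := exists_jetBound_potential_layer hη hηc hχ hχ1 hN0 hα hα1 hc hcN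
  obtain ⟨C2, hC2, j2⟩ := exists_jetBound_potential_off hη hηc hχ hχ1 hN0 hα hα1 hc hcN
  have h1α : 0 < 1 + α := by linarith
  set p := 1 / (1 + α) with hp
  set b : ℝ := (4 / c) ^ p with hb
  have hb0 : 0 ≤ b := Real.rpow_nonneg (by positivity) _
  set A1 : ℝ := 3 * (C1 * (1 + b)) with hA1
  set A2 : ℝ := 3 * (C2 * (1 + |P|)) with hA2
  have hA1' : 1 ≤ A1 := by
    have : 1 * 1 ≤ C1 * (1 + b) := mul_le_mul hC1 (by linarith) zero_le_one (by linarith)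
    linarith
  have hA2' : 1 ≤ A2 := by
    have : 1 * 1 ≤ C2 * (1 + |P|) :=
      mul_le_mul hC2 (by linarith [abs_nonneg P]) zero_le_one (by linarith)
    linarith
  have p1 : 1 ≤ A1 ^ 2 := one_le_pow₀ hA1'
  have p2 : 1 ≤ A2 ^ 2 := one_le_pow₀ hA2'
  have q1 : A1 ≤ 4 * A1 ^ 3 := by linarith [le_self_pow₀ hA1' three_ne_zero]
  have q2 : A2 ≤ A2 ^ 3 := le_self_pow₀ hA2' three_ne_zero
  refine ⟨b, 4 * A1 ^ 3 + A2 ^ 3, hb0, by positivity, fun h hh hN x hxP => ?_⟩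
  have hr0 := rad_nonneg x
  have hcn := cusp_nonneg (α := α) (b := b) (R := R) x
  -- in the layer the height `x₃` is comparable with the gap, hence `x` lies in the cusp and each
  -- derivative of the potential costs a factor `1 / x₃`; elsewhere all derivatives are bounded
  by_cases hx : x ∈ layer χ α c h
  · obtain ⟨hxs, hlo, hup⟩ := hx
    set H := barrier α c (h, x) with hH
    have hl : c * (h + rad x ^ (1 + α)) ≤ H := barrier_lower hα hc x
    have hrp : 0 ≤ rad x ^ (1 + α) := Real.rpow_nonneg hr0 _
    have hHpos : 0 < H := lt_of_lt_of_le (by positivity) hl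
    set t := x 2 with ht
    have ht0 : 0 < t := by linarith
    have hxR : ‖x‖ ≤ R := by simpa using hχs hxs
    have ht1 : t ≤ 1 := ((le_abs_self _).trans (abs_coord_le_norm x 2)).trans (hxR.trans hR)
    have hrt : rad x ≤ b * t ^ p := by
      have h1 : rad x ^ (1 + α) ≤ 4 / c * t := by
        rw [div_mul_eq_mul_div, le_div_iff₀ hc]
        nlinarith
      calc rad x = (rad x ^ (1 + α)) ^ p := by
            rw [← Real.rpow_mul hr0, hp, mul_one_div_cancel h1α.ne', Real.rpow_one]
        _ ≤ (4 / c * t) ^ p := Real.rpow_le_rpow hrp h1 (by positivity)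
        _ = b * t ^ p := Real.mul_rpow (by positivity) ht0.le
    have hcusp : cusp α b R x = t ^ (-((1 + 2 * α) / (1 + α))) :=
      indicator_of_mem (show x ∈ cuspSet α b R from ⟨ht0, hrt, hxR⟩) _
    obtain ⟨k1, k2, k3⟩ := cusp_powers hα hα1 ht0 ht1
    rw [← hcusp] at k1 k2 k3
    have htp : 0 ≤ t ^ p := Real.rpow_nonneg ht0.le _
    have hC10 : 0 ≤ C1 := by linarith
    have htH : t ≤ H := by linarith
    have b1 : C1 / H ≤ C1 * (1 / t) := by
      rw [mul_one_div]; exact div_le_div_of_nonneg_left hC10 ht0 htH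
    have b2 : C1 / H ^ 2 ≤ C1 * (1 / t ^ 2) := by
      rw [mul_one_div]
      exact div_le_div_of_nonneg_left hC10 (by positivity) (pow_le_pow_left₀ ht0.le htH 2)
    have J := (j1 h hh hN x ⟨hxs, hlo, hup⟩).mono le_rfl b1 b2
    set g := 1 + cusp α b R x with hg
    set w := t ^ p * (1 / t) with hw
    have hw0 : 0 ≤ w := mul_nonneg htp (by positivity)
    have n1 : ‖liftField (potential η χ α c) (h, x)‖ ≤ A1 * (1 + w) := by
      refine (norm_liftField_le J).trans ?_
      have : rad x * (C1 * (1 / t)) ≤ b * t ^ p * (C1 * (1 / t)) :=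
        mul_le_mul_of_nonneg_right hrt (by positivity)
      have e : b * t ^ p * (C1 * (1 / t)) = C1 * b * w := by rw [hw]; ring
      change 3 * (C1 + rad x * (C1 * (1 / t))) ≤ _
      rw [hA1]
      nlinarith [mul_nonneg hC10 hw0, mul_nonneg hC10 hb0]
    have hw3 : w ^ 3 ≤ cusp α b R x := k3
    have hw1 : (1 + w) ^ 3 ≤ 4 * g := by linarith [(one_add_cube_le hw0).1]
    have n3 : ‖liftField (potential η χ α c) (h, x)‖ ^ 3 ≤ 4 * A1 ^ 3 * g := by
      refine (pow_le_pow_left₀ (norm_nonneg _) n1 3).trans ?_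
      rw [mul_pow]
      calc A1 ^ 3 * (1 + w) ^ 3 ≤ A1 ^ 3 * (4 * g) :=
            mul_le_mul_of_nonneg_left hw1 (by positivity)
        _ = 4 * A1 ^ 3 * g := by ring
    have hg1 : 1 ≤ g := by linarith
    have hwg : 1 + w ≤ 4 * g := (one_add_cube_le hw0).2.trans hw1
    have hA23 : 0 ≤ A2 ^ 3 * g := by positivity
    have hA13 : A1 ≤ A1 ^ 3 := le_self_pow₀ hA1' (by norm_num)
    refine ⟨?_, ?_, fun v hv i => ?_⟩
    · refine n1.trans ?_
      have : A1 * (1 + w) ≤ A1 ^ 3 * (4 * g) := mul_le_mul hA13 hwg (by linarith) (by positivity)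
      linarith
    · linarith
    · refine (abs_fderiv_liftField_le J hv i).trans ?_
      have : rad x * (C1 * (1 / t ^ 2)) ≤ b * t ^ p * (C1 * (1 / t ^ 2)) :=
        mul_le_mul_of_nonneg_right hrt (by positivity)
      have e : b * t ^ p * (C1 * (1 / t ^ 2)) = C1 * b * cusp α b R x := by rw [← k2]; ring
      change 2 * (C1 * (1 / t)) + rad x * (C1 * (1 / t ^ 2)) ≤ _
      have m1 : C1 * (1 / t) ≤ C1 * cusp α b R x := mul_le_mul_of_nonneg_left k1 hC10
      have m2 : A1 * g ≤ 4 * A1 ^ 3 * g := mul_le_mul_of_nonneg_right q1 (by linarith)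
      have m3 : A1 * g = 3 * C1 * g + 3 * C1 * b * g := by rw [hA1]; ring
      nlinarith [mul_nonneg hC10 hb0, mul_nonneg (mul_nonneg hC10 hb0) hcn, mul_nonneg hC10 hcn]
  · have J := j2 h hh hN x hx
    set g := 1 + cusp α b R x with hg
    have hg1 : 1 ≤ g := by linarith
    have hrP : rad x ≤ |P| := hxP.trans (le_abs_self P)
    have hC20 : 0 ≤ C2 := by linarith
    have n0 : rad x * C2 ≤ |P| * C2 := mul_le_mul_of_nonneg_right hrP hC20
    have n1 : ‖liftField (potential η χ α c) (h, x)‖ ≤ A2 := by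
      refine (norm_liftField_le J).trans ?_
      change 3 * (C2 + rad x * C2) ≤ _
      rw [hA2]; linarith
    have n2 : A2 ^ 3 ≤ (4 * A1 ^ 3 + A2 ^ 3) * g := by
      have : 0 ≤ A1 ^ 3 := by positivity
      nlinarith [pow_nonneg (by linarith : (0 : ℝ) ≤ A2) 3]
    refine ⟨n1.trans (q2.trans n2), (pow_le_pow_left₀ (norm_nonneg _) n1 3).trans n2,
      fun v hv i => ?_⟩
    refine (abs_fderiv_liftField_le J hv i).trans (le_trans ?_ (q2.trans n2))
    change 2 * C2 + rad x * C2 ≤ _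
    rw [hA2]; nlinarith [mul_nonneg hC20 (abs_nonneg P)]

/-! ### Hölder estimates of the terms of the momentum equation -/

section Slices
open scoped NNReal ENNReal

variable {X : Type*} [MeasurableSpace X] {ν : Measure X}

/-- Hölder's inequality for three functions. -/
lemma lintegral_rpow_mul_rpow_mul_rpow_le {f g k : X → ℝ≥0∞} (hf : AEMeasurable f ν)
    (hg : AEMeasurable g ν) (hk : AEMeasurable k ν) {a b c : ℝ} (ha : 0 ≤ a) (hb : 0 ≤ b)
    (hc : 0 ≤ c) (habc : a + b + c = 1) :
    ∫⁻ x, f x ^ a * g x ^ b * k x ^ c ∂ν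
      ≤ (∫⁻ x, f x ∂ν) ^ a * (∫⁻ x, g x ∂ν) ^ b * (∫⁻ x, k x ∂ν) ^ c := by
  have := ENNReal.lintegral_prod_norm_pow_le (μ := ν) Finset.univ (f := ![f, g, k])
    (p := ![a, b, c]) (by intro i _; fin_cases i <;> assumption)
    (by simp [Fin.sum_univ_three, habc]) (by intro i _; fin_cases i <;> assumption)
  simpa [Fin.prod_univ_three] using this

lemma ofReal_rpow_rpow_inv {r p : ℝ} (hr : 0 ≤ r) (hp : 0 < p) :
    ENNReal.ofReal (r ^ p) ^ (1 / p) = ENNReal.ofReal r := by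
  rw [ENNReal.ofReal_rpow_of_nonneg (Real.rpow_nonneg hr _) (by positivity), ← Real.rpow_mul hr,
    mul_one_div_cancel hp.ne', Real.rpow_one]

/-- A density in `L^γ`, a function in `L^3` and a weight in `L^q`, `1/γ + 1/3 + 1/q = 1`. -/
lemma lintegral_density_weight_le {ρ g : X → ℝ} {f : X → ℝ≥0∞} (hρ : AEMeasurable ρ ν)
    (hf : AEMeasurable f ν) (hg : AEMeasurable g ν) (hρ0 : ∀ᵐ x ∂ν, 0 ≤ ρ x)
    (hg0 : ∀ x, 0 ≤ g x) {γ q : ℝ} (hγ : 0 < γ) (hq : 0 < q) (h1 : 1 / γ + 1 / 3 + 1 / q = 1) :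
    ∫⁻ x, ENNReal.ofReal (ρ x) * f x * ENNReal.ofReal (g x) ∂ν
      ≤ (∫⁻ x, ENNReal.ofReal (ρ x ^ γ) ∂ν) ^ (1 / γ) * (∫⁻ x, f x ^ (3 : ℝ) ∂ν) ^ (1 / 3 : ℝ)
        * (∫⁻ x, ENNReal.ofReal (g x ^ q) ∂ν) ^ (1 / q) := by
  refine le_trans (le_of_eq ?_) (lintegral_rpow_mul_rpow_mul_rpow_le (ν := ν)
    (hρ.pow_const γ).ennreal_ofReal (hf.pow_const (3 : ℝ)) (hg.pow_const q).ennreal_ofReal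
    (by positivity) (by norm_num) (by positivity) h1)
  refine lintegral_congr_ae ?_
  filter_upwards [hρ0] with x hx
  rw [ofReal_rpow_rpow_inv hx hγ, ofReal_rpow_rpow_inv (hg0 x) hq, ← ENNReal.rpow_mul]
  norm_num

/-- The gravity term: the Hölder exponents are `γ` for the density and `q` for the weight. -/
lemma lintegral_density_le {ρ g : X → ℝ} (hρ : AEMeasurable ρ ν) (hg : AEMeasurable g ν)
    (hρ0 : ∀ᵐ x ∂ν, 0 ≤ ρ x) (hg0 : ∀ x, 0 ≤ g x) {γ q K : ℝ} (hγ : 0 < γ) (hq : 0 < q)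
    (h1 : 1 / γ + 1 / 3 + 1 / q = 1) (hK : 0 ≤ K)
    (hρK : ∫⁻ x, ENNReal.ofReal (ρ x ^ γ) ∂ν ≤ ENNReal.ofReal K) :
    ∫⁻ x, ENNReal.ofReal (ρ x * g x) ∂ν
      ≤ ν univ ^ (1 / 3 : ℝ) * (∫⁻ x, ENNReal.ofReal (g x ^ q) ∂ν) ^ (1 / q)
        * ENNReal.ofReal (K ^ (1 / γ)) := by
  have := lintegral_density_weight_le (f := fun _ => 1) hρ aemeasurable_const hg hρ0 hg0 hγ hq h1
  simp only [ENNReal.one_rpow, lintegral_one, mul_one] at this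
  calc ∫⁻ x, ENNReal.ofReal (ρ x * g x) ∂ν
      = ∫⁻ x, ENNReal.ofReal (ρ x) * ENNReal.ofReal (g x) ∂ν := by
        simp only [ENNReal.ofReal_mul' (hg0 _)]
    _ ≤ _ := this
    _ ≤ ENNReal.ofReal K ^ (1 / γ) * ν univ ^ (1 / 3 : ℝ)
          * (∫⁻ x, ENNReal.ofReal (g x ^ q) ∂ν) ^ (1 / q) := by gcongr
    _ = _ := by rw [ENNReal.ofReal_rpow_of_nonneg hK (by positivity)]; ring

/-- The convective term: the Hölder exponents are `γ` for the density, `3` for `|u|²` and `q` for the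
weight. -/
lemma lintegral_convection_le {V : Type*} [NormedAddCommGroup V] {ρ g : X → ℝ} {u : X → V}
    (hρ : AEMeasurable ρ ν) (hg : AEMeasurable g ν) (hu : AEStronglyMeasurable u ν)
    (hρ0 : ∀ᵐ x ∂ν, 0 ≤ ρ x) (hg0 : ∀ x, 0 ≤ g x) {γ q K : ℝ} (hγ : 0 < γ) (hq : 0 < q)
    (h1 : 1 / γ + 1 / 3 + 1 / q = 1) (hK : 0 ≤ K)
    (hρK : ∫⁻ x, ENNReal.ofReal (ρ x ^ γ) ∂ν ≤ ENNReal.ofReal K) {C D : ℝ≥0∞}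
    (hS : eLpNorm u 6 ν ≤ C * D ^ (1 / 2 : ℝ)) :
    ∫⁻ x, ENNReal.ofReal (ρ x * ‖u x‖ ^ 2 * g x) ∂ν
      ≤ C ^ (2 : ℝ) * (∫⁻ x, ENNReal.ofReal (g x ^ q) ∂ν) ^ (1 / q)
        * ENNReal.ofReal (K ^ (1 / γ)) * D := by
  have h := lintegral_density_weight_le (f := fun x => ‖u x‖ₑ ^ (2 : ℝ)) hρ
    (hu.enorm.pow_const _) hg hρ0 hg0 hγ hq h1
  have h6 : (∫⁻ x, (‖u x‖ₑ ^ (2 : ℝ)) ^ (3 : ℝ) ∂ν) ^ (1 / 3 : ℝ) ≤ C ^ (2 : ℝ) * D := by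
    have e : (∫⁻ x, (‖u x‖ₑ ^ (2 : ℝ)) ^ (3 : ℝ) ∂ν) ^ (1 / 3 : ℝ) = eLpNorm u 6 ν ^ (2 : ℝ) := by
      rw [eLpNorm_eq_lintegral_rpow_enorm_toReal (by norm_num) (by norm_num), ← ENNReal.rpow_mul]
      simp only [ENNReal.toReal_ofNat, ← ENNReal.rpow_mul]
      norm_num
    rw [e]
    refine (ENNReal.rpow_le_rpow hS (by norm_num)).trans (le_of_eq ?_)
    rw [ENNReal.mul_rpow_of_nonneg _ _ (by norm_num), ← ENNReal.rpow_mul]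
    norm_num
  calc ∫⁻ x, ENNReal.ofReal (ρ x * ‖u x‖ ^ 2 * g x) ∂ν
      = ∫⁻ x, ENNReal.ofReal (ρ x) * ‖u x‖ₑ ^ (2 : ℝ) * ENNReal.ofReal (g x) ∂ν := by
        refine lintegral_congr fun x => ?_
        rw [ENNReal.ofReal_mul' (hg0 x), ENNReal.ofReal_mul' (by positivity), ← ofReal_norm,
          ENNReal.ofReal_rpow_of_nonneg (norm_nonneg _) (by norm_num), Real.rpow_two]
    _ ≤ _ := h
    _ ≤ ENNReal.ofReal K ^ (1 / γ) * (C ^ (2 : ℝ) * D)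
          * (∫⁻ x, ENNReal.ofReal (g x ^ q) ∂ν) ^ (1 / q) := by gcongr
    _ = _ := by rw [ENNReal.ofReal_rpow_of_nonneg hK (by positivity)]; ring

/-- By `ρ w² ≤ 1 + ρ ^ γ + w³`. -/
lemma lintegral_density_mul_sq_le {ρ g w : X → ℝ} (hg : Measurable g) (hρ0 : ∀ᵐ x ∂ν, 0 ≤ ρ x)
    (hρ : AEMeasurable ρ ν)
    (hw0 : ∀ x, 0 ≤ w x) {A : ℝ} (hA : 0 ≤ A) (hw : ∀ᵐ x ∂ν, w x ^ 3 ≤ A * g x)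
    {γ K : ℝ} (hγ : 3 < γ)
    (hρK : ∫⁻ x, ENNReal.ofReal (ρ x ^ γ) ∂ν ≤ ENNReal.ofReal K) :
    ∫⁻ x, ENNReal.ofReal (ρ x * w x ^ 2) ∂ν
      ≤ ν univ + ENNReal.ofReal K + ENNReal.ofReal A * ∫⁻ x, ENNReal.ofReal (g x) ∂ν := by
  have hpt : ∀ᵐ x ∂ν, ENNReal.ofReal (ρ x * w x ^ 2)
      ≤ 1 + ENNReal.ofReal (ρ x ^ γ) + ENNReal.ofReal A * ENNReal.ofReal (g x) := by
    filter_upwards [hρ0, hw] with x hx hwx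
    have h3 : ρ x ^ 3 ≤ 1 + ρ x ^ γ := by
      rcases le_total (ρ x) 1 with h | h
      · have := pow_le_one₀ hx h (n := 3)
        have := Real.rpow_nonneg hx γ
        linarith
      · have := Real.rpow_le_rpow_of_exponent_le h hγ.le
        rw [show (3 : ℝ) = ((3 : ℕ) : ℝ) by norm_num, Real.rpow_natCast] at this
        linarith
    have h4 : ρ x * w x ^ 2 ≤ ρ x ^ 3 + w x ^ 3 := by
      have hwn := hw0 x
      rcases le_total (ρ x) (w x) with h | h
      · have : ρ x * w x ^ 2 ≤ w x * w x ^ 2 := mul_le_mul_of_nonneg_right h (sq_nonneg _)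
        nlinarith [pow_nonneg hx 3]
      · have : ρ x * w x ^ 2 ≤ ρ x * ρ x ^ 2 :=
          mul_le_mul_of_nonneg_left (pow_le_pow_left₀ hwn h 2) hx
        nlinarith [pow_nonneg hwn 3]
    rw [← ENNReal.ofReal_mul hA, ← ENNReal.ofReal_one, ← ENNReal.ofReal_add zero_le_one
      (Real.rpow_nonneg hx γ), ← ENNReal.ofReal_add (add_nonneg zero_le_one (Real.rpow_nonneg hx γ))
      ((pow_nonneg (hw0 x) 3).trans hwx)]
    exact ENNReal.ofReal_le_ofReal (by linarith)
  refine (lintegral_mono_ae hpt).trans ?_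
  rw [lintegral_add_right _ (hg.ennreal_ofReal.const_mul _),
    lintegral_add_right' _ (hρ.pow_const γ).ennreal_ofReal, lintegral_one,
    lintegral_const_mul _ hg.ennreal_ofReal]
  gcongr

/-- Since `ϑ ^ (β / 2)` lies in `L⁶`, the square of the temperature lies in `L ^ (3β / 2)`, and the
square of the weight is needed in `L ^ (q / 2)` with the conjugate exponent `q / 2`. -/
lemma lintegral_temp_sq_mul_sq_le {ϑ k : X → ℝ} (hϑ0 : ∀ᵐ x ∂ν, 0 < ϑ x) (hϑ : AEMeasurable ϑ ν)
    (hk : Measurable k) (hk0 : ∀ x, 0 ≤ k x) {β q : ℝ} (hβ : 2 < β)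
    (hq : q = 6 * β / (3 * β - 2)) {C Z : ℝ≥0∞}
    (hS : eLpNorm (fun x => ϑ x ^ (β / 2)) 6 ν ≤ C * Z ^ (1 / 2 : ℝ)) :
    ∫⁻ x, ENNReal.ofReal (ϑ x ^ 2 * k x ^ 2) ∂ν
      ≤ C ^ (4 / β) * (∫⁻ x, ENNReal.ofReal (k x ^ q) ∂ν) ^ (2 / q) * (1 + Z) := by
  have hβ0 : 0 < β := by linarith
  have h32 : 0 < 3 * β - 2 := by linarith
  have hq0 : 0 < q := by rw [hq]; positivity
  have hsum : 2 / (3 * β) + 2 / q = 1 := by rw [hq]; field_simp; ring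
  have h := lintegral_rpow_mul_rpow_mul_rpow_le (ν := ν) (a := 2 / (3 * β)) (b := 2 / q) (c := 0)
    (f := fun x => ENNReal.ofReal ((ϑ x ^ (β / 2)) ^ (6 : ℝ)))
    (g := fun x => ENNReal.ofReal (k x ^ q)) (k := fun _ => 1)
    ((hϑ.pow_const _).pow_const _).ennreal_ofReal (hk.pow_const q).ennreal_ofReal.aemeasurable
    aemeasurable_const (by positivity) (by positivity) le_rfl (by rw [hsum, add_zero])
  have e : (∫⁻ x, ENNReal.ofReal ((ϑ x ^ (β / 2)) ^ (6 : ℝ)) ∂ν) ^ (2 / (3 * β))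
      ≤ C ^ (4 / β) * (1 + Z) := by
    have e1 : ∫⁻ x, ENNReal.ofReal ((ϑ x ^ (β / 2)) ^ (6 : ℝ)) ∂ν
        = ∫⁻ x, ‖ϑ x ^ (β / 2)‖ₑ ^ (6 : ℝ) ∂ν := by
      refine lintegral_congr_ae ?_
      filter_upwards [hϑ0] with x hx
      rw [Real.enorm_of_nonneg (Real.rpow_nonneg hx.le _),
        ENNReal.ofReal_rpow_of_nonneg (Real.rpow_nonneg hx.le _) (by norm_num)]
    have e2 : (∫⁻ x, ENNReal.ofReal ((ϑ x ^ (β / 2)) ^ (6 : ℝ)) ∂ν) ^ (2 / (3 * β))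
        = eLpNorm (fun x => ϑ x ^ (β / 2)) 6 ν ^ (4 / β) := by
      rw [e1, eLpNorm_eq_lintegral_rpow_enorm_toReal (by norm_num) (by norm_num),
        ← ENNReal.rpow_mul]
      simp only [ENNReal.toReal_ofNat]
      congr 1; field_simp; norm_num
    rw [e2]
    refine (ENNReal.rpow_le_rpow hS (by positivity)).trans ?_
    rw [ENNReal.mul_rpow_of_nonneg _ _ (by positivity), ← ENNReal.rpow_mul]
    gcongr
    have h2β : 1 / 2 * (4 / β) ≤ 1 := by
      rw [div_mul_div_comm, div_le_one (by positivity)]; linarith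
    rcases le_total Z 1 with hZ | hZ
    · exact (ENNReal.rpow_le_one hZ (by positivity)).trans le_self_add
    · calc Z ^ (1 / 2 * (4 / β)) ≤ Z ^ (1 : ℝ) := ENNReal.rpow_le_rpow_of_exponent_le hZ h2β
        _ ≤ 1 + Z := by rw [ENNReal.rpow_one]; exact le_add_self
  calc ∫⁻ x, ENNReal.ofReal (ϑ x ^ 2 * k x ^ 2) ∂ν
      = ∫⁻ x, ENNReal.ofReal ((ϑ x ^ (β / 2)) ^ (6 : ℝ)) ^ (2 / (3 * β))
          * ENNReal.ofReal (k x ^ q) ^ (2 / q) * 1 ^ (0 : ℝ) ∂ν := by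
        refine lintegral_congr_ae ?_
        filter_upwards [hϑ0] with x hx
        rw [ENNReal.ofReal_mul (sq_nonneg _), ENNReal.one_rpow, mul_one,
          ENNReal.ofReal_rpow_of_nonneg (by positivity) (by positivity),
          ENNReal.ofReal_rpow_of_nonneg (Real.rpow_nonneg (hk0 x) _) (by positivity),
          ← Real.rpow_mul hx.le, ← Real.rpow_mul hx.le, ← Real.rpow_mul (hk0 x),
          mul_div_cancel₀ _ hq0.ne', Real.rpow_two, ← Real.rpow_two]
        congr 3
        field_simp; norm_num
    _ ≤ _ := h
    _ ≤ C ^ (4 / β) * (1 + Z) * (∫⁻ x, ENNReal.ofReal (k x ^ q) ∂ν) ^ (2 / q) := by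
        rw [ENNReal.rpow_zero, mul_one]
        gcongr
    _ = _ := by ring

/-- The viscous term, where `fr` is the square of the velocity gradient and `k` the singular part of
the weight. An `L⁶` bound for the temperature is needed only in the set `s` where `k` does not
vanish. -/
lemma lintegral_dissipation_le {ϑ k fr n : X → ℝ} (hϑ0 : ∀ᵐ x ∂ν, 0 < ϑ x) (hϑ : AEMeasurable ϑ ν)
    (hk : Measurable k) (hk0 : ∀ x, 0 ≤ k x) (hfr : ∀ x, 0 ≤ fr x)
    (hfm : AEMeasurable fr ν) (hn : ∀ x, 0 ≤ n x)
    {β q : ℝ} (hβ : 2 < β)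
    (hq : q = 6 * β / (3 * β - 2)) {C Z D : ℝ≥0∞} {s : Set X} (hs : MeasurableSet s)
    (hks : ∀ x ∉ s, k x = 0)
    (hS : eLpNorm (fun x => ϑ x ^ (β / 2)) 6 (ν.restrict s) ≤ C * Z ^ (1 / 2 : ℝ))
    (hZ : ∫⁻ x, ENNReal.ofReal ((ϑ x ^ (β / 2)) ^ 2 + n x) ∂ν ≤ Z)
    (hD : ∫⁻ x, ENNReal.ofReal (fr x) ∂ν ≤ D) :
    ∫⁻ x, ENNReal.ofReal ((1 + ϑ x) * √(fr x) * (1 + k x)) ∂ν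
      ≤ (4 * (3 * ν univ + 1 + ∫⁻ x, ENNReal.ofReal (k x ^ q) ∂ν
        + C ^ (4 / β) * (∫⁻ x, ENNReal.ofReal (k x ^ q) ∂ν) ^ (2 / q))) * (1 + D + Z) := by
  have hβ0 : 0 < β := by linarith
  have h32 : 0 < 3 * β - 2 := by linarith
  have hq2 : 2 ≤ q := by rw [hq, le_div_iff₀ h32]; linarith
  set I := ∫⁻ x, ENNReal.ofReal (k x ^ q) ∂ν with hI
  have hpt : ∀ᵐ x ∂ν, ENNReal.ofReal ((1 + ϑ x) * √(fr x) * (1 + k x))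
      ≤ ENNReal.ofReal (fr x) + 4 * (3 + ENNReal.ofReal ((ϑ x ^ (β / 2)) ^ 2 + n x)
        + ENNReal.ofReal (k x ^ q) + ENNReal.ofReal (ϑ x ^ 2 * k x ^ 2)) := by
    filter_upwards [hϑ0] with x hx
    have pow_le : ∀ {t p : ℝ}, 0 ≤ t → 2 ≤ p → t ^ 2 ≤ 1 + t ^ p := fun {t p} ht hp => by
      rcases le_total t 1 with h | h
      · have := pow_le_one₀ ht h (n := 2)
        have := Real.rpow_nonneg ht p
        linarith
      · have := Real.rpow_le_rpow_of_exponent_le h hp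
        rw [Real.rpow_two] at this
        linarith
    have e1 : (ϑ x ^ (β / 2)) ^ 2 = ϑ x ^ β := by
      rw [← Real.rpow_natCast, ← Real.rpow_mul hx.le]; congr 1; push_cast; ring
    have h1 : ϑ x ^ 2 ≤ 1 + (ϑ x ^ (β / 2)) ^ 2 := by rw [e1]; exact pow_le hx.le hβ.le
    have h2 : k x ^ 2 ≤ 1 + k x ^ q := pow_le (hk0 x) hq2
    have h3 := Real.sq_sqrt (hfr x)
    have h4 := hn x
    have h5 := hk0 x
    have k1 : (1 + ϑ x) * √(fr x) * (1 + k x) ≤ fr x + ((1 + ϑ x) * (1 + k x)) ^ 2 := by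
      nlinarith [sq_nonneg (√(fr x) - (1 + ϑ x) * (1 + k x)), sq_nonneg ((1 + ϑ x) * (1 + k x))]
    have k2 : ((1 + ϑ x) * (1 + k x)) ^ 2 ≤ (2 * (1 + ϑ x ^ 2)) * (2 * (1 + k x ^ 2)) := by
      rw [mul_pow]
      refine mul_le_mul ?_ ?_ (sq_nonneg _) (by positivity)
      · nlinarith [sq_nonneg (1 - ϑ x)]
      · nlinarith [sq_nonneg (1 - k x)]
    have hkq := Real.rpow_nonneg h5 q
    have hzz : 0 ≤ (ϑ x ^ (β / 2)) ^ 2 + n x := by positivity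
    rw [← ENNReal.ofReal_ofNat 4, ← ENNReal.ofReal_ofNat 3, ← ENNReal.ofReal_add (by norm_num) hzz,
      ← ENNReal.ofReal_add (by positivity) hkq, ← ENNReal.ofReal_add (by positivity) (by positivity),
      ← ENNReal.ofReal_mul (by norm_num), ← ENNReal.ofReal_add (hfr x) (by positivity)]
    refine ENNReal.ofReal_le_ofReal ?_
    nlinarith
  have hsq : ∫⁻ x, ENNReal.ofReal (ϑ x ^ 2 * k x ^ 2) ∂ν ≤ C ^ (4 / β) * I ^ (2 / q) * (1 + Z) := by
    have e : ∫⁻ x, ENNReal.ofReal (ϑ x ^ 2 * k x ^ 2) ∂ν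
        = ∫⁻ x, ENNReal.ofReal (ϑ x ^ 2 * k x ^ 2) ∂(ν.restrict s) := by
      rw [← lintegral_indicator hs]
      refine lintegral_congr fun x => ?_
      by_cases hx : x ∈ s
      · rw [indicator_of_mem hx]
      · rw [indicator_of_notMem hx, hks x hx]; simp
    rw [e]
    refine (lintegral_temp_sq_mul_sq_le (ae_restrict_of_ae hϑ0) hϑ.restrict hk hk0 hβ hq hS).trans ?_
    gcongr
    exact setLIntegral_le_lintegral _ _
  have mk : AEMeasurable (fun x => ENNReal.ofReal (k x ^ q)) ν :=
    (hk.pow_const q).ennreal_ofReal.aemeasurable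
  have mϑ : AEMeasurable (fun x => ENNReal.ofReal (ϑ x ^ 2 * k x ^ 2)) ν :=
    ((hϑ.pow_const 2).mul (hk.pow_const 2).aemeasurable).ennreal_ofReal
  calc ∫⁻ x, ENNReal.ofReal ((1 + ϑ x) * √(fr x) * (1 + k x)) ∂ν
      ≤ D + 4 * (3 * ν univ + Z + I + C ^ (4 / β) * I ^ (2 / q) * (1 + Z)) := by
        refine (lintegral_mono_ae hpt).trans ?_
        rw [lintegral_add_left' hfm.ennreal_ofReal, lintegral_const_mul' _ _ (by norm_num),
          lintegral_add_right' _ mϑ, lintegral_add_right' _ mk, lintegral_add_left' aemeasurable_const,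
          lintegral_const]
        gcongr
    _ ≤ (D + 4 * (3 * ν univ + Z + I + C ^ (4 / β) * I ^ (2 / q) * (1 + Z)))
          + (4 + D * (12 * ν univ + 3 + 4 * I + 4 * (C ^ (4 / β) * I ^ (2 / q)))
            + Z * (12 * ν univ + 4 * I)) := le_self_add
    _ = _ := by ring

end Slices

/-! ### Motion of the solid -/

lemma solidAt_eq_preimage (B : Set E3) (h : ℝ) : solidAt B h = (fun x => x - h • e3) ⁻¹' B := rfl

lemma volume_solidAt (B : Set E3) (h : ℝ) : volume (solidAt B h) = volume B := by
  rw [solidAt_eq_preimage]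
  simp only [sub_eq_add_neg]
  exact measure_preimage_add_right volume (-(h • e3)) B

lemma isClosed_solidAt {B : Set E3} (hB : IsClosed B) (h : ℝ) : IsClosed (solidAt B h) :=
  hB.preimage (by fun_prop : Continuous fun x : E3 => x - h • e3)

lemma cross_smul_e3_apply_two (r : ℝ) (y : E3) : (cross (r • e3) y) 2 = 0 := by
  simp [cross, crossProduct, e3, stdVec]

/-- The kinetic energy of the solid controls its vertical speed: a rotation about the vertical axis
does not affect the vertical component of the velocity. -/
lemma mass_mul_speed_sq_le {Ω B : Set E3} {ρs K h v r : ℝ} {ρ : E3 → ℝ} {u : E3 → E3} (hK : 0 ≤ K)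
    (hB : IsCompact B) (hρs : 0 ≤ ρs) (hsub : solidAt B h ⊆ Ω)
    (hρ : ∀ᵐ x ∂volume.restrict (solidAt B h), ρ x = ρs)
    (hu : ∀ᵐ x ∂volume.restrict (solidAt B h),
      u x = v • e3 + cross (r • e3) (x - centerOfMass B h))
    (hkin : ∫⁻ x in Ω, ENNReal.ofReal (ρ x * ‖u x‖ ^ 2) ≤ ENNReal.ofReal K) :
    ρs * volume.real B * v ^ 2 ≤ K := by
  have h1 : ∫⁻ _ in solidAt B h, ENNReal.ofReal (ρs * v ^ 2) ≤ ENNReal.ofReal K := by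
    refine le_trans ?_ ((lintegral_mono_set hsub).trans hkin)
    refine lintegral_mono_ae ?_
    filter_upwards [hρ, hu] with x h1 h2
    refine ENNReal.ofReal_le_ofReal ?_
    rw [h1]
    refine mul_le_mul_of_nonneg_left ?_ hρs
    have h3 := abs_coord_le_norm (u x) 2
    have h4 : (u x) 2 = v := by
      rw [h2, PiLp.add_apply, cross_smul_e3_apply_two]
      simp [e3, stdVec]
    rw [h4] at h3
    rw [← sq_abs v]
    exact pow_le_pow_left₀ (abs_nonneg _) h3 2
  rw [setLIntegral_const, volume_solidAt, ← ENNReal.ofReal_toReal hB.measure_lt_top.ne,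
    ← ENNReal.ofReal_mul (by positivity), ENNReal.ofReal_le_ofReal_iff hK] at h1
  rw [measureReal_def]
  linarith

/-- A smooth approximation of a Lipschitz function with the same Lipschitz constant. -/
lemma exists_smooth_approx {f : ℝ → ℝ} {L ε : ℝ} (hε : 0 < ε) (hL : 0 ≤ L)
    (hf : ∀ s t, |f s - f t| ≤ L * |s - t|) :
    ∃ k : ℝ → ℝ, ContDiff ℝ 1 k ∧ (∀ t, |k t - f t| ≤ ε) ∧ ∀ t, |deriv k t| ≤ L := by
  have hlip : LipschitzWith ⟨L, hL⟩ f := LipschitzWith.of_dist_le_mul fun s t => by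
    rw [Real.dist_eq, Real.dist_eq]; exact hf s t
  have hfc : Continuous f := hlip.continuous
  set δ : ℝ := ε / (L + 1) with hδ
  have hδ0 : 0 < δ := by positivity
  let b : ContDiffBump (0 : ℝ) :=
    { rIn := δ / 2, rOut := δ, rIn_pos := by positivity, rIn_lt_rOut := by linarith }
  set k : ℝ → ℝ := convolution (b.normed volume) f (ContinuousLinearMap.lsmul ℝ ℝ) volume with hk
  have hint : ∀ x, Integrable fun t => b.normed volume t * f (x - t) := fun x => by
    refine Continuous.integrable_of_hasCompactSupport ?_ b.hasCompactSupport_normed.mul_right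
    exact b.continuous_normed.mul (hfc.comp (continuous_const.sub continuous_id))
  have hkx : ∀ x, k x = ∫ t, b.normed volume t * f (x - t) := fun x => rfl
  refine ⟨k, ?_, fun t => ?_, fun t => ?_⟩
  · exact b.hasCompactSupport_normed.contDiff_convolution_left _ b.contDiff_normed
      hfc.locallyIntegrable
  · have := ContDiffBump.dist_normed_convolution_le (φ := b) (μ := volume) (g := f) (x₀ := t)
      (ε := ε) hfc.aestronglyMeasurable (fun x hx => by
        rw [Real.dist_eq]
        refine (hf x t).trans ?_
        have h1 : |x - t| < δ := by rw [← Real.dist_eq]; exact hx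
        calc L * |x - t| ≤ (L + 1) * δ :=
              mul_le_mul (by linarith) h1.le (abs_nonneg _) (by linarith)
          _ = ε := by rw [hδ]; field_simp)
    rwa [Real.dist_eq] at this
  · have hkl : LipschitzWith ⟨L, hL⟩ k := LipschitzWith.of_dist_le_mul fun s t => by
      rw [Real.dist_eq, Real.dist_eq, hkx, hkx, ← integral_sub (hint s) (hint t),
        ← Real.norm_eq_abs]
      have hb1 := b.integral_normed (μ := (volume : Measure ℝ))
      calc ‖∫ r, (b.normed volume r * f (s - r) - b.normed volume r * f (t - r))‖
          ≤ ∫ r, b.normed volume r * (L * |s - t|) := by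
            refine norm_integral_le_of_norm_le
              ((b.continuous_normed.integrable_of_hasCompactSupport
                b.hasCompactSupport_normed).mul_const _) (Eventually.of_forall fun r => ?_)
            rw [← mul_sub, norm_mul, Real.norm_of_nonneg (b.nonneg_normed r)]
            refine mul_le_mul_of_nonneg_left ?_ (b.nonneg_normed r)
            have := hf (s - r) (t - r)
            rwa [sub_sub_sub_cancel_right] at this
        _ = L * |s - t| := by rw [integral_mul_const, hb1, one_mul]
    have := norm_deriv_le_of_lipschitz (x₀ := t) hkl
    exact this

/-- A cutoff in time that decreases on `[0,T₂]`, so that its variation there is at most one however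
small `T₂ - T₁` is. -/
lemma exists_time_cutoff {T₁ T₂ : ℝ} (h0 : 0 < T₁) (h12 : T₁ < T₂) : ∃ ζ : ℝ → ℝ, ContDiff ℝ 1 ζ ∧
    (∀ t, 0 ≤ ζ t ∧ ζ t ≤ 1) ∧ (∀ t, 0 ≤ t → t ≤ T₁ → ζ t = 1) ∧ (∀ t, t ≤ -1 → ζ t = 0) ∧
    (∀ t, T₂ ≤ t → ζ t = 0) ∧ ∫⁻ t in Ioo 0 T₂, ‖deriv ζ t‖ₑ ≤ 1 := by
  have hd : 0 < T₂ - T₁ := by linarith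
  set σ : ℝ → ℝ := fun t => Real.smoothTransition ((T₂ - t) / (T₂ - T₁)) with hσ
  set ζ : ℝ → ℝ := fun t => Real.smoothTransition (1 + t) * σ t with hζ
  have cσ : ContDiff ℝ 1 σ := (Real.smoothTransition.contDiff (n := 1)).comp (by fun_prop)
  have cζ : ContDiff ℝ 1 ζ :=
    ((Real.smoothTransition.contDiff (n := 1)).comp (by fun_prop)).mul cσ
  have hm : Antitone σ := fun s t hst => by
    refine Real.smoothTransition.monotone ?_
    exact div_le_div_of_nonneg_right (by linarith) hd.le
  have heq : ∀ t, 0 ≤ t → ζ t = σ t := fun t ht => by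
    simp only [hζ]
    rw [Real.smoothTransition.one_of_one_le (by linarith), one_mul]
  have hder : ∀ t, 0 < t → deriv ζ t = deriv σ t := fun t ht => by
    refine Filter.EventuallyEq.deriv_eq ?_
    filter_upwards [lt_mem_nhds ht] with s hs using heq s hs.le
  refine ⟨ζ, cζ, fun t => ⟨?_, ?_⟩, fun t ht ht1 => ?_, fun t ht => ?_, fun t ht => ?_, ?_⟩
  · exact mul_nonneg (Real.smoothTransition.nonneg _) (Real.smoothTransition.nonneg _)
  · exact mul_le_one₀ (Real.smoothTransition.le_one _) (Real.smoothTransition.nonneg _)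
      (Real.smoothTransition.le_one _)
  · rw [heq t ht]
    exact Real.smoothTransition.one_of_one_le (by rw [le_div_iff₀ hd]; linarith)
  · simp only [hζ]
    rw [Real.smoothTransition.zero_of_nonpos (by linarith), zero_mul]
  · simp only [hζ, hσ]
    rw [Real.smoothTransition.zero_of_nonpos (x := (T₂ - t) / (T₂ - T₁))
      (div_nonpos_of_nonpos_of_nonneg (by linarith) hd.le), mul_zero]
  · have hneg : ∀ t ∈ Ioo (0 : ℝ) T₂, ‖deriv ζ t‖ₑ = ENNReal.ofReal (-deriv ζ t) := fun t ht => by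
      have : deriv ζ t ≤ 0 := by rw [hder t ht.1]; exact hm.deriv_nonpos
      rw [Real.enorm_eq_ofReal_abs, abs_of_nonpos this]
    have hc : Continuous (deriv ζ) := cζ.continuous_deriv le_rfl
    rw [setLIntegral_congr_fun measurableSet_Ioo hneg, ← ofReal_integral_eq_lintegral_ofReal]
    · rw [integral_neg, ← integral_Ioc_eq_integral_Ioo,
        ← intervalIntegral.integral_of_le (by linarith),
        intervalIntegral.integral_deriv_eq_sub
          (fun t _ => (cζ.differentiable one_ne_zero) t) (hc.intervalIntegrable _ _)]
      rw [heq 0 le_rfl, heq T₂ (by linarith)]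
      refine ENNReal.ofReal_le_one.2 ?_
      have a1 : σ 0 ≤ 1 := Real.smoothTransition.le_one _
      have a2 : 0 ≤ σ T₂ := Real.smoothTransition.nonneg _
      linarith
    · exact (hc.integrableOn_Icc.mono_set Ioo_subset_Icc_self).neg
    · refine (ae_restrict_iff' measurableSet_Ioo).2 (Eventually.of_forall fun t ht => ?_)
      have : deriv ζ t ≤ 0 := by rw [hder t ht.1]; exact hm.deriv_nonpos
      simpa using this

/-- The height is Lipschitz if the speed is bounded. -/
lemma abs_height_sub_le {h v : ℝ → ℝ} {T T₂ h₀ L : ℝ} (hT : T₂ < T) (hv : IntegrableOn v (Ioo 0 T))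
    (hh : ∀ t ∈ Ico 0 T, h t = h₀ + ∫ τ in (0 : ℝ)..t, v τ)
    (hL : ∀ᵐ t ∂volume.restrict (Ioo 0 T₂), |v t| ≤ L) {s t : ℝ} (hs : s ∈ Icc 0 T₂)
    (ht : t ∈ Icc 0 T₂) : |h s - h t| ≤ L * |s - t| := by
  have hint : ∀ r ∈ Icc 0 T₂, IntervalIntegrable v volume 0 r := fun r hr => by
    rw [intervalIntegrable_iff_integrableOn_Ioo_of_le hr.1]
    exact hv.mono_set (Ioo_subset_Ioo le_rfl (hr.2.trans hT.le))
  have e : h s - h t = ∫ τ in t..s, v τ := by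
    rw [hh s ⟨hs.1, hs.2.trans_lt hT⟩, hh t ⟨ht.1, ht.2.trans_lt hT⟩, add_sub_add_left_eq_sub,
      intervalIntegral.integral_interval_sub_left (hint s hs) (hint t ht)]
  rw [e, ← Real.norm_eq_abs]
  refine intervalIntegral.norm_integral_le_of_norm_le_const_ae ?_
  have h1 : ∀ᵐ τ, τ ∈ Ioo 0 T₂ → |v τ| ≤ L := (ae_restrict_iff' measurableSet_Ioo).1 hL
  have h2 : ∀ᵐ τ : ℝ, τ ≠ T₂ := by simp [ae_iff]
  filter_upwards [h1, h2] with τ h1 h2 hτ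
  refine h1 ⟨?_, ?_⟩
  · rcases le_total t s with hts | hts
    · rw [uIoc_of_le hts] at hτ; exact ht.1.trans_lt hτ.1
    · rw [uIoc_of_ge hts] at hτ; exact hs.1.trans_lt hτ.1
  · refine lt_of_le_of_ne ?_ h2
    rcases le_total t s with hts | hts
    · rw [uIoc_of_le hts] at hτ; exact hτ.2.trans hs.2
    · rw [uIoc_of_ge hts] at hτ; exact hτ.2.trans ht.2

/-! ### The test field near the body and away from it -/

lemma continuous_barrier {α c : ℝ} (hα : 0 < α) : Continuous (barrier α c) := by
  unfold barrier
  refine continuous_const.mul (continuous_fst.add (Continuous.rpow_const (by fun_prop) fun y => ?_))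
  right; linarith

/-- A smooth cutoff of a neighbourhood of the body. -/
lemma exists_body_cutoff {B : Set E3} (hB : IsCompact B) (hne : B.Nonempty) {ε : ℝ} (hε : 0 < ε) :
    ∃ η : E3 → ℝ, ContDiff ℝ 2 η ∧ HasCompactSupport η ∧
      (∀ x, Metric.infDist x B ≤ ε / 4 → η x = 1) ∧ ∀ x, ε / 2 ≤ Metric.infDist x B → η x = 0 := by
  have hc : Continuous fun x => Metric.infDist x B := Metric.continuous_infDist_pt B
  obtain ⟨f, hf, -, h0, h1⟩ := exists_contMDiff_zero_iff_one_iff_of_isClosed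
    (modelWithCornersSelf ℝ E3) (n := 2) (isClosed_le continuous_const hc : IsClosed {x | ε / 2 ≤ Metric.infDist x B})
    (isClosed_le hc continuous_const : IsClosed {x | Metric.infDist x B ≤ ε / 4})
    (Set.disjoint_left.2 fun x hx hx' => by
      have a1 : ε / 2 ≤ Metric.infDist x B := hx
      have a2 : Metric.infDist x B ≤ ε / 4 := hx'
      linarith)
  refine ⟨f, hf.contDiff, ?_, fun x hx => (h1 x).1 hx, fun x hx => (h0 x).1 hx⟩
  refine HasCompactSupport.intro (hB.cthickening (r := ε / 2)) fun x hx => (h0 x).1 ?_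
  by_contra hcon
  refine hx ?_
  have : Metric.infDist x B < ε / 2 := not_le.1 hcon
  obtain ⟨y, hy, hxy⟩ := (Metric.infDist_lt_iff hne).1 this
  exact Metric.mem_cthickening_of_dist_le x y _ _ hy hxy.le

section Potential

variable {η χ : E3 → ℝ} {α c h : ℝ} {x : E3}

/-- The potential vanishes away from the body. -/
lemma potential_eventually_zero_of_far {B : Set E3} {ε : ℝ}
    (hη : ∀ x, ε / 2 ≤ Metric.infDist x B → η x = 0)
    (hx : ε / 2 < Metric.infDist (x - h • e3) B) :
    ∀ᶠ z in 𝓝 (h, x), potential η χ α c z = 0 := by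
  have hc : Continuous fun z : ℝ × E3 => Metric.infDist (z.2 - z.1 • e3) B :=
    (Metric.continuous_infDist_pt B).comp (by fun_prop)
  filter_upwards [(isOpen_lt continuous_const hc).mem_nhds (show (h, x) ∈ {z : ℝ × E3 |
    ε / 2 < Metric.infDist (z.2 - z.1 • e3) B} from hx)] with z hz
  rw [potential, hη _ (le_of_lt hz), zero_mul]

/-- The potential vanishes in a layer at the floor below the tip of the body. -/
lemma potential_eventually_zero_at_floor {a : ℝ} (hα : 0 < α) (hc : 0 < c) (hh : 0 < h)
    (hχ : ∀ x : E3, ‖x‖ ≤ a → χ x = 1) (hxa : ‖x‖ < a) (hx : x 2 < barrier α c (h, x) / 4) :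
    ∀ᶠ z in 𝓝 (h, x), potential η χ α c z = 0 := by
  have c1 : Continuous fun z : ℝ × E3 => ‖z.2‖ := by fun_prop
  have c2 : Continuous fun z : ℝ × E3 => z.2 2 := by fun_prop
  have c3 : Continuous fun z : ℝ × E3 => barrier α c z / 4 := (continuous_barrier hα).div_const _
  filter_upwards [(isOpen_lt c1 continuous_const).mem_nhds (show (h, x) ∈ {z : ℝ × E3 | _} from hxa),
    (isOpen_lt c2 c3).mem_nhds (show (h, x) ∈ {z : ℝ × E3 | _} from hx),
    (isOpen_lt continuous_const continuous_fst).mem_nhds (show (h, x) ∈ {z : ℝ × E3 | _} from hh)]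
    with z h1 h2 h3
  have hp : 0 < barrier α c z := barrier_pos hc h3 z.2
  have h2' : z.2 2 < barrier α c z / 4 := h2
  rw [potential, hχ _ (le_of_lt h1), ramp_eq_zero (by rw [div_le_iff₀ hp]; linarith)]
  ring

/-- Near the body, above the layer at the floor, the potential is one. -/
lemma potential_eventually_one {B : Set E3} {ε : ℝ} (hα : 0 < α) (hc : 0 < c) (hh : 0 < h)
    (hη : ∀ x, Metric.infDist x B ≤ ε / 4 → η x = 1)
    (hx : Metric.infDist (x - h • e3) B < ε / 4)
    (hxχ : x ∈ tsupport χ → 3 * barrier α c (h, x) / 4 < x 2) :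
    ∀ᶠ z in 𝓝 (h, x), potential η χ α c z = 1 := by
  have hcd : Continuous fun z : ℝ × E3 => Metric.infDist (z.2 - z.1 • e3) B :=
    (Metric.continuous_infDist_pt B).comp (by fun_prop)
  have near := (isOpen_lt hcd continuous_const).mem_nhds (show (h, x) ∈ {z : ℝ × E3 |
    Metric.infDist (z.2 - z.1 • e3) B < ε / 4} from hx)
  by_cases hxs : x ∈ tsupport χ
  · have c2 : Continuous fun z : ℝ × E3 => z.2 2 := by fun_prop
    have c3 : Continuous fun z : ℝ × E3 => 3 * barrier α c z / 4 :=
      (continuous_const.mul (continuous_barrier hα)).div_const _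
    filter_upwards [near,
      (isOpen_lt c3 c2).mem_nhds (show (h, x) ∈ {z : ℝ × E3 | _} from hxχ hxs),
      (isOpen_lt continuous_const continuous_fst).mem_nhds
        (show (h, x) ∈ {z : ℝ × E3 | _} from hh)] with z h1 h2 h3
    have hp : 0 < barrier α c z := barrier_pos hc h3 z.2
    have h2' : 3 * barrier α c z / 4 < z.2 2 := h2
    rw [potential, hη _ (le_of_lt h1), ramp_eq_one (by rw [le_div_iff₀ hp]; linarith)]
    ring
  · have : ∀ᶠ y in 𝓝 x, χ y = 0 := by
      filter_upwards [(isClosed_tsupport χ).isOpen_compl.mem_nhds hxs] with y hy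
      exact image_eq_zero_of_notMem_tsupport hy
    filter_upwards [near, continuous_snd.continuousAt.eventually this] with z h1 h2
    rw [potential, hη _ (le_of_lt h1), h2]
    ring

end Potential

section Field

variable {ζ k : ℝ → ℝ} {Ψ : ℝ × E3 → ℝ}

/-- The field of the potential `Ψ (k t, ·)`, times a cutoff `ζ` in time. -/
noncomputable def movingField (ζ k : ℝ → ℝ) (Ψ : ℝ × E3 → ℝ) (p : ℝ × E3) : E3 :=
  ζ p.1 • liftField Ψ (k p.1, p.2)

lemma fderiv_movingField_apply (hζ : ContDiff ℝ 1 ζ) (hk : ContDiff ℝ 1 k) {p : ℝ × E3}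
    (hΨ : ContDiffAt ℝ 2 Ψ (k p.1, p.2)) (v : ℝ × E3) :
    fderiv ℝ (movingField ζ k Ψ) p v
      = ζ p.1 • fderiv ℝ (liftField Ψ) (k p.1, p.2) (deriv k p.1 * v.1, v.2)
        + (deriv ζ p.1 * v.1) • liftField Ψ (k p.1, p.2) := by
  have hdζ : HasFDerivAt (fun q : ℝ × E3 => ζ q.1)
      (deriv ζ p.1 • ContinuousLinearMap.fst ℝ ℝ E3) p :=
    ((hζ.differentiable one_ne_zero p.1).hasDerivAt).comp_hasFDerivAt p hasFDerivAt_fst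
  have hdk : HasFDerivAt (fun q : ℝ × E3 => k q.1)
      (deriv k p.1 • ContinuousLinearMap.fst ℝ ℝ E3) p :=
    ((hk.differentiable one_ne_zero p.1).hasDerivAt).comp_hasFDerivAt p hasFDerivAt_fst
  have hW : HasFDerivAt (fun q : ℝ × E3 => liftField Ψ (k q.1, q.2)) _ p :=
    (((contDiffAt_liftField hΨ).differentiableAt one_ne_zero).hasFDerivAt).comp
      (f := fun q : ℝ × E3 => (k q.1, q.2)) p (hdk.prodMk hasFDerivAt_snd)
  have : HasFDerivAt (movingField ζ k Ψ) _ p := hdζ.smul hW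
  rw [this.fderiv]
  rfl

lemma contDiff_movingField (hζ : ContDiff ℝ 1 ζ) (hk : ContDiff ℝ 1 k)
    (hΨ : ∀ p : ℝ × E3, ContDiffAt ℝ 2 Ψ (k p.1, p.2)) : ContDiff ℝ 1 (movingField ζ k Ψ) := by
  refine contDiff_iff_contDiffAt.2 fun p => ?_
  refine (hζ.comp contDiff_fst).contDiffAt.smul ?_
  exact (contDiffAt_liftField (hΨ p)).comp (f := fun q : ℝ × E3 => (k q.1, q.2)) p
    ((hk.comp contDiff_fst).prodMk contDiff_snd).contDiffAt

lemma dt_movingField (hζ : ContDiff ℝ 1 ζ) (hk : ContDiff ℝ 1 k) {p : ℝ × E3}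
    (hΨ : ContDiffAt ℝ 2 Ψ (k p.1, p.2)) :
    dt (movingField ζ k Ψ) p = (ζ p.1 * deriv k p.1) • fderiv ℝ (liftField Ψ) (k p.1, p.2) (1, 0)
      + deriv ζ p.1 • liftField Ψ (k p.1, p.2) := by
  rw [dt, fderiv_movingField_apply hζ hk hΨ]
  simp only [mul_one]
  have : ((deriv k p.1, 0) : ℝ × E3) = deriv k p.1 • ((1, 0) : ℝ × E3) := by simp
  rw [this, map_smul, smul_smul]

lemma gradMat_movingField (hζ : ContDiff ℝ 1 ζ) (hk : ContDiff ℝ 1 k) {p : ℝ × E3}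
    (hΨ : ContDiffAt ℝ 2 Ψ (k p.1, p.2)) (i j : Fin 3) :
    gradMat (movingField ζ k Ψ) p i j
      = ζ p.1 * (fderiv ℝ (liftField Ψ) (k p.1, p.2) (0, stdVec j)) i := by
  rw [gradMat, Matrix.of_apply, dx, fderiv_movingField_apply hζ hk hΨ]
  simp

lemma trace_gradMat_movingField (hζ : ContDiff ℝ 1 ζ) (hk : ContDiff ℝ 1 k) {p : ℝ × E3}
    (hΨ : ContDiffAt ℝ 2 Ψ (k p.1, p.2)) : (gradMat (movingField ζ k Ψ) p).trace = 0 := by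
  rw [Matrix.trace]
  simp only [Matrix.diag_apply, gradMat_movingField hζ hk hΨ]
  rw [← Finset.mul_sum, liftField_div hΨ, mul_zero]

/-- Where the potential is constant, the field is a vertical translation. -/
lemma movingField_of_eventually_const (hζ : ContDiff ℝ 1 ζ) (hk : ContDiff ℝ 1 k) {p : ℝ × E3}
    {r : ℝ} (hΨ : ∀ᶠ z in 𝓝 (k p.1, p.2), Ψ z = r) :
    movingField ζ k Ψ p = ζ p.1 • r • e3 ∧ gradMat (movingField ζ k Ψ) p = 0 ∧
      dt (movingField ζ k Ψ) p = deriv ζ p.1 • r • e3 := by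
  have hs : ContDiffAt ℝ 2 Ψ (k p.1, p.2) :=
    (contDiffAt_const (c := r)).congr_of_eventuallyEq hΨ
  have hW := liftField_eq_of_eventually_const hΨ
  have hW' : liftField Ψ =ᶠ[𝓝 (k p.1, p.2)] fun _ => r • e3 := by
    filter_upwards [eventually_eventually_nhds.2 hΨ] with z hz
    exact liftField_eq_of_eventually_const hz
  have hd : fderiv ℝ (liftField Ψ) (k p.1, p.2) = 0 := by
    rw [hW'.fderiv_eq]; simp
  refine ⟨by rw [movingField, hW], ?_, ?_⟩
  · ext i j
    rw [gradMat_movingField hζ hk hs, hd]; simp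
  · rw [dt_movingField hζ hk hs, hd, hW]; simp

end Field

/-! ### Fields adapted to a motion -/

/-- A test field `φ` on `(0,T₂)` adapted to the motion of the body with height `h`: solenoidal, equal
to `ζ(t) e₃` in the body, and controlled by the weight `G`; `w` bounds `|φ|`, and `L` is a bound of
the speed of the body. -/
structure IsAdaptedField (Ω B : Set E3) (h : ℝ → ℝ) (T T₁ T₂ L C : ℝ) (G : E3 → ℝ)
    (φ : ℝ × E3 → E3) (ζ : ℝ → ℝ) (w : ℝ × E3 → ℝ) : Prop where
  test : IsTest Ω T φ
  rigid : IsRigidNearSolid B h T φ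
  cutoff_cont : Continuous ζ
  cutoff_nonneg : ∀ t, 0 ≤ ζ t
  cutoff_one : ∀ t, 0 ≤ t → t ≤ T₁ → ζ t = 1
  cutoff_variation : ∫⁻ t in Ioo 0 T₂, ‖deriv ζ t‖ₑ ≤ 1
  late : ∀ t x, T₂ < t → φ (t, x) = 0 ∧ fderiv ℝ φ (t, x) = 0
  solenoidal : ∀ p, (gradMat φ p).trace = 0
  solid : ∀ t ∈ Icc 0 T₂, ∀ x ∈ solidAt B (h t),
    φ (t, x) = ζ t • e3 ∧ gradMat φ (t, x) = 0 ∧ dt φ (t, x) = deriv ζ t • e3 ∧ w (t, x) = 1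
  weight_nonneg : ∀ p, 0 ≤ w p
  norm_le_weight : ∀ p, ‖φ p‖ ≤ w p
  weight_le : ∀ t ∈ Icc 0 T₂, ∀ x ∈ Ω, w (t, x) ≤ C * G x
  weight_cube_le : ∀ t ∈ Icc 0 T₂, ∀ x ∈ Ω, w (t, x) ^ 3 ≤ C * G x
  grad_le : ∀ t ∈ Icc 0 T₂, ∀ x ∈ Ω, ∀ i j, |gradMat φ (t, x) i j| ≤ C * G x
  dt_le : ∀ t ∈ Icc 0 T₂, ∀ x ∈ Ω, ‖dt φ (t, x)‖ ≤ |deriv ζ t| * w (t, x) + L * (C * G x)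

section
variable {Ω B : Set E3} {α r₀ : ℝ}

lemma CollisionGeometry.exists_flat_ball (hg : CollisionGeometry Ω B α r₀) : ∃ a > 0, a ≤ 2 * r₀ ∧
    ∀ x : E3, ‖x‖ < a → (x ∈ Ω ↔ 0 < x 2) := by
  obtain ⟨l, hl, hfl⟩ := hg.flat_floor
  have hr := hg.r₀_pos
  refine ⟨min (2 * r₀) l, by positivity, min_le_left _ _, fun x hx => hfl x ?_ ?_ ?_⟩
  · exact (abs_coord_le_norm x 0).trans (hx.le.trans (min_le_left _ _))
  · exact (abs_coord_le_norm x 1).trans (hx.le.trans (min_le_left _ _))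
  · exact (abs_coord_le_norm x 2).trans_lt (hx.trans_le (min_le_right _ _))

/-- The container is bounded, hence so are the possible heights of the body. -/
lemma CollisionGeometry.exists_height_bound (hg : CollisionGeometry Ω B α r₀) :
    ∃ N : ℝ, 0 < N ∧ ∀ h, solidAt B h ⊆ closure Ω → h ≤ N := by
  obtain ⟨P, hP⟩ := hg.container.isBounded.closure.exists_norm_le
  obtain ⟨y, hy⟩ := hg.interior_body_nonempty
  refine ⟨|P| + ‖y‖ + 1, by positivity, fun h hh => ?_⟩
  have h1 : y + h • e3 ∈ solidAt B h := by
    change y + h • e3 - h • e3 ∈ B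
    rw [add_sub_cancel_right]; exact interior_subset hy
  have h2 := hP _ (hh h1)
  have h3 : ‖h • e3‖ ≤ ‖y + h • e3‖ + ‖y‖ := by
    have := norm_sub_le (y + h • e3) y
    rwa [add_sub_cancel_left] at this
  rw [norm_smul, norm_e3, mul_one, Real.norm_eq_abs] at h3
  linarith [le_abs_self h, le_abs_self P]

set_option maxHeartbeats 1000000 in
/-- Adapted fields exist, with constants that do not depend on the motion as long as the body does
not touch the container. The potential follows a smooth approximation of the height, so close to it
that the field is still a translation near the body at its true position. -/
lemma CollisionGeometry.exists_adaptedField (hg : CollisionGeometry Ω B α r₀) (hα : 0 < α)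
    (hα1 : α < 1) {d₀ : ℝ} (hd₀ : 0 < d₀) :
    ∃ a b R C : ℝ, 0 < a ∧ R < a / 2 ∧ R ≤ 1 ∧ 0 ≤ b ∧ 0 < C ∧
      (∀ x : E3, ‖x‖ < a → (x ∈ Ω ↔ 0 < x 2)) ∧
      ∀ (h : ℝ → ℝ) (T T₁ T₂ L : ℝ), 0 < T₁ → T₁ < T₂ → T₂ < T → 0 ≤ L →
        (∀ s ∈ Icc 0 T₂, ∀ t ∈ Icc 0 T₂, |h s - h t| ≤ L * |s - t|) →
        (∀ t ∈ Icc 0 T₂, 0 < h t) → (∀ t ∈ Icc 0 T₂, solidAt B (h t) ⊆ closure Ω) →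
        (∀ t ∈ Icc 0 T₂, ∀ x ∈ solidAt B (h t), ∀ y ∈ frontier Ω \ floorSquare r₀, d₀ ≤ dist x y) →
        ∃ φ ζ w, IsAdaptedField Ω B h T T₁ T₂ L C (fun x => 1 + cusp α b R x) φ ζ w := by
  obtain ⟨a, ha, har, hfl⟩ := hg.exists_flat_ball
  obtain ⟨N₀, hN₀, hN⟩ := hg.exists_height_bound
  set N := N₀ + 1 with hNdef
  have hN0 : 0 < N := by linarith
  set R : ℝ := min (a / 4) 1 with hR
  have hR0 : 0 < R := by positivity
  have hRa : R ≤ a / 4 := min_le_left _ _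
  have hR1 : R ≤ 1 := min_le_right _ _
  have hBc := hg.isCompact_body
  have hBne : B.Nonempty := hg.interior_body_nonempty.mono interior_subset
  obtain ⟨ε, hε, hnear⟩ := hg.exists_near_origin hd₀ hα (half_pos hR0)
  obtain ⟨η, hη2, hηc, hη1, hη0⟩ := exists_body_cutoff hBc hBne hε
  let χ : ContDiffBump (0 : E3) :=
    { rIn := R / 2, rOut := R, rIn_pos := half_pos hR0, rIn_lt_rOut := half_lt_self hR0 }
  have hχ2 : ContDiff ℝ 2 χ := χ.contDiff
  have hχs : tsupport χ ⊆ Metric.closedBall 0 R := χ.tsupport_eq.le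
  have hχ1 : ∀ x : E3, ‖x‖ ≤ R / 2 → χ x = 1 := fun x hx =>
    χ.one_of_mem_closedBall (by rw [mem_closedBall_zero_iff]; exact hx)
  set c : ℝ := 1 / (6 * (1 + N)) with hc
  have hc0 : 0 < c := by positivity
  have hcN : c * (6 * (1 + N)) ≤ 1 := le_of_eq (one_div_mul_cancel (by positivity))
  obtain ⟨P, hP⟩ := hg.container.isBounded.exists_norm_le
  obtain ⟨b, C, hb, hC, hbd⟩ := exists_liftField_bounds hη2 hηc hχ2 hR1 hχs hN0 hα hα1 hc0 hcN P
  obtain ⟨C2, -, hsm⟩ := exists_jetBound_potential_layer hη2 hηc hχ2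
    (hχs.trans (Metric.closedBall_subset_closedBall hR1)) hN0 hα hα1 hc0 hcN
  obtain ⟨C3, -, hsm'⟩ := exists_jetBound_potential_off hη2 hηc hχ2
    (hχs.trans (Metric.closedBall_subset_closedBall hR1)) hN0 hα hα1 hc0 hcN
  have hΨ : ∀ r, 0 < r → r ≤ N → ∀ x : E3, ContDiffAt ℝ 2 (potential η χ α c) (r, x) :=
    fun r hr hrN x => by
      by_cases hx : x ∈ layer χ α c r
      · exact (hsm r hr hrN x hx).smooth
      · exact (hsm' r hr hrN x hx).smooth
  set Ψ := potential η χ α c with hΨdef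
  refine ⟨a, b, R, 3 * C, ha, by linarith, hR1, hb, by positivity, hfl, ?_⟩
  intro h T T₁ T₂ L hT₁ hT₁₂ hT₂ hL hlip hpos hsub hdist
  have hT20 : 0 ≤ T₂ := by linarith
  -- the height, frozen outside `[0,T₂]`, and a smooth approximation
  set cl : ℝ → ℝ := fun t => (projIcc 0 T₂ hT20 t : ℝ) with hcl
  have hclm : ∀ t, cl t ∈ Icc 0 T₂ := fun t => (projIcc 0 T₂ hT20 t).2
  have hcl' : ∀ t ∈ Icc 0 T₂, cl t = t := fun t ht => by
    simp only [hcl, projIcc_of_mem hT20 ht]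
  have hcll : ∀ s t, |cl s - cl t| ≤ |s - t| := fun s t => by
    have := (LipschitzWith.projIcc hT20).dist_le_mul s t
    rwa [NNReal.coe_one, one_mul, Subtype.dist_eq, Real.dist_eq, Real.dist_eq] at this
  set hc' : ℝ → ℝ := fun t => h (cl t) with hhc
  have hlip' : ∀ s t, |hc' s - hc' t| ≤ L * |s - t| := fun s t =>
    (hlip _ (hclm s) _ (hclm t)).trans (mul_le_mul_of_nonneg_left (hcll s t) hL)
  have hcont : ContinuousOn h (Icc 0 T₂) := by
    have : LipschitzOnWith ⟨L, hL⟩ h (Icc 0 T₂) := LipschitzOnWith.of_dist_le_mul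
      fun s hs t ht => by rw [Real.dist_eq, Real.dist_eq]; exact hlip s hs t ht
    exact this.continuousOn
  obtain ⟨t₀, ht₀, hmin⟩ := isCompact_Icc.exists_isMinOn (nonempty_Icc.2 hT20) hcont
  have hm0 := hpos t₀ ht₀
  set δ : ℝ := min (min (h t₀ / 2) (ε / 8)) 1 with hδ
  have hδ0 : 0 < δ := by positivity
  have hδ1 : δ ≤ h t₀ / 2 := (min_le_left _ _).trans (min_le_left _ _)
  have hδ2 : δ ≤ ε / 8 := (min_le_left _ _).trans (min_le_right _ _)
  have hδ3 : δ ≤ 1 := min_le_right _ _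
  obtain ⟨k, hk, hkh, hkd⟩ := exists_smooth_approx hδ0 hL hlip'
  have hmin' : ∀ t, h t₀ ≤ hc' t := fun t => hmin (hclm t)
  have hk0 : ∀ t, 0 < k t := fun t => by
    have h1 := (abs_le.1 (hkh t)).1
    have h2 := hmin' t
    linarith
  have hk2 : ∀ t, k t ≤ 2 * hc' t := fun t => by
    have h1 := (abs_le.1 (hkh t)).2
    have h2 := hmin' t
    linarith
  have hkN : ∀ t, k t ≤ N := fun t => by
    have h1 := (abs_le.1 (hkh t)).2
    have h2 := hN _ (hsub _ (hclm t))
    linarith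
  obtain ⟨ζ, hζ, hζ01, hζ1, hζm, hζT, hζv⟩ := exists_time_cutoff hT₁ hT₁₂
  have hΨk : ∀ p : ℝ × E3, ContDiffAt ℝ 2 Ψ (k p.1, p.2) := fun p => hΨ _ (hk0 _) (hkN _) _
  set φ := movingField ζ k Ψ with hφ
  set w : ℝ × E3 → ℝ := fun p => ‖liftField Ψ (k p.1, p.2)‖ with hw
  have hφ1 : ContDiff ℝ 1 φ := contDiff_movingField hζ hk hΨk
  -- the support of the field
  set S : Set (ℝ × E3) := {p | (-1 ≤ p.1 ∧ p.1 ≤ T₂) ∧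
    Metric.infDist (p.2 - k p.1 • e3) B ≤ ε / 2 ∧
      (R / 2 ≤ ‖p.2‖ ∨ barrier α c (k p.1, p.2) / 4 ≤ p.2 2)} with hS
  have hkc : Continuous k := hk.continuous
  have hkc1 : Continuous fun p : ℝ × E3 => k p.1 := hkc.comp continuous_fst
  have hSc : IsClosed S := by
    have c1 : Continuous fun p : ℝ × E3 => Metric.infDist (p.2 - k p.1 • e3) B :=
      (Metric.continuous_infDist_pt B).comp (continuous_snd.sub (hkc1.smul continuous_const))
    have c2 : Continuous fun p : ℝ × E3 => barrier α c (k p.1, p.2) / 4 :=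
      ((continuous_barrier hα).comp (hkc1.prodMk continuous_snd)).div_const _
    have c3 : Continuous fun p : ℝ × E3 => p.2 2 := by fun_prop
    have c4 : Continuous fun p : ℝ × E3 => ‖p.2‖ := by fun_prop
    exact ((isClosed_le continuous_const continuous_fst).inter
      (isClosed_le continuous_fst continuous_const)).inter
      ((isClosed_le c1 continuous_const).inter
        ((isClosed_le continuous_const c4).union (isClosed_le c2 c3)))
  have hSΩ : ∀ p ∈ S, p.2 ∈ Ω := by
    rintro ⟨t, x⟩ ⟨-, hxB, hxo⟩
    by_contra hxΩ
    obtain ⟨y, hy, hxy⟩ := hBc.exists_infDist_eq_dist hBne (x - k t • e3)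
    have hyS : y + hc' t • e3 ∈ solidAt B (hc' t) := by
      change y + hc' t • e3 - hc' t • e3 ∈ B
      rwa [add_sub_cancel_right]
    have hd : dist (y + hc' t • e3) x < ε := by
      have e1 : y + hc' t • e3 - x = (hc' t - k t) • e3 - (x - k t • e3 - y) := by module
      rw [dist_eq_norm, e1]
      refine (norm_sub_le _ _).trans_lt ?_
      rw [norm_smul, norm_e3, mul_one, Real.norm_eq_abs, abs_sub_comm, ← dist_eq_norm, ← hxy]
      have := hkh t
      change Metric.infDist (x - k t • e3) B ≤ ε / 2 at hxB
      linarith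
    have hxa := hnear _ (hpos _ (hclm t)) (hdist _ (hclm t)) (hsub _ (hclm t)) x _ hyS hd hxΩ
    rcases hxo with hxo | hxo
    · exact absurd hxo (not_le.2 hxa)
    · have hp : 0 < barrier α c (k t, x) := barrier_pos hc0 (hk0 t) x
      refine hxΩ ((hfl x (by linarith)).2 ?_)
      change barrier α c (k t, x) / 4 ≤ x 2 at hxo
      linarith
  have hsupp : Function.support φ ⊆ S := by
    rintro ⟨t, x⟩ hp
    have hp1 : ζ t ≠ 0 := fun h0 => hp (by simp [hφ, movingField, h0])
    have hp2 : liftField Ψ (k t, x) ≠ 0 := fun h0 => hp (by simp [hφ, movingField, h0])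
    have hp3 : ¬ ∀ᶠ z in 𝓝 (k t, x), Ψ z = 0 := fun h0 =>
      hp2 (by rw [liftField_eq_of_eventually_const h0, zero_smul])
    refine ⟨⟨?_, ?_⟩, ?_, ?_⟩
    · by_contra hcon
      exact hp1 (hζm t (not_le.1 hcon).le)
    · by_contra hcon
      exact hp1 (hζT t (not_le.1 hcon).le)
    · by_contra hcon
      exact hp3 (potential_eventually_zero_of_far hη0 (not_le.1 hcon))
    · by_contra! hcon
      exact hp3 (potential_eventually_zero_at_floor hα hc0 (hk0 t) hχ1 hcon.1 hcon.2)
  have htsupp : tsupport φ ⊆ S := closure_minimal hsupp hSc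
  have hcomp : HasCompactSupport φ := by
    refine IsCompact.of_isClosed_subset ?_ (isClosed_tsupport φ) htsupp
    refine Metric.isCompact_of_isClosed_isBounded hSc ?_
    refine ((Metric.isBounded_Icc (-1 : ℝ) T₂).prod hg.container.isBounded).subset ?_
    exact fun p hp => ⟨hp.1, hSΩ p hp⟩
  -- near the body the potential is `1`
  have hone : ∀ t ∈ Icc 0 T₂, ∀ x ∈ solidAt B (h t), ∀ᶠ z in 𝓝 (k t, x), Ψ z = 1 := by
    intro t ht x hx
    have hht : hc' t = h t := by simp only [hhc, hcl' t ht]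
    have hkt := hkh t
    rw [hht] at hkt
    refine potential_eventually_one hα hc0 (hk0 t) hη1 ?_ fun hxχ => ?_
    · refine (Metric.infDist_le_dist_of_mem (show x - h t • e3 ∈ B from hx)).trans_lt ?_
      have e1 : x - k t • e3 - (x - h t • e3) = (h t - k t) • e3 := by module
      rw [dist_eq_norm, e1, norm_smul, norm_e3, mul_one, Real.norm_eq_abs, abs_sub_comm]
      linarith
    · have hxR : ‖x‖ ≤ R := by simpa using hχs hxχ
      have h1 := hg.profile_le hx ((rad_le_norm x).trans (by linarith))
      have h2 := barrier_upper hα hα1 (hk0 t) (hkN t) hc0 hcN x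
      have h3 : 0 < barrier α c (k t, x) := barrier_pos hc0 (hk0 t) x
      have h4 := hk2 t
      rw [hht] at h4
      have h5 : 0 ≤ rad x ^ (1 + α) := Real.rpow_nonneg (rad_nonneg x) _
      linarith
  have hlate : ∀ p : ℝ × E3, T₂ < p.1 → ∀ᶠ q in 𝓝 p, φ q = 0 := fun p hp => by
    filter_upwards [(isOpen_lt continuous_const continuous_fst).mem_nhds
      (show p ∈ {q : ℝ × E3 | T₂ < q.1} from hp)] with q hq
    rw [hφ, movingField, hζT _ (le_of_lt hq), zero_smul]
  have hrad : ∀ x ∈ Ω, rad x ≤ P := fun x hx => (rad_le_norm x).trans (hP x hx)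
  have hB : ∀ t, ∀ x ∈ Ω, _ := fun t x hx => hbd (k t) (hk0 t) (hkN t) x (hrad x hx)
  refine ⟨φ, ζ, w, ?_⟩
  constructor
  · refine ⟨hφ1, hcomp, fun p hp => ?_⟩
    have := htsupp hp
    exact ⟨lt_of_le_of_lt this.1.2 hT₂, hSΩ p this⟩
  · refine ⟨interior {p | gradMat φ p = 0}, isOpen_interior, fun t ht x hx => ?_, fun p hp _ => ?_⟩
    · rw [mem_interior_iff_mem_nhds]
      change ∀ᶠ p in 𝓝 (t, x), gradMat φ p = 0
      rcases le_or_gt t T₂ with h1 | h1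
      · have hcc : ContinuousAt (fun p : ℝ × E3 => (k p.1, p.2)) (t, x) :=
          (hkc1.prodMk continuous_snd).continuousAt
        have h2 := hcc.eventually (eventually_eventually_nhds.2 (hone t ⟨ht.1, h1⟩ x hx))
        filter_upwards [h2] with p hp
        exact (movingField_of_eventually_const hζ hk hp).2.1
      · filter_upwards [eventually_eventually_nhds.2 (hlate (t, x) h1)] with p hp
        have : φ =ᶠ[𝓝 p] fun _ => 0 := hp
        ext i j
        rw [gradMat, Matrix.of_apply, dx, this.fderiv_eq]
        simp
    · have : p ∈ {p | gradMat φ p = 0} := interior_subset hp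
      have : gradMat φ p = 0 := this
      rw [this, symPart]; simp
  · exact hζ.continuous
  · exact fun t => (hζ01 t).1
  · exact hζ1
  · exact hζv
  · intro t x ht
    have h1 := hlate (t, x) ht
    have h2 : φ =ᶠ[𝓝 (t, x)] fun _ => 0 := h1
    exact ⟨h1.self_of_nhds, by rw [h2.fderiv_eq]; simp⟩
  · exact fun p => trace_gradMat_movingField hζ hk (hΨk p)
  · intro t ht x hx
    have h1 := hone t ht x hx
    obtain ⟨e1, e2, e4⟩ := movingField_of_eventually_const hζ hk (p := (t, x)) h1
    refine ⟨by rw [hφ, e1, one_smul], e2, by rw [hφ, e4, one_smul], ?_⟩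
    simp only [hw]
    rw [liftField_eq_of_eventually_const h1, one_smul, norm_e3]
  · exact fun p => norm_nonneg _
  · intro p
    rw [hφ, movingField, norm_smul, Real.norm_of_nonneg (hζ01 _).1]
    exact mul_le_of_le_one_left (norm_nonneg _) (hζ01 _).2
  · intro t ht x hx
    refine (hB t x hx).1.trans ?_
    have := cusp_nonneg (α := α) (b := b) (R := R) x
    nlinarith
  · intro t ht x hx
    refine (hB t x hx).2.1.trans ?_
    have := cusp_nonneg (α := α) (b := b) (R := R) x
    nlinarith
  · intro t ht x hx i j
    rw [hφ, gradMat_movingField hζ hk (hΨk (t, x)), abs_mul, abs_of_nonneg (hζ01 _).1]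
    have h1 := (hB t x hx).2.2 (0, stdVec j) (norm_zero_stdVec j).le i
    have h2 := cusp_nonneg (α := α) (b := b) (R := R) x
    have h3 := mul_le_of_le_one_left (abs_nonneg
      ((fderiv ℝ (liftField Ψ) (k t, x) (0, stdVec j)) i)) (hζ01 t).2
    refine h3.trans (h1.trans ?_)
    nlinarith
  · intro t ht x hx
    rw [hφ, dt_movingField hζ hk (hΨk (t, x))]
    have h1 : ‖fderiv ℝ (liftField Ψ) (k t, x) (1, 0)‖ ≤ 3 * (C * (1 + cusp α b R x)) :=
      norm_le_of_coord fun i => (hB t x hx).2.2 (1, 0) (by simp [Prod.norm_mk]) i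
    refine (norm_add_le _ _).trans ?_
    rw [add_comm, norm_smul, norm_smul, Real.norm_eq_abs, Real.norm_eq_abs, abs_mul,
      abs_of_nonneg (hζ01 _).1]
    refine add_le_add le_rfl ?_
    have h2 : ζ t * |deriv k t| ≤ L :=
      (mul_le_of_le_one_left (abs_nonneg _) (hζ01 t).2).trans (hkd t)
    calc ζ t * |deriv k t| * ‖fderiv ℝ (liftField Ψ) (k t, x) (1, 0)‖
        ≤ L * (3 * (C * (1 + cusp α b R x))) := mul_le_mul h2 h1 (norm_nonneg _) hL
      _ = L * (3 * C * (1 + cusp α b R x)) := by ring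

end

/-! ### Constants of the slice estimates -/

section
open scoped NNReal ENNReal

lemma frob_self_nonneg (A : Matrix (Fin 3) (Fin 3) ℝ) : 0 ≤ frob A A :=
  Finset.sum_nonneg fun _ _ => Finset.sum_nonneg fun _ _ => mul_self_nonneg _

lemma sq_le_frob_self (A : Matrix (Fin 3) (Fin 3) ℝ) (i j : Fin 3) : A i j ^ 2 ≤ frob A A := by
  rw [sq]
  refine (Finset.single_le_sum (f := fun j => A i j * A i j) (fun _ _ => mul_self_nonneg _)
    (Finset.mem_univ j)).trans ?_
  exact Finset.single_le_sum (f := fun i => ∑ j, A i j * A i j)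
    (fun _ _ => Finset.sum_nonneg fun _ _ => mul_self_nonneg _) (Finset.mem_univ i)

lemma abs_le_sqrt_frob (A : Matrix (Fin 3) (Fin 3) ℝ) (i j : Fin 3) : |A i j| ≤ √(frob A A) :=
  Real.abs_le_sqrt (sq_le_frob_self A i j)

/-- The embedding of `W₀^{1,2}` into `L⁶`. -/
lemma exists_sobolev_W0_sq : ∃ C : ℝ≥0∞, C ≠ ⊤ ∧ ∀ (D : Set E3) (u : E3 → E3)
    (Du : E3 → Matrix (Fin 3) (Fin 3) ℝ), IsOpen D → IsW0Grad D u Du →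
      eLpNorm u 6 (volume.restrict D) ≤
        C * (∫⁻ x in D, ENNReal.ofReal (‖u x‖ ^ 2 + frob (Du x) (Du x))) ^ (1 / 2 : ℝ) := by
  obtain ⟨C, hC⟩ := exists_sobolev_W0
  refine ⟨C * 9, ENNReal.mul_ne_top ENNReal.coe_ne_top (by norm_num), fun D u Du hD hu => ?_⟩
  refine (hC D u Du hD hu).trans ?_
  rw [mul_assoc]
  gcongr
  have h1 : ∀ i j, eLpNorm (fun x => Du x i j) 2 (volume.restrict D)
      ≤ (∫⁻ x in D, ENNReal.ofReal (‖u x‖ ^ 2 + frob (Du x) (Du x))) ^ (1 / 2 : ℝ) := fun i j => by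
    rw [← eLpNorm_indicator_eq_eLpNorm_restrict hD.measurableSet]
    refine eLpNorm_two_indicator_le hD.measurableSet fun x => ?_
    linarith [sq_le_frob_self (Du x) i j, sq_nonneg ‖u x‖]
  calc ∑ i, ∑ j, eLpNorm (fun x => Du x i j) 2 (volume.restrict D)
      ≤ ∑ _i : Fin 3, ∑ _j : Fin 3,
        (∫⁻ x in D, ENNReal.ofReal (‖u x‖ ^ 2 + frob (Du x) (Du x))) ^ (1 / 2 : ℝ) :=
        Finset.sum_le_sum fun i _ => Finset.sum_le_sum fun j _ => h1 i j
    _ = _ := by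
        simp only [Finset.sum_const, Finset.card_univ, Fintype.card_fin, nsmul_eq_mul]
        rw [← mul_assoc]; norm_num

lemma lintegral_one_add_cusp_rpow_lt_top {α b R q : ℝ} {Ω : Set E3} (hΩ : volume Ω ≠ ⊤)
    (hα : 0 < α) (hb : 0 ≤ b) (hR : R ≤ 1) (hq : 0 < q) (hqα : q * (1 + 2 * α) < 3 + α) :
    ∫⁻ x in Ω, ENNReal.ofReal ((1 + cusp α b R x) ^ q) ≠ ⊤ := by
  have hpt : ∀ x, ENNReal.ofReal ((1 + cusp α b R x) ^ q)
      ≤ ENNReal.ofReal (2 ^ q) * (1 + ENNReal.ofReal (cusp α b R x ^ q)) := fun x => by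
    have h0 := cusp_nonneg (α := α) (b := b) (R := R) x
    have h1 : 0 ≤ cusp α b R x ^ q := Real.rpow_nonneg h0 q
    rw [← ENNReal.ofReal_one, ← ENNReal.ofReal_add zero_le_one h1,
      ← ENNReal.ofReal_mul (by positivity)]
    refine ENNReal.ofReal_le_ofReal ?_
    have h2 : (0 : ℝ) ≤ 2 ^ q := by positivity
    rcases le_total (cusp α b R x) 1 with h | h
    · have : (1 + cusp α b R x) ^ q ≤ 2 ^ q := Real.rpow_le_rpow (by linarith) (by linarith) hq.le
      nlinarith
    · have : (1 + cusp α b R x) ^ q ≤ (2 * cusp α b R x) ^ q :=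
        Real.rpow_le_rpow (by linarith) (by linarith) hq.le
      rw [Real.mul_rpow zero_le_two h0] at this
      nlinarith
  refine ne_top_of_le_ne_top ?_ (lintegral_mono hpt)
  rw [lintegral_const_mul' _ _ ENNReal.ofReal_ne_top, lintegral_add_left' aemeasurable_const,
    lintegral_one]
  refine ENNReal.mul_ne_top ENNReal.ofReal_ne_top (ENNReal.add_ne_top.2 ⟨?_, ?_⟩)
  · simpa using hΩ
  · exact ne_top_of_le_ne_top (lintegral_cusp_rpow_lt_top hα hb hR hq hqα).ne
      (setLIntegral_le_lintegral _ _)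

/-- The bounds on time slices, with the constant `c`, from which the momentum estimate is made; `G` is
the weight that dominates the test field. -/
structure IsSliceConstant (Ω : Set E3) (G : E3 → ℝ) (γ β A : ℝ) (c : ℝ≥0∞) : Prop where
  fluid : ∀ F ⊆ Ω, ∀ K, 1 ≤ K → ∀ ρ : E3 → ℝ, AEMeasurable ρ (volume.restrict F) →
    (∀ᵐ x ∂volume.restrict F, 0 ≤ ρ x) →
    ∫⁻ x in F, ENNReal.ofReal (ρ x ^ γ) ≤ ENNReal.ofReal K →
    ∫⁻ x in F, ENNReal.ofReal (ρ x * G x) ≤ c * ENNReal.ofReal (K ^ (1 / γ)) ∧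
    (∀ w : E3 → ℝ, (∀ x, 0 ≤ w x) → (∀ᵐ x ∂volume.restrict F, w x ^ 3 ≤ A * G x) →
      ∫⁻ x in F, ENNReal.ofReal (ρ x * w x ^ 2) ≤ c * ENNReal.ofReal K) ∧
    ∀ u Du, IsW0Grad Ω u Du →
      ∫⁻ x in F, ENNReal.ofReal (ρ x * ‖u x‖ ^ 2 * G x)
        ≤ c * ENNReal.ofReal (K ^ (1 / γ))
          * ∫⁻ x in Ω, ENNReal.ofReal (‖u x‖ ^ 2 + frob (Du x) (Du x))
  dissipation : ∀ u Du, IsW0Grad Ω u Du → ∀ ϑ : E3 → ℝ, AEMeasurable ϑ (volume.restrict Ω) →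
    (∀ᵐ x ∂volume.restrict Ω, 0 < ϑ x) →
    ∀ Dz, HasWeakGradOn Ω (fun x => ϑ x ^ (β / 2)) Dz →
      ∫⁻ x in Ω, ENNReal.ofReal ((1 + ϑ x) * √(frob (Du x) (Du x)) * G x)
        ≤ c * (1 + (∫⁻ x in Ω, ENNReal.ofReal (‖u x‖ ^ 2 + frob (Du x) (Du x)))
          + ∫⁻ x in Ω, ENNReal.ofReal ((ϑ x ^ (β / 2)) ^ 2 + ‖Dz x‖ ^ 2))

/-- The conditions on `α` express that the powers of the weight `1 + cusp` required by Hölder's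
inequality are integrable. -/
lemma exists_sliceConstant {Ω : Set E3} {α b R a γ β A : ℝ} (hΩo : IsOpen Ω)
    (hΩb : Bornology.IsBounded Ω) (hα : 0 < α) (hb : 0 ≤ b) (hR : R ≤ 1) (ha : 0 < a)
    (hRa : R < a / 2) (hfl : ∀ x : E3, ‖x‖ < a → (x ∈ Ω ↔ 0 < x 2)) (hA : 0 ≤ A) (hγ : 3 < γ)
    (hβ : 2 < β) (hαγ : α * (4 * γ + 3) < 3 * (γ - 3)) (hαβ : α * (9 * β + 2) < 3 * (β - 2)) :
    ∃ c : ℝ≥0∞, c ≠ ⊤ ∧ IsSliceConstant Ω (fun x => 1 + cusp α b R x) γ β A c := by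
  obtain ⟨S, hS, hSob⟩ := exists_sobolev_W0_sq
  obtain ⟨S', hSob'⟩ := exists_sobolev_near_floor ha
  have hΩt : volume Ω ≠ ⊤ := hΩb.measure_lt_top.ne
  have h23 : 0 < 2 * γ - 3 := by linarith
  have h32 : 0 < 3 * β - 2 := by linarith
  have hγ0 : 0 < γ := by linarith
  have hβ0 : 0 < β := by linarith
  set q : ℝ := 3 * γ / (2 * γ - 3) with hq
  have hq0 : 0 < q := by positivity
  have hqα : q * (1 + 2 * α) < 3 + α := by
    rw [hq, div_mul_eq_mul_div, div_lt_iff₀ h23]; linarith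
  have hsum : 1 / γ + 1 / 3 + 1 / q = 1 := by rw [hq]; field_simp; ring
  set r : ℝ := 6 * β / (3 * β - 2) with hr
  have hr0 : 0 < r := by positivity
  have hrα : r * (1 + 2 * α) < 3 + α := by
    rw [hr, div_mul_eq_mul_div, div_lt_iff₀ h32]; linarith
  have h1α : (1 : ℝ) * (1 + 2 * α) < 3 + α := by
    have h1q : 1 ≤ q := by rw [hq, one_le_div h23]; linarith
    nlinarith
  set G : E3 → ℝ := fun x => 1 + cusp α b R x with hG
  have hGm : Measurable G := measurable_const.add measurable_cusp
  have hG0 : ∀ x, 0 ≤ G x := fun x => add_nonneg zero_le_one (cusp_nonneg x)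
  set Iq := ∫⁻ x in Ω, ENNReal.ofReal (G x ^ q) with hIq
  have Iqt : Iq ≠ ⊤ := lintegral_one_add_cusp_rpow_lt_top hΩt hα hb hR hq0 hqα
  set I1 := ∫⁻ x in Ω, ENNReal.ofReal (G x) with hI1
  have I1t : I1 ≠ ⊤ := by
    have := lintegral_one_add_cusp_rpow_lt_top hΩt hα hb hR one_pos h1α
    simpa only [Real.rpow_one] using this
  set Ir := ∫⁻ x, ENNReal.ofReal (cusp α b R x ^ r) with hIr
  have Irt : Ir ≠ ⊤ := (lintegral_cusp_rpow_lt_top hα hb hR hr0 hrα).ne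
  set c1 : ℝ≥0∞ := volume Ω ^ (1 / 3 : ℝ) * Iq ^ (1 / q) with hc1
  set c2 : ℝ≥0∞ := volume Ω + 1 + ENNReal.ofReal A * I1 with hc2
  set c3 : ℝ≥0∞ := S ^ (2 : ℝ) * Iq ^ (1 / q) with hc3
  set c4 : ℝ≥0∞ := 4 * (3 * volume Ω + 1 + Ir + (S' : ℝ≥0∞) ^ (4 / β) * Ir ^ (2 / r)) with hc4
  have Iq' : Iq ^ (1 / q) ≠ ⊤ := ENNReal.rpow_ne_top_of_nonneg (by positivity) Iqt
  have t1 : c1 ≠ ⊤ := ENNReal.mul_ne_top (ENNReal.rpow_ne_top_of_nonneg (by norm_num) hΩt) Iq'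
  have t2 : c2 ≠ ⊤ := ENNReal.add_ne_top.2 ⟨ENNReal.add_ne_top.2 ⟨hΩt, ENNReal.one_ne_top⟩,
    ENNReal.mul_ne_top ENNReal.ofReal_ne_top I1t⟩
  have t3 : c3 ≠ ⊤ := ENNReal.mul_ne_top (ENNReal.rpow_ne_top_of_nonneg (by norm_num) hS) Iq'
  have t4 : c4 ≠ ⊤ := by
    refine ENNReal.mul_ne_top (by norm_num) (ENNReal.add_ne_top.2 ⟨ENNReal.add_ne_top.2
      ⟨ENNReal.add_ne_top.2 ⟨ENNReal.mul_ne_top (by norm_num) hΩt, ENNReal.one_ne_top⟩, Irt⟩,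
      ENNReal.mul_ne_top ?_ ?_⟩)
    · exact ENNReal.rpow_ne_top_of_nonneg (by positivity) ENNReal.coe_ne_top
    · exact ENNReal.rpow_ne_top_of_nonneg (by positivity) Irt
  set C := c1 + c2 + c3 + c4 with hC
  have l1 : c1 ≤ C := le_self_add.trans (le_self_add.trans le_self_add)
  have l2 : c2 ≤ C := le_add_self.trans (le_self_add.trans le_self_add)
  have l3 : c3 ≤ C := le_add_self.trans le_self_add
  have l4 : c4 ≤ C := le_add_self
  refine ⟨C, ?_, ?_, ?_⟩
  · exact ENNReal.add_ne_top.2 ⟨ENNReal.add_ne_top.2 ⟨ENNReal.add_ne_top.2 ⟨t1, t2⟩, t3⟩, t4⟩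
  · intro F hF K hK ρ hρ hρ0 hρK
    have hK0 : 0 ≤ K := by linarith
    have hle : volume.restrict F ≤ volume.restrict Ω := Measure.restrict_mono hF le_rfl
    have hvF : (volume.restrict F) univ ≤ volume Ω := by
      rw [Measure.restrict_apply_univ]; exact measure_mono hF
    have hIF : ∫⁻ x in F, ENNReal.ofReal (G x ^ q) ≤ Iq := lintegral_mono_set hF
    refine ⟨?_, fun w hw0 hw => ?_, fun u Du hu => ?_⟩
    · refine (lintegral_density_le hρ hGm.aemeasurable hρ0 hG0 hγ0 hq0 hsum hK0 hρK).trans ?_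
      refine mul_le_mul_left ((mul_le_mul' ?_ ?_).trans l1) _
      · exact ENNReal.rpow_le_rpow hvF (by norm_num)
      · exact ENNReal.rpow_le_rpow hIF (by positivity)
    · refine (lintegral_density_mul_sq_le hGm hρ0 hρ hw0 hA hw hγ hρK).trans ?_
      have hK1 : 1 ≤ ENNReal.ofReal K := ENNReal.one_le_ofReal.2 hK
      have hI : ∫⁻ x in F, ENNReal.ofReal (G x) ≤ I1 := lintegral_mono_set hF
      calc (volume.restrict F) univ + ENNReal.ofReal K
            + ENNReal.ofReal A * ∫⁻ x in F, ENNReal.ofReal (G x)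
          ≤ volume Ω * ENNReal.ofReal K + 1 * ENNReal.ofReal K
            + ENNReal.ofReal A * I1 * ENNReal.ofReal K := by
            rw [one_mul]
            refine add_le_add (add_le_add (hvF.trans (le_mul_of_one_le_right' hK1)) le_rfl) ?_
            exact (mul_le_mul_right hI _).trans (le_mul_of_one_le_right' hK1)
        _ = c2 * ENNReal.ofReal K := by rw [hc2]; ring
        _ ≤ C * ENNReal.ofReal K := mul_le_mul_left l2 _
    · have hu6 : eLpNorm u 6 (volume.restrict F)
          ≤ S * (∫⁻ x in Ω, ENNReal.ofReal (‖u x‖ ^ 2 + frob (Du x) (Du x))) ^ (1 / 2 : ℝ) :=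
        (eLpNorm_mono_measure u hle).trans (hSob Ω u Du hΩo hu)
      refine (lintegral_convection_le hρ hGm.aemeasurable (hu.1.1.mono_measure hle) hρ0 hG0 hγ0 hq0
        hsum hK0 hρK hu6).trans ?_
      refine mul_le_mul_left (mul_le_mul_left (le_trans ?_ l3) _) _
      exact mul_le_mul_right (ENNReal.rpow_le_rpow hIF (by positivity)) _
  · intro u Du hu ϑ hϑ hϑ0 Dz hDz
    have hz := hSob' Ω hΩo.measurableSet hfl _ _ hDz
    have hfm : AEMeasurable (fun x => frob (Du x) (Du x)) (volume.restrict Ω) := by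
      unfold frob
      refine Finset.aemeasurable_fun_sum _ fun i _ => Finset.aemeasurable_fun_sum _ fun j _ => ?_
      exact (hu.2.1 i j).1.aemeasurable.mul (hu.2.1 i j).1.aemeasurable
    have hz' : eLpNorm (fun x => ϑ x ^ (β / 2)) 6
        ((volume.restrict Ω).restrict (Metric.ball 0 (a / 2)))
        ≤ S' * (∫⁻ x in Ω, ENNReal.ofReal ((ϑ x ^ (β / 2)) ^ 2 + ‖Dz x‖ ^ 2)) ^ (1 / 2 : ℝ) := by
      rw [Measure.restrict_restrict measurableSet_ball, inter_comm]; exact hz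
    have hI : ∫⁻ x in Ω, ENNReal.ofReal (cusp α b R x ^ r) ≤ Ir := setLIntegral_le_lintegral _ _
    refine (lintegral_dissipation_le hϑ0 hϑ measurable_cusp (fun x => cusp_nonneg x)
      (fun x => frob_self_nonneg (Du x)) hfm (n := fun x => ‖Dz x‖ ^ 2) (fun x => by positivity)
      hβ hr measurableSet_ball (fun x hx => cusp_eq_zero (by
        have : a / 2 ≤ ‖x‖ := by simpa using hx
        linarith)) hz' le_rfl
      (D := ∫⁻ x in Ω, ENNReal.ofReal (‖u x‖ ^ 2 + frob (Du x) (Du x)))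
      (lintegral_mono fun x => ENNReal.ofReal_le_ofReal (by linarith [sq_nonneg ‖u x‖]))).trans ?_
    refine mul_le_mul_left (le_trans ?_ l4) _
    rw [Measure.restrict_apply_univ, hc4]
    gcongr

end

/-! ### Bounds of the stress -/

section
open scoped NNReal ENNReal

/-- The viscosities grow at most linearly in the temperature. -/
lemma ViscosityLaw.exists_upper {μ η : ℝ → ℝ} (hv : ViscosityLaw μ η) :
    ∃ C : ℝ, 0 < C ∧ ∀ s > 0, 0 ≤ μ s ∧ μ s ≤ C * (1 + s) ∧ 0 ≤ η s ∧ η s ≤ C * (1 + s) := by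
  obtain ⟨L, hL⟩ := hv.mu_lip
  obtain ⟨c, hc, hlow⟩ := hv.mu_lower
  obtain ⟨C, hC⟩ := hv.eta_upper
  refine ⟨|μ 1| + L + |C| + 1, by positivity, fun s hs => ⟨?_, ?_, hv.eta_nonneg s hs, ?_⟩⟩
  · exact le_trans (by positivity) (hlow s hs)
  · have h1 := hL.dist_le_mul s hs 1 (mem_Ioi.2 one_pos)
    rw [Real.dist_eq, Real.dist_eq] at h1
    have h2 : |s - 1| ≤ 1 + s := abs_le.2 ⟨by linarith, by linarith⟩
    have h3 : (L : ℝ) * |s - 1| ≤ L * (1 + s) := mul_le_mul_of_nonneg_left h2 L.2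
    have h4 := le_abs_self (μ s - μ 1)
    have h5 := le_abs_self (μ 1)
    have h6 : |μ 1| ≤ |μ 1| * (1 + s) := le_mul_of_one_le_right (abs_nonneg _) (by linarith)
    nlinarith [abs_nonneg C]
  · refine (hC s hs).trans (mul_le_mul_of_nonneg_right ?_ (by linarith))
    linarith [le_abs_self C, abs_nonneg (μ 1), L.2]

lemma abs_stress_le {M : Material} {s C : ℝ} (hC : 0 ≤ M.μ s ∧ M.μ s ≤ C * (1 + s) ∧ 0 ≤ M.η s ∧
    M.η s ≤ C * (1 + s)) (A : Matrix (Fin 3) (Fin 3) ℝ) (i j : Fin 3) :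
    |M.stress s A i j| ≤ 7 * C * ((1 + s) * √(frob A A)) := by
  obtain ⟨m0, m1, e0, e1⟩ := hC
  set f := √(frob A A) with hf
  have hf0 : 0 ≤ f := Real.sqrt_nonneg _
  have ha : ∀ i j, |A i j| ≤ f := abs_le_sqrt_frob A
  have htr : |A.trace| ≤ 3 * f := by
    rw [Matrix.trace_fin_three]
    refine (abs_add_three _ _ _).trans ?_
    linarith [ha 0 0, ha 1 1, ha 2 2]
  have hone : |(1 : Matrix (Fin 3) (Fin 3) ℝ) i j| ≤ 1 := by
    rw [Matrix.one_apply]; split_ifs <;> simp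
  have hs : |symPart A i j| ≤ f := by
    have e : symPart A i j = 1 / 2 * (A i j + A j i) := by
      simp [symPart]
    rw [e, abs_mul, abs_of_pos (by norm_num : (0 : ℝ) < 1 / 2)]
    have := abs_add_le (A i j) (A j i)
    linarith [ha i j, ha j i]
  have e : M.stress s A i j = 2 * M.μ s * (symPart A i j - A.trace / 3 * (1 : Matrix _ _ ℝ) i j)
      + M.η s * A.trace * (1 : Matrix _ _ ℝ) i j := by
    simp [Material.stress]
  have h1 : |symPart A i j - A.trace / 3 * (1 : Matrix (Fin 3) (Fin 3) ℝ) i j| ≤ 2 * f := by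
    refine (abs_sub _ _).trans ?_
    rw [abs_mul, abs_div, abs_of_pos (by norm_num : (0 : ℝ) < 3)]
    have : |A.trace| / 3 * |(1 : Matrix (Fin 3) (Fin 3) ℝ) i j| ≤ f * 1 :=
      mul_le_mul (by linarith) hone (abs_nonneg _) hf0
    linarith
  have h2 : |A.trace * (1 : Matrix (Fin 3) (Fin 3) ℝ) i j| ≤ 3 * f := by
    rw [abs_mul]
    calc |A.trace| * |(1 : Matrix (Fin 3) (Fin 3) ℝ) i j| ≤ 3 * f * 1 :=
          mul_le_mul htr hone (abs_nonneg _) (by linarith)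
      _ = 3 * f := mul_one _
  rw [e]
  refine (abs_add_le _ _).trans ?_
  rw [abs_mul, mul_assoc (M.η s), abs_mul (M.η s), abs_of_nonneg e0,
    abs_of_nonneg (by linarith : 0 ≤ 2 * M.μ s)]
  have k1 : 2 * M.μ s * |symPart A i j - A.trace / 3 * (1 : Matrix (Fin 3) (Fin 3) ℝ) i j|
      ≤ 2 * (C * (1 + s)) * (2 * f) :=
    mul_le_mul (by linarith) h1 (abs_nonneg _) (by linarith)
  have k2 : M.η s * |A.trace * (1 : Matrix (Fin 3) (Fin 3) ℝ) i j| ≤ C * (1 + s) * (3 * f) :=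
    mul_le_mul e1 h2 (abs_nonneg _) (by linarith)
  linarith

lemma abs_frob_le {A B : Matrix (Fin 3) (Fin 3) ℝ} {a b : ℝ} (hA : ∀ i j, |A i j| ≤ a)
    (hB : ∀ i j, |B i j| ≤ b) : |frob A B| ≤ 9 * (a * b) := by
  unfold frob
  refine (Finset.abs_sum_le_sum_abs _ _).trans ?_
  calc ∑ i, |∑ j, A i j * B i j| ≤ ∑ _i : Fin 3, ∑ _j : Fin 3, a * b := by
        refine Finset.sum_le_sum fun i _ => (Finset.abs_sum_le_sum_abs _ _).trans ?_
        exact Finset.sum_le_sum fun j _ => abs_mul_le_mul (hA i j) (hB i j)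
    _ = 9 * (a * b) := by
        simp only [Finset.sum_const, Finset.card_univ, Fintype.card_fin, nsmul_eq_mul]
        push_cast; ring

/-! ### Time slices -/

lemma volume_restrict_cyl (Ω : Set E3) (T : ℝ) : (volume.restrict (cyl Ω T) : Measure (ℝ × E3))
    = (volume.restrict (Ioo 0 T)).prod (volume.restrict Ω) := by
  rw [Measure.prod_restrict, cyl, Measure.volume_eq_prod]

lemma lintegral_cyl_le (Ω : Set E3) (T : ℝ) (f : ℝ × E3 → ℝ≥0∞) :
    ∫⁻ p in cyl Ω T, f p ≤ ∫⁻ t in Ioo 0 T, ∫⁻ x in Ω, f (t, x) := by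
  rw [volume_restrict_cyl]
  exact lintegral_prod_le f

lemma measurableSet_fluidCyl {Ω B : Set E3} {h k : ℝ → ℝ} {T : ℝ} (hΩ : MeasurableSet Ω)
    (hB : IsClosed B) (hk : Continuous k) (hkh : ∀ t ∈ Ioo 0 T, k t = h t) :
    MeasurableSet (fluidCyl Ω B h T) := by
  have e : fluidCyl Ω B h T = cyl Ω T \ {p | p.2 - k p.1 • e3 ∈ B} := by
    ext p
    constructor
    · rintro ⟨h1, h2, h3⟩
      refine ⟨⟨h1, h2⟩, fun h4 => h3 ?_⟩
      change p.2 - h p.1 • e3 ∈ B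
      rw [← hkh _ h1]; exact h4
    · rintro ⟨⟨h1, h2⟩, h3⟩
      refine ⟨h1, h2, fun h4 => h3 ?_⟩
      change p.2 - k p.1 • e3 ∈ B
      rw [hkh _ h1]; exact h4
  rw [e]
  refine (measurableSet_Ioo.prod hΩ).diff (hB.preimage ?_).measurableSet
  exact continuous_snd.sub ((hk.comp continuous_fst).smul continuous_const)

lemma lintegral_fluidCyl_le {Ω B : Set E3} {h : ℝ → ℝ} {T : ℝ} (hΩ : MeasurableSet Ω)
    (hB : IsClosed B) (hm : MeasurableSet (fluidCyl Ω B h T)) (f : ℝ × E3 → ℝ≥0∞) :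
    ∫⁻ p in fluidCyl Ω B h T, f p ≤ ∫⁻ t in Ioo 0 T, ∫⁻ x in Ω \ solidAt B (h t), f (t, x) := by
  rw [← lintegral_indicator hm, Measure.volume_eq_prod]
  refine (lintegral_prod_le _).trans (le_of_eq ?_)
  rw [← lintegral_indicator measurableSet_Ioo]
  refine lintegral_congr fun t => ?_
  by_cases ht : t ∈ Ioo 0 T
  · rw [indicator_of_mem ht, ← lintegral_indicator (hΩ.diff (isClosed_solidAt hB _).measurableSet)]
    refine lintegral_congr fun x => ?_
    by_cases hx : x ∈ Ω \ solidAt B (h t)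
    · rw [indicator_of_mem hx, indicator_of_mem (show (t, x) ∈ fluidCyl Ω B h T from ⟨ht, hx⟩)]
    · rw [indicator_of_notMem hx, indicator_of_notMem fun hc => hx hc.2]
  · rw [indicator_of_notMem ht]
    refine (lintegral_congr fun x => ?_).trans lintegral_zero
    exact indicator_of_notMem (fun hc => ht hc.1) _

lemma ae_fst_ne (T : ℝ) : ∀ᵐ p : ℝ × E3, p.1 ≠ T := by
  have h : ∀ᵐ t : ℝ, t ≠ T := by simp [ae_iff]
  rw [Measure.volume_eq_prod]
  exact Measure.quasiMeasurePreserving_fst.ae h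

/-- Functions that vanish after the time `T₂` are integrated only up to `T₂`. -/
lemma setIntegral_cyl_of_late {Ω : Set E3} {T T₂ : ℝ} (hΩ : MeasurableSet Ω) (hT : T₂ ≤ T)
    {f : ℝ × E3 → ℝ} (hf : ∀ p, T₂ < p.1 → f p = 0) :
    ∫ p in cyl Ω T, f p = ∫ p in cyl Ω T₂, f p := by
  refine setIntegral_eq_of_subset_of_ae_sdiff_eq_zero
    (measurableSet_Ioo.prod hΩ).nullMeasurableSet
    (prod_mono (Ioo_subset_Ioo le_rfl hT) le_rfl) ?_
  filter_upwards [ae_fst_ne T₂] with p hp hmem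
  refine hf p (lt_of_le_of_ne ?_ (Ne.symm hp))
  by_contra hcon
  exact hmem.2 ⟨⟨hmem.1.1.1, not_le.1 hcon⟩, hmem.1.2⟩

lemma setIntegral_fluidCyl_of_late {Ω B : Set E3} {h : ℝ → ℝ} {T T₂ : ℝ} (hT : T₂ ≤ T)
    (hm : MeasurableSet (fluidCyl Ω B h T)) {f : ℝ × E3 → ℝ} (hf : ∀ p, T₂ < p.1 → f p = 0) :
    ∫ p in fluidCyl Ω B h T, f p = ∫ p in fluidCyl Ω B h T₂, f p := by
  refine setIntegral_eq_of_subset_of_ae_sdiff_eq_zero hm.nullMeasurableSet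
    (fun p hp => ⟨⟨hp.1.1, hp.1.2.trans_le hT⟩, hp.2⟩) ?_
  filter_upwards [ae_fst_ne T₂] with p hp hmem
  refine hf p (lt_of_le_of_ne ?_ (Ne.symm hp))
  by_contra hcon
  exact hmem.2 ⟨⟨hmem.1.1.1, not_le.1 hcon⟩, hmem.1.2⟩

/-- A momentum density `n` with energy density `e`, `n² ≤ ρ e`, paired with a field of size `w`. The
heavy solid contributes the square root of its mass. -/
lemma lintegral_momentum_mul_le {Ω S : Set E3} (hS : MeasurableSet S)
    (hSΩ : S ⊆ Ω)
    {ρ n e w : E3 → ℝ} {ρs m K : ℝ} (hm : 0 < m) (hK : 1 ≤ K)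
    (hms : ENNReal.ofReal ρs * volume S = ENNReal.ofReal m)
    (hn : ∀ᵐ x ∂volume.restrict Ω, 0 ≤ n x ∧ 0 ≤ ρ x ∧ 0 ≤ e x ∧ n x ^ 2 ≤ ρ x * e x)
    (hw : ∀ x, 0 ≤ w x)
    (hρS : ∀ᵐ x ∂volume.restrict S, ρ x = ρs) (hwS : ∀ x ∈ S, w x = 1)
    (hem : AEMeasurable e (volume.restrict Ω))
    (he : ∫⁻ x in Ω, ENNReal.ofReal (e x) ≤ ENNReal.ofReal K) {c : ℝ≥0∞}
    (hF : ∫⁻ x in Ω \ S, ENNReal.ofReal (ρ x * w x ^ 2) ≤ c * ENNReal.ofReal K) :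
    ∫⁻ x in Ω, ENNReal.ofReal (n x * w x) ≤ (2 + c) * ENNReal.ofReal ((1 + √m) * K) := by
  set l := 1 + √m with hl
  have hs0 : 0 < √m := Real.sqrt_pos.2 hm
  have hl1 : 1 ≤ l := by linarith
  have hl0 : 0 < l := by linarith
  have hpt : ∀ᵐ x ∂volume.restrict Ω, ENNReal.ofReal (n x * w x)
      ≤ ENNReal.ofReal l * ENNReal.ofReal (e x)
        + ENNReal.ofReal (1 / l) * ENNReal.ofReal (ρ x * w x ^ 2) := by
    filter_upwards [hn] with x hx
    obtain ⟨h1, h2, h3, h4⟩ := hx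
    have h5 := hw x
    rw [← ENNReal.ofReal_mul hl0.le, ← ENNReal.ofReal_mul (by positivity),
      ← ENNReal.ofReal_add (by positivity) (by positivity)]
    refine ENNReal.ofReal_le_ofReal ?_
    refine abs_le_of_sq_le_sq' ?_ (by positivity) |>.2
    have e1 : (l * e x) * (1 / l * (ρ x * w x ^ 2)) = ρ x * e x * w x ^ 2 := by field_simp
    have e2 : n x ^ 2 * w x ^ 2 ≤ ρ x * e x * w x ^ 2 :=
      mul_le_mul_of_nonneg_right h4 (sq_nonneg _)
    have e4 : 0 ≤ l * e x := by positivity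
    have e5 : 0 ≤ 1 / l * (ρ x * w x ^ 2) := by positivity
    nlinarith [sq_nonneg (l * e x), sq_nonneg (1 / l * (ρ x * w x ^ 2))]
  have hsolid : ∫⁻ x in S, ENNReal.ofReal (ρ x * w x ^ 2) = ENNReal.ofReal m := by
    rw [← hms]
    have : ∀ᵐ x ∂volume.restrict S, ENNReal.ofReal (ρ x * w x ^ 2) = ENNReal.ofReal ρs := by
      filter_upwards [hρS, ae_restrict_mem hS] with x h1 h2
      rw [h1, hwS x h2]; simp
    rw [lintegral_congr_ae this, setLIntegral_const]
  have hsplit : ∫⁻ x in Ω, ENNReal.ofReal (ρ x * w x ^ 2)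
      ≤ ENNReal.ofReal m + c * ENNReal.ofReal K := by
    rw [← lintegral_inter_add_sdiff _ Ω hS, inter_eq_self_of_subset_right hSΩ, hsolid]
    exact add_le_add_right hF _
  refine (lintegral_mono_ae hpt).trans ?_
  rw [lintegral_add_left' (hem.ennreal_ofReal.const_mul _),
    lintegral_const_mul' _ _ ENNReal.ofReal_ne_top, lintegral_const_mul' _ _ ENNReal.ofReal_ne_top]
  have k1 : ENNReal.ofReal (1 / l) * ENNReal.ofReal m ≤ ENNReal.ofReal (l * K) := by
    rw [← ENNReal.ofReal_mul (by positivity)]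
    refine ENNReal.ofReal_le_ofReal ?_
    have h1 := Real.sq_sqrt hm.le
    have h2 : 1 / l * m ≤ l := by
      rw [one_div_mul_eq_div, div_le_iff₀ hl0]; nlinarith
    nlinarith
  have k2 : ENNReal.ofReal (1 / l) * (c * ENNReal.ofReal K) ≤ c * ENNReal.ofReal (l * K) := by
    rw [mul_left_comm, ← ENNReal.ofReal_mul (by positivity)]
    refine mul_le_mul_right (ENNReal.ofReal_le_ofReal ?_) _
    have h1 : 1 / l ≤ l := ((div_le_one hl0).2 hl1).trans hl1
    exact mul_le_mul_of_nonneg_right h1 (by linarith)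
  calc (ENNReal.ofReal l * ∫⁻ x in Ω, ENNReal.ofReal (e x))
        + ENNReal.ofReal (1 / l) * ∫⁻ x in Ω, ENNReal.ofReal (ρ x * w x ^ 2)
      ≤ ENNReal.ofReal l * ENNReal.ofReal K
        + ENNReal.ofReal (1 / l) * (ENNReal.ofReal m + c * ENNReal.ofReal K) := by gcongr
    _ ≤ ENNReal.ofReal (l * K) + (ENNReal.ofReal (l * K) + c * ENNReal.ofReal (l * K)) := by
        rw [mul_add, ← ENNReal.ofReal_mul hl0.le]
        exact add_le_add le_rfl (add_le_add k1 k2)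
    _ = _ := by ring

end

section
open scoped NNReal ENNReal

/-! ### Energy of the initial data -/

lemma norm_cross_sq (w y : E3) : ‖cross w y‖ ^ 2 = ‖y‖ ^ 2 * ‖w‖ ^ 2 - inner ℝ y w ^ 2 := by
  rw [EuclideanSpace.norm_sq_eq, EuclideanSpace.norm_sq_eq, EuclideanSpace.norm_sq_eq,
    PiLp.inner_apply]
  simp only [Fin.sum_univ_three, Real.norm_eq_abs, sq_abs, cross, cross_apply]
  simp only [Matrix.cons_val_zero, Matrix.cons_val_one, Matrix.cons_val]
  simp only [RCLike.inner_apply, conj_trivial]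
  ring

lemma norm_add_cross_sq_le (v w y : E3) :
    ‖v + cross w y‖ ^ 2 ≤ 2 * ‖v‖ ^ 2 + 2 * (‖y‖ ^ 2 * ‖w‖ ^ 2 - inner ℝ y w ^ 2) := by
  rw [← norm_cross_sq]
  have h1 := norm_add_le v (cross w y)
  have h2 := pow_le_pow_left₀ (norm_nonneg _) h1 2
  nlinarith [sq_nonneg (‖v‖ - ‖cross w y‖)]

lemma inertia_nonneg (w y : E3) : 0 ≤ ‖y‖ ^ 2 * ‖w‖ ^ 2 - inner ℝ y w ^ 2 := by
  rw [← norm_cross_sq]; positivity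

lemma isCompact_solidAt {B : Set E3} (hB : IsCompact B) (h : ℝ) : IsCompact (solidAt B h) := by
  have e : solidAt B h = (fun x => x + h • e3) '' B := by
    ext x
    constructor
    · intro hx
      exact ⟨x - h • e3, hx, sub_add_cancel _ _⟩
    · rintro ⟨y, hy, rfl⟩
      change y + h • e3 - h • e3 ∈ B
      rwa [add_sub_cancel_right]
  rw [e]
  exact hB.image (by fun_prop)

lemma ofReal_mul_volume_solidAt {B : Set E3} (hB : IsCompact B) {r : ℝ} (hr : 0 ≤ r) (h : ℝ) :
    ENNReal.ofReal r * volume (solidAt B h) = ENNReal.ofReal (r * volume.real B) := by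
  rw [volume_solidAt, ← ENNReal.ofReal_toReal hB.measure_lt_top.ne, ← ENNReal.ofReal_mul hr,
    measureReal_def]

lemma Material.rpow_le_fluidEnergy {M : Material} (hγ : 1 < M.γ) (hcv : 0 < M.cv) {r s : ℝ} (hr : 0 ≤ r)
    (hs : 0 < s) : r ^ M.γ ≤ (M.γ - 1) * M.fluidEnergy r s := by
  have h1 : 0 < M.γ - 1 := by linarith
  have e : (M.γ - 1) * M.fluidEnergy r s
      = r ^ M.γ + (M.γ - 1) * (3 * s ^ 4 + M.cv * r * s) := by
    unfold Material.fluidEnergy; field_simp; ring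
  rw [e]
  have : 0 ≤ (M.γ - 1) * (3 * s ^ 4 + M.cv * r * s) := by positivity
  linarith

/-- The initial energy controls the momentum and the density. -/
lemma IsInitialData.bounds {Ω B : Set E3} {M : Material} {d : InitialData}
    (hd : IsInitialData Ω B M d) (hB : IsCompact B) (hγ : 1 < M.γ)
    (hcv : 0 < M.cv) (hρs : 0 < M.ρs) :
    0 ≤ initialEnergy Ω B M d ∧
    ∫⁻ x in Ω \ solidAt B d.h₀, ENNReal.ofReal (d.ρ₀ x ^ M.γ)
      ≤ ENNReal.ofReal (M.γ * initialEnergy Ω B M d) ∧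
    ∫⁻ x in Ω, ENNReal.ofReal (‖d.m₀ x‖ ^ 2 / d.ρ₀ x)
      ≤ ENNReal.ofReal (4 * initialEnergy Ω B M d) := by
  set S := solidAt B d.h₀ with hS
  have hSc : IsCompact S := isCompact_solidAt hB _
  have hle : volume.restrict (Ω \ S) ≤ volume.restrict Ω := Measure.restrict_mono sdiff_subset le_rfl
  have hρ0 : ∀ᵐ x ∂volume.restrict (Ω \ S), 0 ≤ d.ρ₀ x := ae_mono hle hd.rho_nonneg
  have hϑ0 : ∀ᵐ x ∂volume.restrict (Ω \ S), 0 < d.ϑ₀ x := ae_mono hle hd.temp_pos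
  set EF := ∫ x in Ω \ S, (‖d.m₀ x‖ ^ 2 / (2 * d.ρ₀ x) + M.fluidEnergy (d.ρ₀ x) (d.ϑ₀ x)) with hEF
  set m := solidMass B M with hm
  have hm0 : 0 ≤ m := mul_nonneg hρs.le measureReal_nonneg
  set J := inertiaForm B M.ρs d.h₀ d.ω₀ with hJ
  have hE : initialEnergy Ω B M d = EF + m / 2 * ‖d.V₀‖ ^ 2 + J / 2 := rfl
  have hint : IntegrableOn (fun x => ‖d.m₀ x‖ ^ 2 / (2 * d.ρ₀ x)
      + M.fluidEnergy (d.ρ₀ x) (d.ϑ₀ x)) (Ω \ S) := hd.kinetic_finite.add hd.internal_finite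
  have hγ1 : 0 < M.γ - 1 := by linarith
  have hpt : ∀ᵐ x ∂volume.restrict (Ω \ S), 0 ≤ ‖d.m₀ x‖ ^ 2 / (2 * d.ρ₀ x) ∧
      0 ≤ d.ρ₀ x ^ M.γ ∧ d.ρ₀ x ^ M.γ ≤ (M.γ - 1) * M.fluidEnergy (d.ρ₀ x) (d.ϑ₀ x) := by
    filter_upwards [hρ0, hϑ0] with x h1 h2
    exact ⟨by positivity, Real.rpow_nonneg h1 _, Material.rpow_le_fluidEnergy hγ hcv h1 h2⟩
  have hpt0 : ∀ᵐ x ∂volume.restrict (Ω \ S), 0 ≤ ‖d.m₀ x‖ ^ 2 / (2 * d.ρ₀ x)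
      + M.fluidEnergy (d.ρ₀ x) (d.ϑ₀ x) := by
    filter_upwards [hpt] with x hx
    have : 0 ≤ M.fluidEnergy (d.ρ₀ x) (d.ϑ₀ x) := by
      by_contra hcon
      nlinarith [hx.2.1, hx.2.2]
    linarith [hx.1]
  have hEF0 : 0 ≤ EF := integral_nonneg_of_ae hpt0
  have hEFl : ∫⁻ x in Ω \ S, ENNReal.ofReal (‖d.m₀ x‖ ^ 2 / (2 * d.ρ₀ x)
      + M.fluidEnergy (d.ρ₀ x) (d.ϑ₀ x)) = ENNReal.ofReal EF :=
    (ofReal_integral_eq_lintegral_ofReal hint hpt0).symm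
  set c := centerOfMass B d.h₀ with hc
  set f : E3 → ℝ := fun x => M.ρs * (‖x - c‖ ^ 2 * ‖d.ω₀‖ ^ 2 - inner ℝ (x - c) d.ω₀ ^ 2) with hf
  have hf0 : ∀ x, 0 ≤ f x := fun x => mul_nonneg hρs.le (inertia_nonneg _ _)
  have hJ0 : 0 ≤ J := integral_nonneg fun x => hf0 x
  have hfc : Continuous f := by fun_prop
  have hJl : ∫⁻ x in S, ENNReal.ofReal (f x) = ENNReal.ofReal J :=
    (ofReal_integral_eq_lintegral_ofReal (hfc.continuousOn.integrableOn_compact hSc)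
      (Eventually.of_forall hf0)).symm
  have hV : 0 ≤ m / 2 * ‖d.V₀‖ ^ 2 := by positivity
  have hE0 : 0 ≤ initialEnergy Ω B M d := by rw [hE]; positivity
  refine ⟨hE0, ?_, ?_⟩
  · calc ∫⁻ x in Ω \ S, ENNReal.ofReal (d.ρ₀ x ^ M.γ)
        ≤ ∫⁻ x in Ω \ S, ENNReal.ofReal (M.γ - 1) * ENNReal.ofReal (‖d.m₀ x‖ ^ 2 / (2 * d.ρ₀ x)
            + M.fluidEnergy (d.ρ₀ x) (d.ϑ₀ x)) := by
          refine lintegral_mono_ae ?_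
          filter_upwards [hpt] with x hx
          rw [← ENNReal.ofReal_mul hγ1.le]
          refine ENNReal.ofReal_le_ofReal ?_
          nlinarith [hx.1, hx.2.2]
      _ = ENNReal.ofReal ((M.γ - 1) * EF) := by
          rw [lintegral_const_mul' _ _ ENNReal.ofReal_ne_top, hEFl, ← ENNReal.ofReal_mul hγ1.le]
      _ ≤ _ := by
          refine ENNReal.ofReal_le_ofReal ?_
          have : EF ≤ initialEnergy Ω B M d := by rw [hE]; linarith
          nlinarith
  · have hF : ∫⁻ x in Ω \ S, ENNReal.ofReal (‖d.m₀ x‖ ^ 2 / d.ρ₀ x) ≤ ENNReal.ofReal (2 * EF) := by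
      rw [ENNReal.ofReal_mul zero_le_two, ← hEFl, ← lintegral_const_mul' _ _ ENNReal.ofReal_ne_top]
      refine lintegral_mono_ae ?_
      filter_upwards [hpt] with x hx
      rw [← ENNReal.ofReal_mul zero_le_two]
      refine ENNReal.ofReal_le_ofReal ?_
      have h1 : 0 ≤ M.fluidEnergy (d.ρ₀ x) (d.ϑ₀ x) := by
        by_contra hcon
        nlinarith [hx.2.1, hx.2.2]
      have h2 : ‖d.m₀ x‖ ^ 2 / d.ρ₀ x = 2 * (‖d.m₀ x‖ ^ 2 / (2 * d.ρ₀ x)) := by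
        rw [mul_comm 2 (d.ρ₀ x), ← div_div, mul_div_cancel₀ _ two_ne_zero]
      linarith
    have hSo : ∫⁻ x in S, ENNReal.ofReal (‖d.m₀ x‖ ^ 2 / d.ρ₀ x)
        ≤ ENNReal.ofReal (2 * m * ‖d.V₀‖ ^ 2) + ENNReal.ofReal (2 * J) := by
      calc ∫⁻ x in S, ENNReal.ofReal (‖d.m₀ x‖ ^ 2 / d.ρ₀ x)
          ≤ ∫⁻ x in S, (ENNReal.ofReal (2 * M.ρs * ‖d.V₀‖ ^ 2)
              + ENNReal.ofReal 2 * ENNReal.ofReal (f x)) := by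
            refine lintegral_mono_ae ?_
            filter_upwards [ae_restrict_mem hSc.measurableSet] with x hx
            have h2 : (0 : ℝ) ≤ 2 * M.ρs * ‖d.V₀‖ ^ 2 := by positivity
            rw [← ENNReal.ofReal_mul zero_le_two,
              ← ENNReal.ofReal_add h2 (by have := hf0 x; positivity)]
            refine ENNReal.ofReal_le_ofReal ?_
            have h3 := norm_add_cross_sq_le d.V₀ d.ω₀ (x - c)
            rw [hd.mom_solid x hx, hd.rho_solid x hx, norm_smul, Real.norm_of_nonneg hρs.le, mul_pow,
              sq M.ρs, mul_assoc, mul_div_cancel_left₀ _ hρs.ne']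
            simp only [hf]
            nlinarith
        _ = _ := by
            rw [lintegral_add_left measurable_const, setLIntegral_const,
              lintegral_const_mul' _ _ ENNReal.ofReal_ne_top, hJl,
              ofReal_mul_volume_solidAt hB (by positivity), ← ENNReal.ofReal_mul zero_le_two, hm,
              solidMass]
            congr 2; ring
    rw [← lintegral_inter_add_sdiff _ Ω hSc.measurableSet,
      inter_eq_self_of_subset_right hd.solid_inside]
    refine (add_le_add hSo hF).trans ?_
    rw [← ENNReal.ofReal_add (by positivity) (by positivity),
      ← ENNReal.ofReal_add (by positivity) (by positivity), hE]
    refine ENNReal.ofReal_le_ofReal ?_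
    linarith

end

section
open scoped NNReal ENNReal

/-! ### Estimates of the momentum equation on time slices -/

/-- The state of the fluid and the solid at one time: density `ρ`, velocity `u`, temperature `ϑ`, the
gradients `Du` of `u` and `Dz` of `ϑ ^ (β/2)`; the solid of density `ρs` occupies `S`, and `K` is the
bound of the energy. -/
structure IsState (Ω S : Set E3) (ρs γ β K : ℝ) (ρ : E3 → ℝ) (u : E3 → E3) (ϑ : E3 → ℝ)
    (Du : E3 → Matrix (Fin 3) (Fin 3) ℝ) (Dz : E3 → E3) : Prop where
  meas_rho : AEMeasurable ρ (volume.restrict Ω)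
  rho_nonneg : ∀ᵐ x ∂volume.restrict Ω, 0 ≤ ρ x
  rho_solid : ∀ᵐ x ∂volume.restrict S, ρ x = ρs
  density : ∫⁻ x in Ω \ S, ENNReal.ofReal (ρ x ^ γ) ≤ ENNReal.ofReal K
  kinetic : ∫⁻ x in Ω, ENNReal.ofReal (ρ x * ‖u x‖ ^ 2) ≤ ENNReal.ofReal K
  u_space : IsW0Grad Ω u Du
  meas_temp : AEMeasurable ϑ (volume.restrict Ω)
  temp_pos : ∀ᵐ x ∂volume.restrict Ω, 0 < ϑ x
  temp_space : HasWeakGradOn Ω (fun x => ϑ x ^ (β / 2)) Dz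

lemma abs_sum_sum_mul_le (u : E3) (A : Matrix (Fin 3) (Fin 3) ℝ) {a : ℝ} (hA : ∀ i j, |A i j| ≤ a) :
    |∑ i, ∑ j, u i * u j * A i j| ≤ 9 * (‖u‖ ^ 2 * a) := by
  have h := abs_frob_le (A := Matrix.of fun i j => u i * u j) (B := A) (a := ‖u‖ ^ 2) (b := a)
    (fun i j => by
      rw [Matrix.of_apply, sq]
      exact abs_mul_le_mul (abs_coord_le_norm u i) (abs_coord_le_norm u j)) hA
  simpa [frob] using h

variable {Ω S : Set E3} {ρs γ β K A m L : ℝ} {ρ G w : E3 → ℝ} {u : E3 → E3} {ϑ : E3 → ℝ}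
  {Du : E3 → Matrix (Fin 3) (Fin 3) ℝ} {Dz : E3 → E3} {c : ℝ≥0∞}

/-- The slice estimates of the fluid, applied to a state. -/
lemma IsState.fluid (hs : IsState Ω S ρs γ β K ρ u ϑ Du Dz) (hc : IsSliceConstant Ω G γ β A c)
    (hK : 1 ≤ K) :
    ∫⁻ x in Ω \ S, ENNReal.ofReal (ρ x * G x) ≤ c * ENNReal.ofReal (K ^ (1 / γ)) ∧
    (∀ w : E3 → ℝ, (∀ x, 0 ≤ w x) → (∀ᵐ x ∂volume.restrict (Ω \ S), w x ^ 3 ≤ A * G x) →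
      ∫⁻ x in Ω \ S, ENNReal.ofReal (ρ x * w x ^ 2) ≤ c * ENNReal.ofReal K) ∧
    ∫⁻ x in Ω \ S, ENNReal.ofReal (ρ x * ‖u x‖ ^ 2 * G x) ≤ c * ENNReal.ofReal (K ^ (1 / γ))
      * ∫⁻ x in Ω, ENNReal.ofReal (‖u x‖ ^ 2 + frob (Du x) (Du x)) := by
  have hle : volume.restrict (Ω \ S) ≤ volume.restrict Ω := Measure.restrict_mono sdiff_subset le_rfl
  obtain ⟨h1, h2, h3⟩ := hc.fluid (Ω \ S) sdiff_subset K hK ρ (hs.meas_rho.mono_measure hle)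
    (ae_mono hle hs.rho_nonneg) hs.density
  exact ⟨h1, h2, h3 u Du hs.u_space⟩

/-- The inertial terms of the momentum equation. -/
lemma IsState.lintegral_inertial_le (hs : IsState Ω S ρs γ β K ρ u ϑ Du Dz)
    (hc : IsSliceConstant Ω G γ β A c) (hΩ : MeasurableSet Ω) (hS : MeasurableSet S) (hSΩ : S ⊆ Ω)
    (hG0 : ∀ x, 0 ≤ G x) (hGm : Measurable G) (hA : 0 ≤ A) (hK : 1 ≤ K) (hγ : 0 < γ) (hm : 0 < m)
    (hms : ENNReal.ofReal ρs * volume S = ENNReal.ofReal m) (hL : L = √(K / m)) {z : ℝ}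
    {a : E3 → E3} {Q : E3 → Matrix (Fin 3) (Fin 3) ℝ} (hw0 : ∀ x, 0 ≤ w x)
    (hw : ∀ x ∈ Ω, w x ^ 3 ≤ A * G x) (hwS : ∀ x ∈ S, w x = 1)
    (ha : ∀ x ∈ Ω, ‖a x‖ ≤ |z| * w x + L * (A * G x)) (haS : ∀ x ∈ S, a x = z • e3)
    (hQ : ∀ x ∈ Ω, ∀ i j, |Q x i j| ≤ A * G x) (hQS : ∀ x ∈ S, Q x = 0) :
    ∫⁻ x in Ω, ‖ρ x * inner ℝ (u x) (a x) + ρ x * ∑ i, ∑ j, u x i * u x j * Q x i j‖ₑ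
      ≤ (2 + c) * (1 + ENNReal.ofReal (9 * A)) * ENNReal.ofReal (1 + √m + 1 / √m)
        * ENNReal.ofReal (K ^ (1 / γ)) * (‖z‖ₑ * ENNReal.ofReal K + ENNReal.ofReal K
          + ∫⁻ x in Ω, ENNReal.ofReal (‖u x‖ ^ 2 + frob (Du x) (Du x))) := by
  obtain ⟨f1, f2, f3⟩ := hs.fluid hc hK
  set D := ∫⁻ x in Ω, ENNReal.ofReal (‖u x‖ ^ 2 + frob (Du x) (Du x)) with hD
  have hsm : 0 < √m := Real.sqrt_pos.2 hm
  have hum : AEMeasurable (fun x => ‖u x‖) (volume.restrict Ω) := hs.u_space.1.1.norm.aemeasurable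
  have hK0 : 0 < K := by linarith
  have hA' : 0 ≤ A / √m := by positivity
  -- the part that contains the time derivative of the cutoff
  have hpair : ∫⁻ x in Ω, ENNReal.ofReal (ρ x * ‖u x‖ * w x)
      ≤ (2 + c) * ENNReal.ofReal ((1 + √m) * K) := by
    refine lintegral_momentum_mul_le (e := fun x => ρ x * ‖u x‖ ^ 2) (n := fun x => ρ x * ‖u x‖)
      hS hSΩ hm hK hms ?_ hw0 hs.rho_solid hwS (hs.meas_rho.mul (hum.pow_const 2)) hs.kinetic
      (f2 w hw0 ?_)
    · filter_upwards [hs.rho_nonneg] with x hx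
      exact ⟨by positivity, hx, by positivity, le_of_eq (by ring)⟩
    · exact (ae_restrict_iff' (hΩ.diff hS)).2 (Eventually.of_forall fun x hx => hw x hx.1)
  set g1 : E3 → ℝ≥0∞ := fun x => ENNReal.ofReal (A / √m * K) * ENNReal.ofReal (ρ x * G x) with hg1
  set g2 : E3 → ℝ≥0∞ := fun x => ENNReal.ofReal (A / √m + 9 * A)
    * ENNReal.ofReal (ρ x * ‖u x‖ ^ 2 * G x) with hg2
  have mg1 : AEMeasurable g1 (volume.restrict Ω) :=
    (hs.meas_rho.mul hGm.aemeasurable).ennreal_ofReal.const_mul _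
  have mg2 : AEMeasurable g2 (volume.restrict Ω) :=
    ((hs.meas_rho.mul (hum.pow_const 2)).mul hGm.aemeasurable).ennreal_ofReal.const_mul _
  have hpt : ∀ᵐ x ∂volume.restrict Ω,
      ‖ρ x * inner ℝ (u x) (a x) + ρ x * ∑ i, ∑ j, u x i * u x j * Q x i j‖ₑ
      ≤ ‖z‖ₑ * ENNReal.ofReal (ρ x * ‖u x‖ * w x) + (Ω \ S).indicator (fun x => g1 x + g2 x) x := by
    filter_upwards [hs.rho_nonneg, ae_restrict_mem hΩ] with x hρ hxΩ
    have hin : |ρ x * inner ℝ (u x) (a x)| ≤ ρ x * (‖u x‖ * ‖a x‖) := by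
      rw [abs_mul, abs_of_nonneg hρ]
      exact mul_le_mul_of_nonneg_left (abs_real_inner_le_norm _ _) hρ
    rw [Real.enorm_eq_ofReal_abs, Real.enorm_eq_ofReal_abs]
    by_cases hxS : x ∈ S
    · rw [indicator_of_notMem (fun h => h.2 hxS), add_zero, ← ENNReal.ofReal_mul (abs_nonneg _),
        hQS x hxS, hwS x hxS]
      refine ENNReal.ofReal_le_ofReal ?_
      simp only [Matrix.zero_apply, mul_zero, Finset.sum_const_zero, add_zero, mul_one]
      refine hin.trans (le_of_eq ?_)
      rw [haS x hxS, norm_smul, norm_e3, Real.norm_eq_abs]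
      ring
    · rw [indicator_of_mem (show x ∈ Ω \ S from ⟨hxΩ, hxS⟩)]
      simp only [hg1, hg2]
      have hGx := hG0 x
      have hwx := hw0 x
      rw [← ENNReal.ofReal_mul (abs_nonneg _), ← ENNReal.ofReal_mul (by positivity),
        ← ENNReal.ofReal_mul (by positivity), ← ENNReal.ofReal_add (by positivity) (by positivity),
        ← ENNReal.ofReal_add (by positivity) (by positivity)]
      refine ENNReal.ofReal_le_ofReal ?_
      have h2 : |ρ x * ∑ i, ∑ j, u x i * u x j * Q x i j| ≤ ρ x * (9 * (‖u x‖ ^ 2 * (A * G x))) := by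
        rw [abs_mul, abs_of_nonneg hρ]
        exact mul_le_mul_of_nonneg_left (abs_sum_sum_mul_le _ _ (hQ x hxΩ)) hρ
      have h3 : ρ x * (‖u x‖ * ‖a x‖) ≤ ρ x * (‖u x‖ * (|z| * w x + L * (A * G x))) := by
        have := ha x hxΩ
        gcongr
      -- the speed of the body is absorbed by `√K |u| ≤ K + |u|²`
      have h4 : L * ‖u x‖ ≤ (K + ‖u x‖ ^ 2) / √m := by
        rw [hL, Real.sqrt_div hK0.le, div_mul_eq_mul_div]
        refine div_le_div_of_nonneg_right ?_ hsm.le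
        have := Real.sq_sqrt hK0.le
        nlinarith [sq_nonneg (√K - ‖u x‖), sq_nonneg (√K + ‖u x‖)]
      have h5 : ρ x * (A * G x) * (L * ‖u x‖) ≤ ρ x * (A * G x) * ((K + ‖u x‖ ^ 2) / √m) :=
        mul_le_mul_of_nonneg_left h4 (by positivity)
      calc |ρ x * inner ℝ (u x) (a x) + ρ x * ∑ i, ∑ j, u x i * u x j * Q x i j|
          ≤ ρ x * (‖u x‖ * (|z| * w x + L * (A * G x))) + ρ x * (9 * (‖u x‖ ^ 2 * (A * G x))) :=
            (abs_add_le _ _).trans (add_le_add (hin.trans h3) h2)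
        _ = |z| * (ρ x * ‖u x‖ * w x) + ρ x * (A * G x) * (L * ‖u x‖)
            + 9 * A * (ρ x * ‖u x‖ ^ 2 * G x) := by ring
        _ ≤ |z| * (ρ x * ‖u x‖ * w x) + ρ x * (A * G x) * ((K + ‖u x‖ ^ 2) / √m)
            + 9 * A * (ρ x * ‖u x‖ ^ 2 * G x) := by linarith
        _ = _ := by ring
  have hQ1 : 1 ≤ ENNReal.ofReal (K ^ (1 / γ)) :=
    ENNReal.one_le_ofReal.2 (Real.one_le_rpow hK (by positivity))
  set q := ENNReal.ofReal (K ^ (1 / γ)) with hq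
  set s := ENNReal.ofReal (1 + √m + 1 / √m) with hsdef
  have hinv : 0 < 1 / √m := by positivity
  have s1 : ENNReal.ofReal ((1 + √m) * K) ≤ s * ENNReal.ofReal K := by
    rw [hsdef, ← ENNReal.ofReal_mul (by positivity)]
    exact ENNReal.ofReal_le_ofReal (mul_le_mul_of_nonneg_right (by linarith) hK0.le)
  have s2 : ENNReal.ofReal (A / √m * K) ≤ ENNReal.ofReal (9 * A) * s * ENNReal.ofReal K := by
    rw [hsdef, ← ENNReal.ofReal_mul (by positivity), ← ENNReal.ofReal_mul (by positivity)]
    refine ENNReal.ofReal_le_ofReal (mul_le_mul_of_nonneg_right ?_ hK0.le)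
    have e : A / √m = A * (1 / √m) := by ring
    rw [e]
    nlinarith [mul_nonneg hA hinv.le, mul_nonneg hA hsm.le]
  have s3 : ENNReal.ofReal (A / √m + 9 * A) ≤ ENNReal.ofReal (9 * A) * s := by
    rw [hsdef, ← ENNReal.ofReal_mul (by positivity)]
    refine ENNReal.ofReal_le_ofReal ?_
    have e : A / √m = A * (1 / √m) := by ring
    rw [e]
    nlinarith [mul_nonneg hA hinv.le, mul_nonneg hA hsm.le]
  have hfl : ∫⁻ x in Ω, (Ω \ S).indicator (fun x => g1 x + g2 x) x
      ≤ ENNReal.ofReal (A / √m * K) * (c * q) + ENNReal.ofReal (A / √m + 9 * A) * (c * q * D) := by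
    rw [lintegral_indicator (hΩ.diff hS), Measure.restrict_restrict (hΩ.diff hS),
      inter_eq_self_of_subset_left sdiff_subset, lintegral_add_left'
        (mg1.mono_measure (Measure.restrict_mono sdiff_subset le_rfl)),
      lintegral_const_mul' _ _ ENNReal.ofReal_ne_top, lintegral_const_mul' _ _ ENNReal.ofReal_ne_top]
    gcongr
  calc ∫⁻ x in Ω, ‖ρ x * inner ℝ (u x) (a x) + ρ x * ∑ i, ∑ j, u x i * u x j * Q x i j‖ₑ
      ≤ ‖z‖ₑ * ((2 + c) * (s * ENNReal.ofReal K))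
        + (ENNReal.ofReal (9 * A) * s * ENNReal.ofReal K * (c * q)
          + ENNReal.ofReal (9 * A) * s * (c * q * D)) := by
        refine (lintegral_mono_ae hpt).trans ?_
        have mi : AEMeasurable ((Ω \ S).indicator fun x => g1 x + g2 x) (volume.restrict Ω) :=
          (mg1.add mg2).indicator (hΩ.diff hS)
        rw [lintegral_add_right' _ mi, lintegral_const_mul' _ _ enorm_ne_top]
        refine add_le_add (mul_le_mul_right (hpair.trans (mul_le_mul_right s1 _)) _) ?_
        refine hfl.trans (add_le_add (mul_le_mul_left s2 _) (mul_le_mul_left s3 _))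
    _ ≤ ‖z‖ₑ * ((2 + c) * (s * ENNReal.ofReal K)) * q
        + (ENNReal.ofReal (9 * A) * s * ENNReal.ofReal K * ((2 + c) * q)
          + ENNReal.ofReal (9 * A) * s * ((2 + c) * q * D)) := by
        have hc2 : c ≤ 2 + c := le_add_self
        refine add_le_add (le_mul_of_one_le_right' hQ1) (add_le_add ?_ ?_) <;> gcongr
    _ ≤ (‖z‖ₑ * ((2 + c) * (s * ENNReal.ofReal K)) * q
        + (ENNReal.ofReal (9 * A) * s * ENNReal.ofReal K * ((2 + c) * q)
          + ENNReal.ofReal (9 * A) * s * ((2 + c) * q * D)))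
        + ((2 + c) * s * q * (ENNReal.ofReal K + D)
          + (2 + c) * ENNReal.ofReal (9 * A) * s * q * (‖z‖ₑ * ENNReal.ofReal K)) := le_self_add
    _ = _ := by ring

/-- The viscous term of the momentum equation. -/
lemma IsState.lintegral_viscous_le {M : Material} (hs : IsState Ω S ρs γ β K ρ u ϑ Du Dz)
    (hc : IsSliceConstant Ω G γ β A c) (hΩ : MeasurableSet Ω) (hA : 0 ≤ A)
    {V : ℝ} (hV0 : 0 ≤ V) (hV : ∀ s > 0, 0 ≤ M.μ s ∧ M.μ s ≤ V * (1 + s) ∧ 0 ≤ M.η s ∧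
      M.η s ≤ V * (1 + s)) {Q : E3 → Matrix (Fin 3) (Fin 3) ℝ}
    (hQ : ∀ x ∈ Ω, ∀ i j, |Q x i j| ≤ A * G x) :
    ∫⁻ x in Ω \ S, ‖frob (M.stress (ϑ x) (Du x)) (Q x)‖ₑ
      ≤ ENNReal.ofReal (63 * V * A) * (c * (1
        + (∫⁻ x in Ω, ENNReal.ofReal (‖u x‖ ^ 2 + frob (Du x) (Du x)))
        + ∫⁻ x in Ω, ENNReal.ofReal ((ϑ x ^ (β / 2)) ^ 2 + ‖Dz x‖ ^ 2))) := by
  refine (lintegral_mono_set sdiff_subset).trans ?_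
  refine le_trans ?_ (mul_le_mul_right (hc.dissipation u Du hs.u_space ϑ hs.meas_temp hs.temp_pos Dz
    hs.temp_space) _)
  rw [← lintegral_const_mul' _ _ ENNReal.ofReal_ne_top]
  refine lintegral_mono_ae ?_
  filter_upwards [hs.temp_pos, ae_restrict_mem hΩ] with x hx hxΩ
  rw [Real.enorm_eq_ofReal_abs, ← ENNReal.ofReal_mul (by positivity)]
  refine ENNReal.ofReal_le_ofReal ?_
  refine (abs_frob_le (abs_stress_le (hV _ hx) (Du x)) (hQ x hxΩ)).trans (le_of_eq ?_)
  ring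

/-- The gravity term of the momentum equation in the fluid. -/
lemma IsState.lintegral_gravity_le (hs : IsState Ω S ρs γ β K ρ u ϑ Du Dz)
    (hc : IsSliceConstant Ω G γ β A c) (hΩ : MeasurableSet Ω) (hS : MeasurableSet S)
    (hA : 0 ≤ A) (hK : 1 ≤ K) {g : ℝ} (hg : 0 ≤ g) {f : E3 → E3} (hf : ∀ x ∈ Ω, ‖f x‖ ≤ A * G x) :
    ∫⁻ x in Ω \ S, ‖ρ x * inner ℝ (-g • e3) (f x)‖ₑ
      ≤ ENNReal.ofReal (g * A) * (c * ENNReal.ofReal (K ^ (1 / γ))) := by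
  refine le_trans ?_ (mul_le_mul_right (hs.fluid hc hK).1 _)
  rw [← lintegral_const_mul' _ _ ENNReal.ofReal_ne_top]
  refine lintegral_mono_ae ?_
  filter_upwards [ae_restrict_of_ae_restrict_of_subset sdiff_subset hs.rho_nonneg,
    ae_restrict_mem (hΩ.diff hS)] with x hx hxΩ
  rw [Real.enorm_eq_ofReal_abs, ← ENNReal.ofReal_mul (by positivity)]
  refine ENNReal.ofReal_le_ofReal ?_
  rw [abs_mul, abs_of_nonneg hx]
  have h1 := abs_real_inner_le_norm (-g • e3) (f x)
  rw [norm_smul, norm_e3, mul_one, norm_neg, Real.norm_of_nonneg hg] at h1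
  have h2 := mul_le_mul_of_nonneg_left (hf x hxΩ.1) hg
  have h3 := mul_le_mul_of_nonneg_left (h1.trans h2) hx
  linarith

end

section
open scoped NNReal ENNReal

/-! ### The momentum balance of the heavy solid -/

variable {Ω B : Set E3} {M : Material} {T T₂ K K' γ β : ℝ} {d : InitialData} {s : Motion}

lemma IsWeakSolution.exists_continuous_height (hs : IsWeakSolution Ω B M T d s) :
    ∃ k : ℝ → ℝ, Continuous k ∧ ∀ t ∈ Ico 0 T, k t = s.h t := by
  have hi : Integrable ((Ioo 0 T).indicator s.v) := hs.speed_int.integrable_indicator measurableSet_Ioo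
  refine ⟨fun t => d.h₀ + ∫ τ in (0 : ℝ)..t, (Ioo 0 T).indicator s.v τ,
    continuous_const.add (intervalIntegral.continuous_primitive (fun a b => hi.intervalIntegrable) 0),
    fun t ht => ?_⟩
  rw [hs.height_eq t ht]
  dsimp only
  congr 1
  rw [intervalIntegral.integral_of_le ht.1, intervalIntegral.integral_of_le ht.1]
  refine setIntegral_congr_fun measurableSet_Ioc fun τ hτ => ?_
  exact indicator_of_mem (show τ ∈ Ioo 0 T from ⟨hτ.1, hτ.2.trans_lt ht.2⟩) _

/-- Almost every time slice of a weak solution is a state in the sense of `IsState`, and the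
dissipative quantities are integrable in time. -/
lemma IsWeakSolution.exists_ae_isState (hs : IsWeakSolution Ω B M T d s)
    (hb : UniformBounds Ω B γ β T s K') (hK : K' ≤ K) :
    ∃ Dz : ℝ → E3 → E3,
      (∀ᵐ t ∂volume.restrict (Ioo 0 T), IsState Ω (solidAt B (s.h t)) M.ρs γ β K (s.ρ t) (s.u t)
        (s.ϑ t) (s.Du t) (Dz t)) ∧
      AEMeasurable (fun t => ∫⁻ x in Ω,
        ENNReal.ofReal (‖s.u t x‖ ^ 2 + frob (s.Du t x) (s.Du t x))) (volume.restrict (Ioo 0 T)) ∧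
      ∫⁻ t in Ioo 0 T, ∫⁻ x in Ω,
        ENNReal.ofReal (‖s.u t x‖ ^ 2 + frob (s.Du t x) (s.Du t x)) ≤ ENNReal.ofReal K ∧
      ∫⁻ t in Ioo 0 T, ∫⁻ x in Ω, ENNReal.ofReal ((s.ϑ t x ^ (β / 2)) ^ 2 + ‖Dz t x‖ ^ 2)
        ≤ ENNReal.ofReal K := by
  obtain ⟨Dz, hDz, hDzs, hDzi⟩ := hb.temperature
  have hKK : ENNReal.ofReal K' ≤ ENNReal.ofReal K := ENNReal.ofReal_le_ofReal hK
  have mρ := hs.meas_rho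
  have mu := hs.meas_u
  have mt := hs.meas_temp
  have mDu := hs.meas_Du
  have h0 := hs.rho_nonneg
  have h1 := hs.temp_pos
  have hv := hb.velocity
  rw [volume_restrict_cyl] at mρ mu mt h0 h1 hv hDz hDzi
  simp only [volume_restrict_cyl] at mDu
  have mD : AEMeasurable (fun p : ℝ × E3 =>
      ENNReal.ofReal (‖s.u p.1 p.2‖ ^ 2 + frob (s.Du p.1 p.2) (s.Du p.1 p.2)))
      ((volume.restrict (Ioo 0 T)).prod (volume.restrict Ω)) := by
    refine ((mu.norm.aemeasurable.pow_const 2).add ?_).ennreal_ofReal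
    refine Finset.aemeasurable_fun_sum _ fun i _ => Finset.aemeasurable_fun_sum _ fun j _ => ?_
    exact (mDu i j).aemeasurable.mul (mDu i j).aemeasurable
  refine ⟨Dz, ?_, mD.lintegral_prod_right', ?_, ?_⟩
  · filter_upwards [mρ.prodMk_left, mt.prodMk_left, Measure.ae_ae_of_ae_prod h0,
      Measure.ae_ae_of_ae_prod h1, hs.rho_solid, hb.density, hb.kinetic, hs.u_space, hDzs]
      with t a1 a2 a3 a4 a5 a6 a7 a8 a9
    exact ⟨a1.aemeasurable, a3, a5, a6.trans hKK, a7.trans hKK, a8, a2.aemeasurable, a4, a9⟩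
  · rw [lintegral_prod _ mD] at hv
    exact hv.trans hKK
  · rw [lintegral_prod] at hDzi
    · exact hDzi.trans hKK
    · exact (((mt.aemeasurable.pow_const _).pow_const 2).add
        (hDz.norm.aemeasurable.pow_const 2)).ennreal_ofReal

/-- A lower bound of a function in the solid gives a lower bound of its integral over the space-time
region occupied by the solid. -/
lemma le_lintegral_solidCyl {h : ℝ → ℝ} {T₁ : ℝ} (hB : IsClosed B)
    (hF : MeasurableSet (fluidCyl Ω B h T₂)) (hΩ : MeasurableSet Ω) (h12 : T₁ ≤ T₂)
    (hsub : ∀ t ∈ Icc 0 T₂, solidAt B (h t) ⊆ Ω) {f : ℝ × E3 → ℝ≥0∞} {c : ℝ≥0∞}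
    (hfm : AEMeasurable f (volume.restrict (cyl Ω T₂)))
    (hf : ∀ᵐ t ∂volume.restrict (Ioo 0 T₁), ∀ᵐ x ∂volume.restrict (solidAt B (h t)), c ≤ f (t, x)) :
    c * volume B * ENNReal.ofReal T₁ ≤ ∫⁻ p in cyl Ω T₂ \ fluidCyl Ω B h T₂, f p := by
  have hC : MeasurableSet (cyl Ω T₂) := measurableSet_Ioo.prod hΩ
  have hSC := hC.diff hF
  have e : ∫⁻ p in cyl Ω T₂ \ fluidCyl Ω B h T₂, f p
      = ∫⁻ t in Ioo 0 T₂, ∫⁻ x in Ω, (cyl Ω T₂ \ fluidCyl Ω B h T₂).indicator f (t, x) := by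
    rw [← lintegral_prod, ← volume_restrict_cyl, lintegral_indicator hSC,
      Measure.restrict_restrict hSC, inter_eq_self_of_subset_left sdiff_subset]
    rw [← volume_restrict_cyl]
    exact hfm.indicator hSC
  rw [e]
  calc c * volume B * ENNReal.ofReal T₁ = ∫⁻ _ in Ioo 0 T₁, c * volume B := by
        rw [setLIntegral_const, Real.volume_Ioo, sub_zero]
    _ ≤ ∫⁻ t in Ioo 0 T₁, ∫⁻ x in Ω, (cyl Ω T₂ \ fluidCyl Ω B h T₂).indicator f (t, x) := by
        refine lintegral_mono_ae ?_
        filter_upwards [hf, ae_restrict_mem measurableSet_Ioo] with t ht htI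
        refine le_trans ?_ (lintegral_mono_set (hsub t ⟨htI.1.le, htI.2.le.trans h12⟩))
        rw [← volume_solidAt B (h t), ← setLIntegral_const]
        refine lintegral_mono_ae ?_
        filter_upwards [ht, ae_restrict_mem (isClosed_solidAt hB (h t)).measurableSet] with x hx hxS
        rw [indicator_of_mem]
        · exact hx
        · exact ⟨⟨⟨htI.1, htI.2.trans_le h12⟩, hsub t ⟨htI.1.le, htI.2.le.trans h12⟩ hxS⟩,
            fun hc => hc.2.2 hxS⟩
    _ ≤ _ := lintegral_mono_set (Ioo_subset_Ioo le_rfl h12)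

end

section
open scoped NNReal ENNReal

variable {Ω B : Set E3} {M : Material} {T T₁ T₂ K K' β A m : ℝ} {d : InitialData} {s : Motion}
  {G : E3 → ℝ} {c : ℝ≥0∞} {φ : ℝ × E3 → E3} {ζ : ℝ → ℝ} {w : ℝ × E3 → ℝ}

/-- The momentum equation tested with an adapted field: the weight of the solid is balanced by the
inertial, viscous, gravitational and initial contributions of the mixture. -/
lemma IsWeakSolution.exists_weight_le (hs : IsWeakSolution Ω B M T d s) (hΩ : MeasurableSet Ω)
    (hB : IsCompact B) (hg : 0 ≤ M.g) (h12 : T₁ < T₂) (h2T : T₂ < T)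
    (hF : ∀ r ≤ T, MeasurableSet (fluidCyl Ω B s.h r))
    (hsub : ∀ t ∈ Icc 0 T₂, solidAt B (s.h t) ⊆ Ω) {L : ℝ}
    (hφ : IsAdaptedField Ω B s.h T T₁ T₂ L A G φ ζ w) :
    ENNReal.ofReal (M.g * M.ρs) * volume B * ENNReal.ofReal T₁
      ≤ (∫⁻ t in Ioo 0 T₂, ∫⁻ x in Ω, ‖s.ρ t x * inner ℝ (s.u t x) (dt φ (t, x))
          + s.ρ t x * ∑ i, ∑ j, s.u t x i * s.u t x j * gradMat φ (t, x) i j‖ₑ)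
        + (∫⁻ t in Ioo 0 T₂, ∫⁻ x in Ω \ solidAt B (s.h t),
          ‖frob (M.stress (s.ϑ t x) (s.Du t x)) (gradMat φ (t, x))‖ₑ)
        + (∫⁻ t in Ioo 0 T₂, ∫⁻ x in Ω \ solidAt B (s.h t),
          ‖s.ρ t x * inner ℝ (-M.g • e3) (φ (t, x))‖ₑ)
        + ∫⁻ x in Ω, ‖inner ℝ (d.m₀ x) (φ (0, x))‖ₑ := by
  have hFT : MeasurableSet (fluidCyl Ω B s.h T) := hF T le_rfl
  have hF2 : MeasurableSet (fluidCyl Ω B s.h T₂) := hF T₂ h2T.le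
  set f1 : ℝ × E3 → ℝ := fun p => s.ρ p.1 p.2 * inner ℝ (s.u p.1 p.2) (dt φ p)
    + s.ρ p.1 p.2 * ∑ i, ∑ j, s.u p.1 p.2 i * s.u p.1 p.2 j * gradMat φ p i j with hf1
  set f2 : ℝ × E3 → ℝ := fun p => frob (M.stress (s.ϑ p.1 p.2) (s.Du p.1 p.2)) (gradMat φ p) with hf2
  set f3 : ℝ × E3 → ℝ := fun p => s.ρ p.1 p.2 * inner ℝ (-M.g • e3) (φ p) with hf3
  set f4 : E3 → ℝ := fun x => inner ℝ (d.m₀ x) (φ (0, x)) with hf4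
  have hlate : ∀ p : ℝ × E3, T₂ < p.1 → φ p = 0 ∧ dt φ p = 0 ∧ gradMat φ p = 0 := fun p hp => by
    obtain ⟨h1, h2⟩ := hφ.late p.1 p.2 hp
    refine ⟨h1, ?_, ?_⟩
    · rw [dt, h2]; rfl
    · ext i j
      rw [gradMat, Matrix.of_apply, dx, h2]; rfl
  have hmom := hs.momentum φ hφ.test hφ.rigid
  have e1 : ∫ p in cyl Ω T, f1 p = ∫ p in cyl Ω T₂, f1 p :=
    setIntegral_cyl_of_late hΩ h2T.le fun p hp => by
      obtain ⟨-, h2, h3⟩ := hlate p hp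
      simp [hf1, h2, h3]
  have e2 : ∫ p in fluidCyl Ω B s.h T, (M.pressure (s.ρ p.1 p.2) (s.ϑ p.1 p.2) * (gradMat φ p).trace
        - frob (M.stress (s.ϑ p.1 p.2) (s.Du p.1 p.2)) (gradMat φ p))
      = -∫ p in fluidCyl Ω B s.h T₂, f2 p := by
    rw [← integral_neg, ← setIntegral_fluidCyl_of_late h2T.le hFT]
    · refine integral_congr_ae (Eventually.of_forall fun p => ?_)
      simp only [hf2]
      rw [hφ.solenoidal p, mul_zero, zero_sub]
    · intro p hp
      simp [hf2, (hlate p hp).2.2, frob]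
  have e3' : ∫ p in cyl Ω T, f3 p = ∫ p in cyl Ω T₂, f3 p :=
    setIntegral_cyl_of_late hΩ h2T.le fun p hp => by simp [hf3, (hlate p hp).1]
  have hcyl : cyl Ω T₂ ⊆ cyl Ω T := prod_mono (Ioo_subset_Ioo le_rfl h2T.le) le_rfl
  have hφc : Continuous φ := hφ.test.1.continuous
  have i3 : IntegrableOn f3 (cyl Ω T₂) := by
    obtain ⟨P, hP⟩ := hφc.bounded_above_of_compact_support hφ.test.2.1
    refine (hs.int_rho.mono_set hcyl).mul_bdd (c := M.g * P) ?_ (Eventually.of_forall fun p => ?_)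
    · exact (continuous_const.inner hφc).aestronglyMeasurable
    · refine (abs_real_inner_le_norm _ _).trans ?_
      rw [norm_smul, norm_e3, mul_one, norm_neg, Real.norm_of_nonneg hg]
      exact mul_le_mul_of_nonneg_left (hP p) hg
  have hsplit : ∫ p in cyl Ω T₂, f3 p = (∫ p in fluidCyl Ω B s.h T₂, f3 p)
      + ∫ p in cyl Ω T₂ \ fluidCyl Ω B s.h T₂, f3 p := by
    have hFs : fluidCyl Ω B s.h T₂ ⊆ cyl Ω T₂ := fun p hp => ⟨hp.1, hp.2.1⟩
    rw [← integral_inter_add_sdiff hF2 i3, inter_eq_self_of_subset_right hFs]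
  set P := ∫ p in cyl Ω T₂ \ fluidCyl Ω B s.h T₂, -f3 p with hP
  have hPe : P = (∫ p in cyl Ω T₂, f1 p) + -(∫ p in fluidCyl Ω B s.h T₂, f2 p)
      + (∫ p in fluidCyl Ω B s.h T₂, f3 p) + ∫ x in Ω, f4 x := by
    rw [e1, e2, e3', hsplit] at hmom
    rw [hP, integral_neg]
    linarith
  -- in the solid the field is vertical, so that gravity contributes the weight of the solid
  have hweight : ∀ t ∈ Icc 0 T₂, ∀ x ∈ solidAt B (s.h t), -f3 (t, x) = M.g * s.ρ t x * ζ t :=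
    fun t ht x hx => by
      simp only [hf3]
      rw [(hφ.solid t ht x hx).1, real_inner_smul_left, real_inner_smul_right,
        real_inner_self_eq_norm_sq, norm_e3]
      ring
  have hlow : ENNReal.ofReal (M.g * M.ρs) * volume B * ENNReal.ofReal T₁ ≤ ENNReal.ofReal P := by
    have i3n : IntegrableOn (fun p => -f3 p) (cyl Ω T₂ \ fluidCyl Ω B s.h T₂) :=
      (i3.mono_set sdiff_subset).neg
    rw [hP, ofReal_integral_eq_lintegral_ofReal i3n]
    · refine le_lintegral_solidCyl hB.isClosed hF2 hΩ h12.le hsub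
        i3.neg.aestronglyMeasurable.aemeasurable.ennreal_ofReal ?_
      filter_upwards [ae_restrict_of_ae_restrict_of_subset
        (Ioo_subset_Ioo le_rfl (h12.trans h2T).le) hs.rho_solid, ae_restrict_mem measurableSet_Ioo]
        with t ht htI
      filter_upwards [ht, ae_restrict_mem (isClosed_solidAt hB.isClosed (s.h t)).measurableSet]
        with x hx hxS
      have h1 := hweight t ⟨htI.1.le, (htI.2.trans h12).le⟩ x hxS
      rw [hφ.cutoff_one t htI.1.le htI.2.le, mul_one, hx] at h1
      exact ENNReal.ofReal_le_ofReal h1.ge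
    · have hmeas : MeasurableSet (cyl Ω T₂ \ fluidCyl Ω B s.h T₂) :=
        (measurableSet_Ioo.prod hΩ).diff hF2
      filter_upwards [ae_restrict_of_ae_restrict_of_subset (sdiff_subset.trans hcyl) hs.rho_nonneg,
        ae_restrict_mem hmeas] with p hp hpm
      have hpS : p.2 ∈ solidAt B (s.h p.1) := by
        by_contra hcon
        exact hpm.2 ⟨hpm.1.1, hpm.1.2, hcon⟩
      have h1 := hweight p.1 (Ioo_subset_Icc_self hpm.1.1) p.2 hpS
      change 0 ≤ -f3 (p.1, p.2)
      rw [h1]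
      have := hφ.cutoff_nonneg p.1
      positivity
  refine hlow.trans ((Real.ofReal_le_enorm P).trans ?_)
  rw [hPe]
  refine (enorm_add_le _ _).trans (add_le_add ((enorm_add_le _ _).trans
    (add_le_add ((enorm_add_le _ _).trans (add_le_add ?_ ?_)) ?_)) ?_)
  · exact (enorm_integral_le_lintegral_enorm _).trans (lintegral_cyl_le _ _ _)
  · rw [enorm_neg]
    exact (enorm_integral_le_lintegral_enorm _).trans (lintegral_fluidCyl_le hΩ hB.isClosed hF2 _)
  · exact (enorm_integral_le_lintegral_enorm _).trans (lintegral_fluidCyl_le hΩ hB.isClosed hF2 _)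
  · exact enorm_integral_le_lintegral_enorm _

/-- The initial momentum paired with an adapted field. -/
lemma IsInitialData.lintegral_momentum_le (hd : IsInitialData Ω B M d) (hΩ : MeasurableSet Ω)
    (hB : IsCompact B) (hγ : 1 < M.γ) (hcv : 0 < M.cv) (hρs : 0 < M.ρs)
    (hm : m = solidMass B M) (hm0 : 0 < m) (hK1 : 1 ≤ K)
    (hE : (4 + M.γ) * initialEnergy Ω B M d ≤ K) {w : E3 → ℝ} (hw0 : ∀ x, 0 ≤ w x)
    (hw : ∀ x ∈ Ω, w x ^ 3 ≤ A * G x) (hwS : ∀ x ∈ solidAt B d.h₀, w x = 1)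
    (hc : IsSliceConstant Ω G M.γ β A c) {f : E3 → E3} (hf : ∀ x, ‖f x‖ ≤ w x) :
    ∫⁻ x in Ω, ‖inner ℝ (d.m₀ x) (f x)‖ₑ ≤ (2 + c) * ENNReal.ofReal ((1 + √m) * K) := by
  obtain ⟨hE0, hE1, hE2⟩ := hd.bounds hB hγ hcv hρs
  have hS : MeasurableSet (solidAt B d.h₀) := (isClosed_solidAt hB.isClosed _).measurableSet
  have hle : volume.restrict (Ω \ solidAt B d.h₀) ≤ volume.restrict Ω :=
    Measure.restrict_mono sdiff_subset le_rfl
  calc ∫⁻ x in Ω, ‖inner ℝ (d.m₀ x) (f x)‖ₑ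
      ≤ ∫⁻ x in Ω, ENNReal.ofReal (‖d.m₀ x‖ * w x) := by
        refine lintegral_mono fun x => ?_
        rw [Real.enorm_eq_ofReal_abs]
        refine ENNReal.ofReal_le_ofReal ((abs_real_inner_le_norm _ _).trans ?_)
        exact mul_le_mul_of_nonneg_left (hf x) (norm_nonneg _)
    _ ≤ _ := by
        refine lintegral_momentum_mul_le (ρs := M.ρs) (ρ := d.ρ₀)
          (e := fun x => ‖d.m₀ x‖ ^ 2 / d.ρ₀ x) hS hd.solid_inside hm0 hK1 ?_ ?_ hw0 ?_ hwS ?_ ?_ ?_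
        · rw [ofReal_mul_volume_solidAt hB hρs.le, hm]; rfl
        · filter_upwards [hd.rho_nonneg, hd.mom_vacuum] with x h1 h2
          refine ⟨norm_nonneg _, h1, by positivity, ?_⟩
          rcases eq_or_ne (d.ρ₀ x) 0 with h0 | h0
          · rw [h2 h0]; simp
          · rw [mul_div_cancel₀ _ h0]
        · exact (ae_restrict_iff' hS).2 (Eventually.of_forall hd.rho_solid)
        · exact (hd.meas_mom.norm.aemeasurable.pow_const 2).div hd.meas_rho.aemeasurable
        · refine hE2.trans (ENNReal.ofReal_le_ofReal ?_)
          nlinarith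
        · refine (hc.fluid (Ω \ solidAt B d.h₀) sdiff_subset K hK1 d.ρ₀
            (hd.meas_rho.aemeasurable.mono_measure hle) (ae_mono hle hd.rho_nonneg)
            (hE1.trans (ENNReal.ofReal_le_ofReal ?_))).2.1 w hw0 ?_
          · nlinarith
          · exact (ae_restrict_iff' (hΩ.diff hS)).2 (Eventually.of_forall fun x hx => hw x hx.1)

/-- As long as the heavy solid has not touched the floor, its weight is controlled by the energy. -/
lemma IsWeakSolution.weight_le (hs : IsWeakSolution Ω B M T d s) (hd : IsInitialData Ω B M d)
    (hb : UniformBounds Ω B M.γ β T s K') (hΩ : MeasurableSet Ω) (hB : IsCompact B) (hγ : 1 < M.γ)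
    (hcv : 0 < M.cv) (hρs : 0 < M.ρs) (hg : 0 ≤ M.g) (hm : m = solidMass B M) (hm0 : 0 < m)
    (hK1 : 1 ≤ K) (hK' : K' ≤ K) (hE : (4 + M.γ) * initialEnergy Ω B M d ≤ K)
    (h1 : 0 < T₁) (h12 : T₁ < T₂) (h2T : T₂ < T)
    (hsub : ∀ t ∈ Icc 0 T₂, solidAt B (s.h t) ⊆ Ω) (hA : 0 ≤ A)
    (hφ : IsAdaptedField Ω B s.h T T₁ T₂ (√(K / m)) A G φ ζ w)
    (hG0 : ∀ x, 0 ≤ G x) (hGm : Measurable G)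
    (hc : IsSliceConstant Ω G M.γ β A c) (hct : c ≠ ⊤) {V : ℝ} (hV0 : 0 ≤ V)
    (hV : ∀ s > 0, 0 ≤ M.μ s ∧ M.μ s ≤ V * (1 + s) ∧ 0 ≤ M.η s ∧ M.η s ≤ V * (1 + s)) :
    ENNReal.ofReal (M.g * m * T₁)
      ≤ ((2 + c) * (1 + ENNReal.ofReal (9 * A)) + ENNReal.ofReal (63 * V * A) * c
          + ENNReal.ofReal (M.g * A) * c + (2 + c))
        * (ENNReal.ofReal (1 + √m + 1 / √m) * ENNReal.ofReal (K ^ (1 / M.γ)) * ENNReal.ofReal K)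
        * (2 + ENNReal.ofReal T₂) := by
  obtain ⟨k, hk, hkh⟩ := hs.exists_continuous_height
  obtain ⟨Dz, hst, hDm, hD, hZ⟩ := hs.exists_ae_isState hb hK'
  have hF : ∀ r ≤ T, MeasurableSet (fluidCyl Ω B s.h r) := fun r hr =>
    measurableSet_fluidCyl hΩ hB.isClosed hk fun t ht => hkh t ⟨ht.1.le, ht.2.trans_le hr⟩
  have hI : Ioo 0 T₂ ⊆ Ioo 0 T := Ioo_subset_Ioo le_rfl h2T.le
  replace hst := ae_restrict_of_ae_restrict_of_subset hI hst
  replace hDm := hDm.mono_measure (Measure.restrict_mono hI le_rfl)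
  replace hD := (lintegral_mono_set hI).trans hD
  replace hZ := (lintegral_mono_set hI).trans hZ
  have hms : ∀ t, ENNReal.ofReal M.ρs * volume (solidAt B (s.h t)) = ENNReal.ofReal m := fun t => by
    rw [ofReal_mul_volume_solidAt hB hρs.le, hm]; rfl
  have hSm : ∀ t, MeasurableSet (solidAt B (s.h t)) := fun t =>
    (isClosed_solidAt hB.isClosed _).measurableSet
  have hγ0 : 0 < M.γ := by linarith
  have key := hs.exists_weight_le hΩ hB hg h12 h2T hF hsub hφ
  set S := ENNReal.ofReal (1 + √m + 1 / √m) with hS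
  set q := ENNReal.ofReal (K ^ (1 / M.γ)) with hq
  set k := ENNReal.ofReal K with hkdef
  set τ := ENNReal.ofReal T₂ with hτ
  have hsm : 0 < √m := Real.sqrt_pos.2 hm0
  have hinv : 0 < 1 / √m := by positivity
  have hq1 : 1 ≤ q := ENNReal.one_le_ofReal.2 (Real.one_le_rpow hK1 (by positivity))
  have hk1 : 1 ≤ k := ENNReal.one_le_ofReal.2 hK1
  have hS1 : 1 ≤ S := ENNReal.one_le_ofReal.2 (by linarith)
  have hvol : volume (Ioo 0 T₂) = τ := by rw [Real.volume_Ioo, sub_zero]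
  have b1 : ∫⁻ t in Ioo 0 T₂, ∫⁻ x in Ω, ‖s.ρ t x * inner ℝ (s.u t x) (dt φ (t, x))
          + s.ρ t x * ∑ i, ∑ j, s.u t x i * s.u t x j * gradMat φ (t, x) i j‖ₑ
      ≤ (2 + c) * (1 + ENNReal.ofReal (9 * A)) * S * q * (k + τ * k + k) := by
    calc _ ≤ ∫⁻ t in Ioo 0 T₂, (2 + c) * (1 + ENNReal.ofReal (9 * A)) * S * q
            * (‖deriv ζ t‖ₑ * k + k
              + ∫⁻ x in Ω, ENNReal.ofReal (‖s.u t x‖ ^ 2 + frob (s.Du t x) (s.Du t x))) := by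
          refine lintegral_mono_ae ?_
          filter_upwards [hst, ae_restrict_mem measurableSet_Ioo] with t ht htI
          have htc := Ioo_subset_Icc_self htI
          exact ht.lintegral_inertial_le hc hΩ (hSm t) (hsub t htc) hG0 hGm hA hK1 hγ0 hm0 (hms t) rfl
            (w := fun x => w (t, x)) (fun x => hφ.weight_nonneg _) (hφ.weight_cube_le t htc)
            (fun x hx => (hφ.solid t htc x hx).2.2.2) (hφ.dt_le t htc)
            (fun x hx => (hφ.solid t htc x hx).2.2.1) (hφ.grad_le t htc)
            (fun x hx => (hφ.solid t htc x hx).2.1)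
      _ ≤ _ := by
          rw [lintegral_const_mul' _ _ (by finiteness)]
          refine mul_le_mul_right ?_ _
          rw [lintegral_add_left (((measurable_deriv ζ).enorm.mul_const _).add_const _),
            lintegral_add_right _ measurable_const, lintegral_mul_const' _ _ ENNReal.ofReal_ne_top,
            setLIntegral_const, hvol]
          refine add_le_add (add_le_add ?_ (le_of_eq (mul_comm _ _))) hD
          exact mul_le_of_le_one_left' hφ.cutoff_variation
  have b2 : ∫⁻ t in Ioo 0 T₂, ∫⁻ x in Ω \ solidAt B (s.h t),
          ‖frob (M.stress (s.ϑ t x) (s.Du t x)) (gradMat φ (t, x))‖ₑ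
      ≤ ENNReal.ofReal (63 * V * A) * (c * (τ + k + k)) := by
    calc _ ≤ ∫⁻ t in Ioo 0 T₂, ENNReal.ofReal (63 * V * A) * (c * (1
            + (∫⁻ x in Ω, ENNReal.ofReal (‖s.u t x‖ ^ 2 + frob (s.Du t x) (s.Du t x)))
            + ∫⁻ x in Ω, ENNReal.ofReal ((s.ϑ t x ^ (β / 2)) ^ 2 + ‖Dz t x‖ ^ 2))) := by
          refine lintegral_mono_ae ?_
          filter_upwards [hst, ae_restrict_mem measurableSet_Ioo] with t ht htI
          exact ht.lintegral_viscous_le hc hΩ hA hV0 hV (hφ.grad_le t (Ioo_subset_Icc_self htI))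
      _ ≤ _ := by
          rw [lintegral_const_mul' _ _ ENNReal.ofReal_ne_top, lintegral_const_mul' _ _ hct]
          refine mul_le_mul_right (mul_le_mul_right ?_ _) _
          rw [lintegral_add_left' (hDm.const_add _), lintegral_add_left measurable_const,
            setLIntegral_const, hvol, one_mul]
          exact add_le_add (add_le_add le_rfl hD) hZ
  have b3 : ∫⁻ t in Ioo 0 T₂, ∫⁻ x in Ω \ solidAt B (s.h t),
          ‖s.ρ t x * inner ℝ (-M.g • e3) (φ (t, x))‖ₑ
      ≤ ENNReal.ofReal (M.g * A) * (c * q) * τ := by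
    calc _ ≤ ∫⁻ t in Ioo 0 T₂, ENNReal.ofReal (M.g * A) * (c * q) := by
          refine lintegral_mono_ae ?_
          filter_upwards [hst, ae_restrict_mem measurableSet_Ioo] with t ht htI
          have htc := Ioo_subset_Icc_self htI
          exact ht.lintegral_gravity_le hc hΩ (hSm t) hA hK1 hg fun x hx =>
            (hφ.norm_le_weight _).trans (hφ.weight_le t htc x hx)
      _ = _ := by rw [setLIntegral_const, hvol]
  have h0c : (0 : ℝ) ∈ Icc 0 T₂ := ⟨le_rfl, (h1.trans h12).le⟩
  have b4 : ∫⁻ x in Ω, ‖inner ℝ (d.m₀ x) (φ (0, x))‖ₑ ≤ (2 + c) * (S * k) := by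
    refine (hd.lintegral_momentum_le hΩ hB hγ hcv hρs hm hm0 hK1 hE (w := fun x => w (0, x))
      (fun x => hφ.weight_nonneg _) (hφ.weight_cube_le 0 h0c) (fun x hx => ?_) hc
      (fun x => hφ.norm_le_weight _)).trans (mul_le_mul_right ?_ _)
    · rw [← hs.height_init] at hx
      exact (hφ.solid 0 h0c x hx).2.2.2
    · rw [hS, hkdef, ← ENNReal.ofReal_mul (by positivity)]
      exact ENNReal.ofReal_le_ofReal (mul_le_mul_of_nonneg_right (by linarith) (by linarith))
  have e : ENNReal.ofReal (M.g * m * T₁)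
      = ENNReal.ofReal (M.g * M.ρs) * volume B * ENNReal.ofReal T₁ := by
    rw [← volume_solidAt B 0, ofReal_mul_volume_solidAt hB (by positivity),
      ← ENNReal.ofReal_mul (by positivity), hm, solidMass]
    congr 2; ring
  rw [e]
  refine key.trans ((add_le_add (add_le_add (add_le_add b1 b2) b3) b4).trans ?_)
  set X := S * q * k with hX
  have hSq : 1 ≤ S * q := one_le_mul hS1 hq1
  have x1 : k ≤ X := le_mul_of_one_le_left' hSq
  have x2 : 1 ≤ X := one_le_mul hSq hk1
  have x3 : q ≤ X := by
    rw [hX, mul_right_comm]; exact le_mul_of_one_le_left' (one_le_mul hS1 hk1)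
  have x4 : S * k ≤ X := by
    rw [hX, mul_right_comm]; exact le_mul_of_one_le_right' hq1
  have y1 : (2 + c) * (1 + ENNReal.ofReal (9 * A)) * S * q * (k + τ * k + k)
      = (2 + c) * (1 + ENNReal.ofReal (9 * A)) * (X * (2 + τ)) := by rw [hX]; ring
  have y2 : τ + k + k ≤ X * (2 + τ) := by
    calc τ + k + k ≤ X * τ + X + X := by
          gcongr
          exact le_mul_of_one_le_left' x2
      _ = _ := by ring
  have y3 : q * τ ≤ X * (2 + τ) := by
    gcongr
    exact le_add_self
  have y4 : S * k ≤ X * (2 + τ) :=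
    x4.trans (le_mul_of_one_le_right' (le_trans (by norm_num) le_self_add))
  calc _ ≤ (2 + c) * (1 + ENNReal.ofReal (9 * A)) * (X * (2 + τ))
        + ENNReal.ofReal (63 * V * A) * (c * (X * (2 + τ)))
        + ENNReal.ofReal (M.g * A) * c * (X * (2 + τ)) + (2 + c) * (X * (2 + τ)) := by
        rw [y1, ← mul_assoc (ENNReal.ofReal (M.g * A)) c q, mul_assoc _ q τ]
        gcongr
    _ = _ := by ring

end

section
open scoped NNReal ENNReal

/-! ### Collision in finite time -/

lemma CollisionGeometry.solidMass_pos {Ω B : Set E3} {α r₀ : ℝ} (hg : CollisionGeometry Ω B α r₀)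
    {M : Material} (hρs : 0 < M.ρs) : 0 < solidMass B M := by
  refine mul_pos hρs (ENNReal.toReal_pos ?_ hg.isCompact_body.measure_lt_top.ne)
  exact (Measure.measure_pos_of_nonempty_interior _ hg.interior_body_nonempty).ne'

/-- While the solid stays above the floor, the impulse of its weight is bounded by the energy, with a
constant that depends only on the geometry, on gravity and on the viscosities. -/
lemma CollisionGeometry.exists_impulse_bound {Ω B : Set E3} {α r₀ d₀ γ β g : ℝ} {μ η : ℝ → ℝ}
    (hgeom : CollisionGeometry Ω B α r₀) (hα : 0 < α) (hd₀ : 0 < d₀) (hg : 0 < g) (hγ : 3 < γ)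
    (hβ : 2 < β) (hαγ : α * (4 * γ + 3) < 3 * (γ - 3)) (hαβ : α * (9 * β + 2) < 3 * (β - 2))
    (hvisc : ViscosityLaw μ η) :
    ∃ C : ℝ, 0 ≤ C ∧ ∀ (M : Material), M.γ = γ → M.g = g → M.μ = μ → M.η = η → 0 < M.cv → 0 < M.ρs →
      ∀ (d : InitialData), IsInitialData Ω B M d →
      ∀ (K K' : ℝ), 1 ≤ K → K' ≤ K → (4 + γ) * initialEnergy Ω B M d ≤ K →
      ∀ (T : ℝ) (s : Motion), IsWeakSolution Ω B M T d s →
        (∀ t ∈ Ico 0 T, ∀ x ∈ solidAt B (s.h t), ∀ y ∈ frontier Ω \ floorSquare r₀,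
          d₀ ≤ dist x y) →
        UniformBounds Ω B γ β T s K' →
      ∀ (T₁ T₂ : ℝ), 0 < T₁ → T₁ < T₂ → T₂ < T → (∀ t ∈ Icc 0 T₂, 0 < s.h t) →
        g * solidMass B M * T₁ ≤ C * ((1 + √(solidMass B M) + 1 / √(solidMass B M))
          * K ^ (1 / γ) * K) * (2 + T₂) := by
  have hα1 : α < 1 := by
    by_contra hcon
    have : 1 * (9 * β + 2) ≤ α * (9 * β + 2) :=
      mul_le_mul_of_nonneg_right (not_lt.1 hcon) (by linarith)
    linarith
  obtain ⟨a, b, R, A, ha, hRa, hR, hb, hA, hfl, hfield⟩ := hgeom.exists_adaptedField hα hα1 hd₀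
  obtain ⟨c, hct, hc⟩ := exists_sliceConstant hgeom.container.isOpen hgeom.container.isBounded hα hb hR
    ha hRa hfl hA.le hγ hβ hαγ hαβ
  obtain ⟨V, hV0, hV⟩ := hvisc.exists_upper
  set Cc : ℝ≥0∞ := (2 + c) * (1 + ENNReal.ofReal (9 * A)) + ENNReal.ofReal (63 * V * A) * c
    + ENNReal.ofReal (g * A) * c + (2 + c) with hCc
  have hCt : Cc ≠ ⊤ := by rw [hCc]; finiteness
  have hΩ : MeasurableSet Ω := hgeom.container.isOpen.measurableSet
  have hB := hgeom.isCompact_body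
  refine ⟨Cc.toReal, ENNReal.toReal_nonneg, ?_⟩
  intro M hMγ hMg hMμ hMη hcv hρs d hd K K' hK hK' hE T s hs hdist hub T₁ T₂ h1 h12 h2T hpos
  have hm := hgeom.solidMass_pos (M := M) hρs
  set m := solidMass B M with hmdef
  have hIco : ∀ t ∈ Icc 0 T₂, t ∈ Ico 0 T := fun t ht => ⟨ht.1, ht.2.trans_lt h2T⟩
  have hsub : ∀ t ∈ Icc 0 T₂, solidAt B (s.h t) ⊆ Ω := fun t ht =>
    hgeom.solid_subset hd₀ (hpos t ht) (hdist t (hIco t ht)) (hs.solid_inside t (hIco t ht))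
  have hI : Ioo 0 T₂ ⊆ Ioo 0 T := Ioo_subset_Ioo le_rfl h2T.le
  have hspeed : ∀ᵐ t ∂volume.restrict (Ioo 0 T₂), |s.v t| ≤ √(K / m) := by
    filter_upwards [ae_restrict_of_ae_restrict_of_subset hI hs.rho_solid,
      ae_restrict_of_ae_restrict_of_subset hI hs.u_solid,
      ae_restrict_of_ae_restrict_of_subset hI hub.kinetic, ae_restrict_mem measurableSet_Ioo]
      with t k1 k2 k3 k4
    have h3 := mass_mul_speed_sq_le (by linarith : (0 : ℝ) ≤ K) hB hρs.le
      (hsub t (Ioo_subset_Icc_self k4)) k1 k2 (k3.trans (ENNReal.ofReal_le_ofReal hK'))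
    refine Real.abs_le_sqrt ?_
    rw [le_div_iff₀ hm, mul_comm]
    exact h3
  obtain ⟨φ, ζ, w, hφ⟩ := hfield s.h T T₁ T₂ (√(K / m)) h1 h12 h2T (Real.sqrt_nonneg _)
    (fun r hr t ht => abs_height_sub_le h2T hs.speed_int (by
      intro t ht; exact hs.height_eq t ht) hspeed hr ht) hpos
    (fun t ht => hs.solid_inside t (hIco t ht)) (fun t ht => hdist t (hIco t ht))
  subst hMγ hMg hMμ hMη
  have key := hs.weight_le hd hub hΩ hB (by linarith) hcv hρs hg.le hmdef hm hK hK' hE h1 h12 h2T hsub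
    hA.le hφ (fun x => by have := cusp_nonneg (α := α) (b := b) (R := R) x; linarith)
    (measurable_const.add measurable_cusp) hc hct hV0.le hV
  have hT2 : 0 < T₂ := h1.trans h12
  rw [← hCc, ← ENNReal.ofReal_toReal hCt, ← ENNReal.ofReal_mul (by positivity),
    ← ENNReal.ofReal_mul (by positivity), ← ENNReal.ofReal_mul ENNReal.toReal_nonneg,
    ← ENNReal.ofReal_ofNat 2, ← ENNReal.ofReal_add (by norm_num) hT2.le,
    ← ENNReal.ofReal_mul (by positivity), ENNReal.ofReal_le_ofReal_iff (by positivity)] at key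
  exact key

/-- The powers of the mass and of the energy in the impulse bound, divided by the weight, are
controlled by those of `collisionRatio`. -/
lemma impulse_div_le {C m N E γ g : ℝ} (hC : 0 ≤ C) (hm : 0 < m) (hN : 0 ≤ N) (hE : 0 ≤ E)
    (hγ : 0 < γ) (hg : 0 < g) :
    C * ((1 + √m + 1 / √m) * (N * (E + 1)) ^ (1 / γ) * (N * (E + 1))) / (g * m)
      ≤ C * (3 * (N ^ (1 + 1 / γ) * 2 ^ (1 / γ))) / g
        * (max (m ^ (-(1 / 2) : ℝ)) (m ^ (-(3 / 2) : ℝ)) * (1 + E ^ (1 + 1 / γ))) := by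
  have hγ1 : 0 < 1 / γ := by positivity
  set x := 1 / √m with hx
  have hsm : 0 < √m := Real.sqrt_pos.2 hm
  have hx0 : 0 < x := by positivity
  have hxm : x ^ 2 * m = 1 := by
    rw [hx, div_pow, one_pow, Real.sq_sqrt hm.le]; field_simp
  have hxs : x * √m = 1 := by rw [hx]; field_simp
  have e1 : m ^ (-(1 / 2) : ℝ) = x := by
    rw [Real.rpow_neg hm.le, ← Real.sqrt_eq_rpow, hx, one_div]
  have e2 : m ^ (-(3 / 2) : ℝ) = x ^ 3 := by
    rw [← e1, ← Real.rpow_natCast, ← Real.rpow_mul hm.le]; norm_num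
  have e3 : (1 + √m + x) / m = x ^ 2 + x + x ^ 3 := by
    rw [div_eq_iff hm.ne']
    have : √m = x * m := by
      calc √m = x ^ 2 * m * √m := by rw [hxm, one_mul]
        _ = x * m * (x * √m) := by ring
        _ = x * m := by rw [hxs, mul_one]
    rw [this]
    linear_combination (-(1 + x)) * hxm
  have hmax : (1 + √m + x) / m ≤ 3 * max x (x ^ 3) := by
    rw [e3]
    have h1 := le_max_left x (x ^ 3)
    have h2 := le_max_right x (x ^ 3)
    nlinarith [mul_nonneg hx0.le (sq_nonneg (x - 1))]
  have hpow : (N * (E + 1)) ^ (1 / γ) * (N * (E + 1))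
      ≤ N ^ (1 + 1 / γ) * 2 ^ (1 / γ) * (1 + E ^ (1 + 1 / γ)) := by
    have h1 : (N * (E + 1)) ^ (1 / γ) * (N * (E + 1)) = N ^ (1 + 1 / γ) * (E + 1) ^ (1 + 1 / γ) := by
      rw [← Real.mul_rpow hN (by linarith), add_comm 1 (1 / γ),
        Real.rpow_add_one' (by positivity) (by positivity)]
    have h3 : (E + 1) ^ (1 + 1 / γ) ≤ 2 ^ (1 / γ) * (E ^ (1 + 1 / γ) + 1) := by
      lift E to ℝ≥0 using hE
      have h2 := NNReal.rpow_add_le_mul_rpow_add_rpow E 1 (p := 1 + 1 / γ) (by linarith)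
      rw [add_sub_cancel_left, NNReal.one_rpow] at h2
      exact_mod_cast h2
    rw [h1, mul_assoc, add_comm 1 (E ^ _)]
    exact mul_le_mul_of_nonneg_left h3 (by positivity)
  rw [e1, e2]
  calc C * ((1 + √m + x) * (N * (E + 1)) ^ (1 / γ) * (N * (E + 1))) / (g * m)
      = C / g * ((1 + √m + x) / m * ((N * (E + 1)) ^ (1 / γ) * (N * (E + 1)))) := by
        field_simp
    _ ≤ C / g * (3 * max x (x ^ 3) * (N ^ (1 + 1 / γ) * 2 ^ (1 / γ) * (1 + E ^ (1 + 1 / γ)))) := by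
        gcongr
    _ = _ := by ring

end

theorem mainTheorem2 (Ω B : Set E3) (α r₀ d₀ γ β g : ℝ) (μ η : ℝ → ℝ) (Cb : ℝ)
    (hα : 0 < α) (hd₀ : 0 < d₀) (hg : 0 < g) (hγ : 3 < γ) (hβ : 2 < β)
    (hαmin : α < min (3 * (γ - 3) / (4 * γ + 3)) (3 * (β - 2) / (9 * β + 2)))
    (hgeom : CollisionGeometry Ω B α r₀) (hvisc : ViscosityLaw μ η) :
    ∃ C₀ : ℝ, 0 < C₀ ∧
      ∀ (M : Material), M.γ = γ → M.g = g → M.μ = μ → M.η = η → ConductivityLaw β M.κ →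
        0 < M.cv → 0 < M.ρs → SolidGibbs M.es M.ss →
      ∀ (d : InitialData), IsInitialData Ω B M d →
        collisionRatio Ω B M d C₀ < 1 →
      ∀ (T : ℝ), collisionRatio Ω B M d C₀ / (1 - collisionRatio Ω B M d C₀) < T →
      ∀ (s : Motion), IsWeakSolution Ω B M T d s →
        (∀ t ∈ Ico 0 T, ∀ x ∈ solidAt B (s.h t), ∀ y ∈ frontier Ω \ floorSquare r₀,
          d₀ ≤ dist x y) →
        UniformBounds Ω B γ β T s (Cb * (initialEnergy Ω B M d + 1)) →
        ∃ t : ℝ, 0 < t ∧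
          t ≤ collisionRatio Ω B M d C₀ / (1 - collisionRatio Ω B M d C₀) ∧
          (0 : E3) ∈ solidAt B (s.h t) ∩ frontier Ω := by
  have hγ0 : 0 < γ := by linarith
  have hαγ : α * (4 * γ + 3) < 3 * (γ - 3) := by
    rw [← lt_div_iff₀ (by linarith)]; exact hαmin.trans_le (min_le_left _ _)
  have hαβ : α * (9 * β + 2) < 3 * (β - 2) := by
    rw [← lt_div_iff₀ (by linarith)]; exact hαmin.trans_le (min_le_right _ _)
  obtain ⟨C, hC, himp⟩ := hgeom.exists_impulse_bound hα hd₀ hg hγ hβ hαγ hαβ hvisc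
  set N : ℝ := |Cb| + 4 + γ with hN
  have hN0 : 0 < N := by positivity
  set C' : ℝ := 3 * C * (3 * (N ^ (1 + 1 / γ) * 2 ^ (1 / γ))) / g with hC'
  have hC'0 : 0 ≤ C' := by positivity
  refine ⟨C' + 1, by positivity, ?_⟩
  intro M hMγ hMg hMμ hMη _ hcv hρs _ d hd hA1 T hT s hs hdist hub
  obtain ⟨hE0, -, -⟩ := hd.bounds hgeom.isCompact_body (by linarith) hcv hρs
  have hm := hgeom.solidMass_pos (M := M) hρs
  set A := collisionRatio Ω B M d (C' + 1) with hA
  set E := initialEnergy Ω B M d with hE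
  set m := solidMass B M with hmdef
  set Y := max (m ^ (-(1 / 2) : ℝ)) (m ^ (-(3 / 2) : ℝ)) * (1 + E ^ (1 + 1 / γ)) with hY
  have hY0 : 0 < Y := mul_pos (lt_max_of_lt_left (by positivity)) (by positivity)
  have hAY : A = (C' + 1) * Y := by
    rw [hA, collisionRatio, hMγ, hY, mul_assoc]
  have hA0 : 0 < A := by rw [hAY]; positivity
  set T₁ := A / (1 - A) with hT₁
  have h1A : 0 < 1 - A := by linarith
  have hT₁0 : 0 < T₁ := by positivity
  by_contra hcon
  push Not at hcon
  obtain ⟨k, hk, hkh⟩ := hs.exists_continuous_height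
  have hk0 : 0 < k 0 := by
    rw [hkh 0 ⟨le_rfl, hT₁0.trans hT⟩, hs.height_init]; exact hd.height_pos
  -- without a contact the height has no zero, hence it stays positive for a little longer
  have hpos : ∀ t ∈ Icc 0 T₁, 0 < k t := by
    intro t ht
    by_contra hneg
    obtain ⟨r, hr, hr0⟩ := intermediate_value_Icc' ht.1 hk.continuousOn ⟨not_lt.1 hneg, hk0.le⟩
    have hr1 : 0 < r := lt_of_le_of_ne hr.1 fun h => by rw [← h] at hr0; exact hk0.ne' hr0
    have hrT : r ≤ T₁ := hr.2.trans ht.2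
    refine hcon r hr1 hrT ⟨?_, hgeom.zero_mem_frontier⟩
    rw [← hkh r ⟨hr1.le, hrT.trans_lt hT⟩, hr0]
    exact hgeom.zero_mem_solid hα
  obtain ⟨δ, hδ, hδk⟩ := Metric.eventually_nhds_iff.1
    (hk.continuousAt.eventually_const_lt (hpos T₁ ⟨hT₁0.le, le_rfl⟩))
  -- the excess of `T₂` over `T₁` leaves time for the cutoff to decrease to zero
  obtain ⟨T₂, h12, h2⟩ := exists_between (lt_min (lt_min hT (lt_add_of_pos_right T₁ hδ))
    (lt_add_one T₁))
  rw [lt_min_iff, lt_min_iff] at h2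
  obtain ⟨⟨h2T, h2δ⟩, h21⟩ := h2
  have hpos2 : ∀ t ∈ Icc 0 T₂, 0 < s.h t := by
    intro t ht
    rw [← hkh t ⟨ht.1, ht.2.trans_lt h2T⟩]
    rcases le_or_gt t T₁ with h | h
    · exact hpos t ⟨ht.1, h⟩
    · refine hδk ?_
      rw [Real.dist_eq, abs_of_pos (by linarith)]
      linarith [ht.2]
  have hCbN : Cb * (E + 1) ≤ N * (E + 1) :=
    mul_le_mul_of_nonneg_right (by linarith [le_abs_self Cb]) (by linarith)
  have hNγ : 4 + γ ≤ N := by linarith [abs_nonneg Cb]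
  have hNE : 1 ≤ N * (E + 1) := one_le_mul_of_one_le_of_one_le (by linarith) (by linarith)
  have key := himp M hMγ hMg hMμ hMη hcv hρs d hd (N * (E + 1)) (Cb * (E + 1)) hNE hCbN
    (mul_le_mul hNγ (by linarith) hE0 hN0.le) T s hs hdist hub T₁ T₂ hT₁0 h12 h2T hpos2
  rw [← hmdef] at key
  have harith := impulse_div_le (C := 3 * C) (by positivity) hm hN0.le hE0 hγ0 hg
  rw [← hC', ← hY] at harith
  set Z := (1 + √m + 1 / √m) * (N * (E + 1)) ^ (1 / γ) * (N * (E + 1)) with hZ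
  have hZ0 : 0 ≤ Z := by positivity
  have hgm : 0 < g * m := mul_pos hg hm
  -- `1 + T₁ = 1 / (1 - A)`
  have h3 : (1 + T₁) * (1 - A) = 1 := by rw [hT₁]; field_simp; ring
  have h4 : T₁ * (1 - A) = A := by rw [hT₁]; field_simp
  -- since `T₂ ≤ T₁ + 1`, the impulse bound grows at most linearly in `1 + T₁`
  have h5 : g * m * T₁ ≤ 3 * C * Z * (1 + T₁) := by
    refine key.trans ?_
    have : C * Z * (2 + T₂) ≤ C * Z * (3 * (1 + T₁)) :=
      mul_le_mul_of_nonneg_left (by linarith) (by positivity)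
    linarith
  have h6 : g * m * A ≤ 3 * C * Z := by
    have := mul_le_mul_of_nonneg_right h5 h1A.le
    rw [mul_assoc, h4, mul_assoc _ (1 + T₁), h3, mul_one] at this
    exact this
  have h7 : A ≤ C' * Y := le_trans ((le_div_iff₀' hgm).2 h6) harith
  rw [hAY] at h7
  linarith
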